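/- **Theorem 1.5.** Fix $\alpha\in(0,1)$ and $r\in[1,2]$. *Setting.* Let $\nu,\mu,g>0$, $\Omega\in\mathbb R$ and $\mathcal N\ge 0$ with Prandtl number $P=\nu/\mu=1$. Consider the Cauchy problem of the viscous primitive equations on $\mathbb R^3$, $$\begin{cases}\partial_t u-\nu\Delta u+\Omega e_3\times u+(u\cdot\nabla)u+\nabla p=g\theta e_3,\\ \partial_t\theta-\mu\Delta\theta+(u\cdot\nabla)\theta=-\mathcal N^2u_3,\\ \operatorname{div}u=0,\qquad u|_{t=0}=u_0,\ \theta|_{t=0}=\theta_0.\end{cases}\tag{1}$$ Let $\mathscr S'_h=\mathscr S'(\mathbb R^3)/\mathcal P$ be the space of (complex) tempered distributions modulo polynomials. The Fourier transform is $\hat f(\xi)=\int e^{-2\pi i x\cdot\xi}f(x)\,dx$. Fix a radial Schwartz function $\psi$ with $\operatorname{supp}\hat\psi\subset\{\frac34\le|\xi|\le\frac83\}$ and $\sum_{j\in\mathbb Z}\hat\psi(2^{-j}\xi)=1$ for $\xi\ne0$, and put $\Delta_jf=2^{3j}\psi(2^j\cdot)*f$. For $s\in\mathbb R$ and $\delta\in[1,\infty]$,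 $F\dot B^s_{1,r}$ is the space of $f\in\mathscr S'_h$ with $$\|f\|_{F\dot B^s_{1,r}}=\big\|\{2^{js}\|\widehat{\Delta_jf}\|_{L^1}\}_{j\in\mathbb Z}\big\|_{\ell^r}<\infty,$$ and $\tilde L^\delta(0,T;F\dot B^s_{1,r})$ is the space of strongly measurable $f:(0,T)\to F\dot B^s_{1,r}$ with $\big\|\{2^{js}\|\widehat{\Delta_jf}\|_{L^\delta(0,T;L^1)}\}_{j}\big\|_{\ell^r}<\infty$. For $0<T\le\infty$ let $$Y^\alpha_T=\big[\tilde L^{\frac2{1+\alpha}}(0,T;F\dot B^{\alpha}_{1,r})\big]^4\cap\big[\tilde L^{\frac2{1-\alpha}}(0,T;F\dot B^{-\alpha}_{1,r})\big]^4 .$$ The norm of a vector is the sum of the norms of its components. A *mild solution* of (1) on a time interval $I=[0,T]$ or $I=[0,\infty)$ is $v=(u,\theta)$ satisfying, for all $t\in I$, $$v(t)=\mathcal T(t)(u_0,\theta_0)-\int_0^t\mathcal T(t-\tau)\,\widetilde{\mathbb P}\,\sum_{j=1}^3\partial_j\big(u_j v\big)(\tau)\,d\tau ,$$ read through the Fourier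 transform at almost every frequency. Here $\widetilde{\mathbb P}$ is the Helmholtz projection on the first three components and the identity on the fourth, and $\mathcal T(t)$ is the semigroup of the linear part of (1), that is the Fourier multiplier with symbol $\exp\!\big(-t\,[\,4\pi^2|\xi|^2\operatorname{diag}(\nu,\nu,\nu,\mu)+\widetilde{\mathbb P}(\xi)J\widetilde{\mathbb P}(\xi)]\big)$ with $J(u,\theta)=(\Omega e_3\times u-g\theta e_3,\ \mathcal N^2u_3)$. *(i) Local well-posedness.* For all such constants and all $(u_0,\theta_0)\in[F\dot B^{-1}_{1,r}]^4$ with $\operatorname{div}u_0=0$ there is $T>0$ such that (1) has a unique mild solution $(u,\theta)$ on $[0,T]$ in the class $[C([0,T],F\dot B^{-1}_{1,r})]^4\cap Y^\alpha_T$. *(ii) Global well-posedness for small data.* There is a constant $C>0$ depending only on $\alpha$, $r$ and $\psi$ (in particular not on $\nu$, $\mu$, $g$, $\Omega$, $\mathcal N$) such that for all such constants with $\mathcal N>0$ and all $(u_0,\theta_0)\in[F\dot B^{-1}_{1,r}]^4$ with $\operatorname{div}u_0=0$ and $$\|(u_0,\sqrt g\,\theta_0/\mathcal N)\|_{F\dot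 B^{-1}_{1,r}}\le C\nu ,$$ problem (1) has a unique mild solution on $[0,\infty)$ in the class $[C([0,\infty);F\dot B^{-1}_{1,r})]^4\cap Y^\alpha_\infty$. -/

import Mathlib

open MeasureTheory Filter Set Topology Distribution
open scoped SchwartzMap FourierTransform LineDeriv ENNReal

namespace PrimitiveEquations

noncomputable section

/-- The physical space `ℝ³` with its Euclidean norm; also the frequency space. The Fourier transform
is Mathlib's, with kernel `exp (-2πi x·ξ)`. -/
abbrev E := EuclideanSpace ℝ (Fin 3)

/-! ### Tempered distributions modulo polynomials -/

/-- The polynomials on `ℝ³` among the tempered distributions: they are exactly the tempered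
distributions whose Fourier transform is supported in the origin. -/
def polynomials : Submodule ℂ 𝓢'(E, ℂ) where
  carrier := {u | IsVanishingOn (𝓕 u : 𝓢'(E, ℂ)) ({0}ᶜ : Set E)}
  add_mem' := by
    intro u v hu hv φ hφ
    have h : (𝓕 (u + v) : 𝓢'(E, ℂ)) φ = (𝓕 u : 𝓢'(E, ℂ)) φ + (𝓕 v : 𝓢'(E, ℂ)) φ := rfl
    exact h.trans (by rw [hu φ hφ, hv φ hφ, add_zero])
  zero_mem' := fun _ _ => rfl
  smul_mem' := by
    intro c u hu φ hφ
    have h : (𝓕 (c • u) : 𝓢'(E, ℂ)) φ = c • (𝓕 u : 𝓢'(E, ℂ)) φ := rfl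
    exact h.trans (by rw [hu φ hφ, smul_zero])

/-- The space `𝓢'_h(ℝ³) = 𝓢'(ℝ³) / P[ℝ³]`. -/
abbrev HomDist := 𝓢'(E, ℂ) ⧸ polynomials

theorem lineDeriv_mem_polynomials (m : E) :
    polynomials ≤ polynomials.comap
      (LineDeriv.lineDerivOpCLM ℂ 𝓢'(E, ℂ) m : 𝓢'(E, ℂ) →L[ℂ] 𝓢'(E, ℂ)).toLinearMap := by
  intro u hu
  change IsVanishingOn (𝓕 (∂_{m} u : 𝓢'(E, ℂ)) : 𝓢'(E, ℂ)) ({0}ᶜ : Set E)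
  have hu' : IsVanishingOn (𝓕 u : 𝓢'(E, ℂ)) ({0}ᶜ : Set E) := hu
  rw [TemperedDistribution.fourier_lineDerivOp_eq]
  intro φ hφ
  have h := TemperedDistribution.IsVanishingOn.smulLeftCLM hu'
    (g := fun x : E => ((inner ℝ x m : ℝ) : ℂ)) (by fun_prop) φ hφ
  have h' : (2 * Real.pi * Complex.I : ℂ) •
      (TemperedDistribution.smulLeftCLM ℂ (fun x : E => ((inner ℝ x m : ℝ) : ℂ)) (𝓕 u)) φ = 0 := by
    rw [h, smul_zero]
  exact h'

/-- The partial derivative `∂_j` on `𝓢'_h(ℝ³)`. -/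
def partialDeriv (j : Fin 3) : HomDist →ₗ[ℂ] HomDist :=
  polynomials.mapQ polynomials _ (lineDeriv_mem_polynomials (EuclideanSpace.single j (1 : ℝ)))

/-- The divergence of a vector field with components in `𝓢'_h(ℝ³)`. -/
def divergence (u : Fin 3 → HomDist) : HomDist := ∑ j, partialDeriv j (u j)

/-! ### Littlewood-Paley blocks and Fourier-Besov norms -/

/-- A radial Schwartz function `ψ` whose Fourier transform is supported in the annulus
`3/4 ≤ |ξ| ≤ 8/3` and generates a homogeneous dyadic partition of unity. -/
structure LittlewoodPaley where
  ψ : 𝓢(E, ℂ)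
  radial : ∀ x y : E, ‖x‖ = ‖y‖ → ψ x = ψ y
  support : tsupport (𝓕 ψ : 𝓢(E, ℂ)) ⊆ {ξ : E | 3 / 4 ≤ ‖ξ‖ ∧ ‖ξ‖ ≤ 8 / 3}
  partition : ∀ ξ : E, ξ ≠ 0 → HasSum (fun j : ℤ => (𝓕 ψ : 𝓢(E, ℂ)) ((2 : ℝ) ^ (-j) • ξ)) 1

namespace LittlewoodPaley

/-- `ξ ↦ ψ̂(2^{-j} ξ)`, the Fourier transform of `ψ_j(x) = 2^{3j} ψ(2^j x)`. -/
def symbol (L : LittlewoodPaley) (j : ℤ) (ξ : E) : ℂ := (𝓕 L.ψ : 𝓢(E, ℂ)) ((2 : ℝ) ^ (-j) • ξ)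

theorem symbol_hasTemperateGrowth (L : LittlewoodPaley) (j : ℤ) :
    (L.symbol j).HasTemperateGrowth := by
  have h2 : (fun ξ : E => (2 : ℝ) ^ (-j) • ξ).HasTemperateGrowth := by fun_prop
  exact (SchwartzMap.hasTemperateGrowth (𝓕 L.ψ : 𝓢(E, ℂ))).comp h2

theorem zero_notMem_tsupport_symbol (L : LittlewoodPaley) (j : ℤ) :
    (0 : E) ∉ tsupport (L.symbol j) := by
  intro h
  have h1 : (2 : ℝ) ^ (-j) • (0 : E) ∈ tsupport (𝓕 L.ψ : 𝓢(E, ℂ)) :=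
    tsupport_comp_subset_preimage (𝓕 L.ψ : 𝓢(E, ℂ)) (f := fun ξ : E => (2 : ℝ) ^ (-j) • ξ)
      (by fun_prop) h
  have h2 := (L.support h1).1
  simp only [smul_zero, norm_zero] at h2
  norm_num at h2

theorem polynomials_le_ker (L : LittlewoodPaley) (j : ℤ) :
    polynomials ≤ LinearMap.ker
      (TemperedDistribution.fourierMultiplierCLM ℂ (L.symbol j)).toLinearMap := by
  intro u hu
  have hu' : IsVanishingOn (𝓕 u : 𝓢'(E, ℂ)) ({0}ᶜ : Set E) := hu
  rw [LinearMap.mem_ker]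
  change TemperedDistribution.fourierMultiplierCLM ℂ (L.symbol j) u = 0
  ext φ
  rw [TemperedDistribution.fourierMultiplierCLM_apply_apply]
  refine hu' _ ?_
  intro ξ hξ h0
  rw [mem_singleton_iff] at h0
  subst h0
  refine L.zero_notMem_tsupport_symbol j ?_
  refine closure_mono ?_ hξ
  intro η hη
  rw [Function.mem_support] at hη ⊢
  intro hz
  apply hη
  rw [SchwartzMap.smulLeftCLM_apply_apply (L.symbol_hasTemperateGrowth j), hz, zero_smul]

/-- The Littlewood-Paley block `Δ_j u = ψ_j ∗ u`, as a map `𝓢'_h(ℝ³) → 𝓢'(ℝ³)`. -/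
def block (L : LittlewoodPaley) (j : ℤ) : HomDist →ₗ[ℂ] 𝓢'(E, ℂ) :=
  polynomials.liftQ _ (L.polynomials_le_ker j)

end LittlewoodPaley

/-- The `L^p` norm of a tempered distribution: `∞` unless it is given by an `L^p` function. -/
def distLpNorm (p : ℝ≥0∞) [Fact (1 ≤ p)] (w : 𝓢'(E, ℂ)) : ℝ≥0∞ :=
  ⨅ (f : Lp ℂ p (volume : Measure E)) (_ : Lp.toTemperedDistribution f = w), ‖f‖ₑ

/-- `‖u‖_{FḂ^s_{p,r}}`, the `ℓ^r(ℤ)` norm of `2^{js} ‖𝓕(Δ_j u)‖_{L^p}`. -/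
def besovNorm (L : LittlewoodPaley) (s : ℝ) (p r : ℝ≥0∞) [Fact (1 ≤ p)] (u : HomDist) : ℝ≥0∞ :=
  eLpNorm (fun j : ℤ => (2 : ℝ≥0∞) ^ ((j : ℝ) * s) * distLpNorm p (𝓕 (L.block j u)))
    r Measure.count

/-- Membership in the Fourier-Besov space `FḂ^s_{p,r}(ℝ³)`. -/
def MemBesov (L : LittlewoodPaley) (s : ℝ) (p r : ℝ≥0∞) [Fact (1 ≤ p)] (u : HomDist) : Prop :=
  besovNorm L s p r u < ⊤

/-- `u ∈ C(I, FḂ^s_{p,r}(ℝ³))`. -/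
def ContinuousBesov (L : LittlewoodPaley) (s : ℝ) (p r : ℝ≥0∞) [Fact (1 ≤ p)] (I : Set ℝ)
    (u : ℝ → HomDist) : Prop :=
  ∀ t ∈ I, MemBesov L s p r (u t) ∧
    Tendsto (fun t' => besovNorm L s p r (u t' - u t)) (𝓝[I] t) (𝓝 0)

/-- Strong measurability of `u : I → FḂ^s_{p,r}(ℝ³)` (up to a null set of times): `u` takes values in
the space and is the limit, in its norm, of simple functions. -/
def StronglyMeasurableBesov (L : LittlewoodPaley) (s : ℝ) (p r : ℝ≥0∞) [Fact (1 ≤ p)] (I : Set ℝ)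
    (u : ℝ → HomDist) : Prop :=
  (∀ᵐ t ∂volume.restrict I, MemBesov L s p r (u t)) ∧
  ∃ φ : ℕ → SimpleFunc ℝ HomDist, (∀ n t, MemBesov L s p r (φ n t)) ∧
    ∀ᵐ t ∂volume.restrict I, Tendsto (fun n => besovNorm L s p r (φ n t - u t)) atTop (𝓝 0)

/-- The Chemin-Lerner norm: the `ℓ^r(ℤ)` norm of `2^{js} ‖𝓕(Δ_j u)‖_{L^δ(I; L^p)}`. -/
def cheminLernerNorm (L : LittlewoodPaley) (δ : ℝ≥0∞) (s : ℝ) (p r : ℝ≥0∞) [Fact (1 ≤ p)]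
    (I : Set ℝ) (u : ℝ → HomDist) : ℝ≥0∞ :=
  eLpNorm (fun j : ℤ => (2 : ℝ≥0∞) ^ ((j : ℝ) * s) *
      eLpNorm (fun t => distLpNorm p (𝓕 (L.block j (u t)))) δ (volume.restrict I))
    r Measure.count

/-- Membership in the Chemin-Lerner space `L̃^δ(I; FḂ^s_{p,r}(ℝ³))`. -/
def MemCheminLerner (L : LittlewoodPaley) (δ : ℝ≥0∞) (s : ℝ) (p r : ℝ≥0∞) [Fact (1 ≤ p)]
    (I : Set ℝ) (u : ℝ → HomDist) : Prop :=
  StronglyMeasurableBesov L s p r I u ∧ cheminLernerNorm L δ s p r I u < ⊤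

/-- The class `[C(I, FḂ^{-1}_{1,r})]⁴ ∩ [L̃^{2/(1+α)}(I; FḂ^α_{1,r})]⁴ ∩ [L̃^{2/(1-α)}(I; FḂ^{-α}_{1,r})]⁴`. -/
def SolutionClass (L : LittlewoodPaley) (α : ℝ) (r : ℝ≥0∞) (I : Set ℝ)
    (v : ℝ → Fin 4 → HomDist) : Prop :=
  ∀ i, ContinuousBesov L (-1) 1 r I (fun t => v t i) ∧
    MemCheminLerner L (ENNReal.ofReal (2 / (1 + α))) α 1 r I (fun t => v t i) ∧
    MemCheminLerner L (ENNReal.ofReal (2 / (1 - α))) (-α) 1 r I (fun t => v t i)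

/-! ### The primitive equations in mild form -/

/-- The physical constants: viscosity `ν`, diffusivity `μ`, gravity `g`, Coriolis parameter `Ω` and
stratification parameter `𝒩`. -/
structure Parameters where
  ν : ℝ
  μ : ℝ
  g : ℝ
  Ω : ℝ
  𝒩 : ℝ
  ν_pos : 0 < ν
  μ_pos : 0 < μ
  g_pos : 0 < g
  𝒩_nonneg : 0 ≤ 𝒩

/-- The frequency `(ξ₁, ξ₂, ξ₃, 0)`; times `2πi` it is the symbol of `(∂₁, ∂₂, ∂₃, 0)`. -/
def extFreq (ξ : E) : Fin 4 → ℂ := ![(ξ 0 : ℂ), (ξ 1 : ℂ), (ξ 2 : ℂ), 0]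

/-- The symbol of the Helmholtz projection acting on the first three components,
`δ_{jk} - ξ_j ξ_k / |ξ|²` for `j, k ≤ 3`, and of the identity on the fourth one. -/
def helmholtz (ξ : E) : Matrix (Fin 4) (Fin 4) ℂ :=
  1 - ((‖ξ‖ ^ 2)⁻¹ : ℂ) • Matrix.vecMulVec (extFreq ξ) (extFreq ξ)

/-- The symbol of the dissipation `(-νΔ, -νΔ, -νΔ, -μΔ)`. -/
def dissipation (P : Parameters) (ξ : E) : Matrix (Fin 4) (Fin 4) ℂ :=
  ((4 * Real.pi ^ 2 * ‖ξ‖ ^ 2 : ℝ) : ℂ) •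
    Matrix.diagonal ![(P.ν : ℂ), (P.ν : ℂ), (P.ν : ℂ), (P.μ : ℂ)]

/-- The zeroth order coupling `(u, θ) ↦ (Ω e₃ × u - g θ e₃, 𝒩² u₃)`. -/
def coupling (P : Parameters) : Matrix (Fin 4) (Fin 4) ℂ :=
  !![0, -(P.Ω : ℂ), 0, 0;
     (P.Ω : ℂ), 0, 0, 0;
     0, 0, 0, -(P.g : ℂ);
     0, 0, (P.𝒩 : ℂ) ^ 2, 0]

/-- The symbol at time `t` of the Stokes-Coriolis-Stratification semigroup, that is of the solution
operator on divergence-free fields of the linear problem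
`∂ₜu - νΔu + Ω e₃ × u + ∇p = g θ e₃`, `∂ₜθ - μΔθ = -𝒩² u₃`, `div u = 0`. -/
def semigroup (P : Parameters) (t : ℝ) (ξ : E) : Matrix (Fin 4) (Fin 4) ℂ :=
  NormedSpace.exp (-(t : ℂ) • (dissipation P ξ + helmholtz ξ * coupling P * helmholtz ξ))

/-- `f` is the Fourier transform of (some representative of) `u` away from the origin. It is
determined by `u` almost everywhere, and it determines `u` modulo polynomials. -/
def HasFourier (u : HomDist) (f : E → ℂ) : Prop :=
  LocallyIntegrableOn f ({0}ᶜ : Set E) ∧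
  ∃ w : 𝓢'(E, ℂ), (Submodule.Quotient.mk w : HomDist) = u ∧
    ∀ φ : 𝓢(E, ℂ), HasCompactSupport φ → tsupport φ ⊆ ({0}ᶜ : Set E) →
      𝓕 w φ = ∫ ξ, φ ξ * f ξ

/-- The Fourier transform of `(u·∇)(u, θ) = ∑_j ∂_j (u_j (u, θ))`, where `V = (û, θ̂)`; the Fourier
transform of a product is the convolution of the Fourier transforms. -/
def advection (V : E → Fin 4 → ℂ) (ξ : E) : Fin 4 → ℂ := fun k =>
  ∑ j, 2 * Real.pi * Complex.I * extFreq ξ j * ∫ η, V η j * V (ξ - η) k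

/-- `v = (u, θ)` is a mild solution with initial data `v₀` on the time interval `I` (which starts at
`0`): with `T(t)` the semigroup above and `ℙ` the Helmholtz projection on the first three components,
`v(t) = T(t) v₀ - ∫₀ᵗ T(t-τ) ℙ ∑_j ∂_j (v_j v)(τ) dτ` for all `t ∈ I`, on the Fourier side. -/
def IsMildSolution (P : Parameters) (I : Set ℝ) (v₀ : Fin 4 → HomDist)
    (v : ℝ → Fin 4 → HomDist) : Prop :=
  ∃ (V₀ : E → Fin 4 → ℂ) (V : ℝ → E → Fin 4 → ℂ),
    (∀ i, HasFourier (v₀ i) (fun ξ => V₀ ξ i)) ∧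
    (∀ t ∈ I, ∀ i, HasFourier (v t i) (fun ξ => V t ξ i)) ∧
    AEStronglyMeasurable (Function.uncurry V) ((volume.restrict I).prod volume) ∧
    ∀ t ∈ I, ∀ᵐ ξ : E,
      IntervalIntegrable
        (fun τ => (semigroup P (t - τ) ξ).mulVec ((helmholtz ξ).mulVec (advection (V τ) ξ)))
        volume 0 t ∧
      V t ξ = (semigroup P t ξ).mulVec (V₀ ξ) -
        ∫ τ in (0 : ℝ)..t,
          (semigroup P (t - τ) ξ).mulVec ((helmholtz ξ).mulVec (advection (V τ) ξ))

/-- There is one and only one mild solution on `I` in the solution class. -/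
def UniquelySolvable (L : LittlewoodPaley) (α : ℝ) (r : ℝ≥0∞) (P : Parameters) (I : Set ℝ)
    (v₀ : Fin 4 → HomDist) : Prop :=
  ∃ v : ℝ → Fin 4 → HomDist, (SolutionClass L α r I v ∧ IsMildSolution P I v₀ v) ∧
    ∀ v' : ℝ → Fin 4 → HomDist, SolutionClass L α r I v' ∧ IsMildSolution P I v₀ v' → EqOn v' v I

end

end PrimitiveEquations

open PrimitiveEquations

namespace PrimitiveEquations

noncomputable section

/-! Everything is done on the Fourier side, where elements of a Fourier-Besov space are functions on
`ℝ³ ∖ {0}` and products are convolutions. The fixed point is not sought in the solution class itself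
but in the larger space Z = L²(I; L¹) of functions of time and frequency, with norm `zNorm`. Three
facts make Z the right space.

Nonlinearity. Convolution maps L¹ × L¹ to L¹, so the advection term is |ξ| times a function whose
L¹(I; L¹) norm is controlled by the square of the Z norm. The heat kernel exp(-4π²ν|ξ|²t) has an L²
norm in time of order ν^(-1/2)|ξ|⁻¹, which absorbs the derivative exactly. By Minkowski's inequality
the Duhamel term is then a bounded quadratic map on Z (`zNorm_duhamel_sub_le_mul`), without any
paraproduct.

From the class to Z. The two Chemin-Lerner spaces have opposite regularities ±α and conjugate time
exponents 2/(1±α). Expanding the square of the sum over dyadic blocks and applying Hölder's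
inequality to each pair of blocks leaves a factor 2^(-α|k-l|), and Schur's test in ℓ² concludes
because r ≤ 2 (`zNorm_sq_le_freqTimeNorm`). Hence uniqueness in Z, which needs no smallness
(`picard_eq_of_ae_eq`), gives uniqueness in the class; and the free evolution of data in the
critical space lies in Z (`zNorm_semigroup_sq_le`).

From Z back to the class. A solution in Z has a forcing in L¹(I; L¹). Smoothing puts its Duhamel
term into all the Chemin-Lerner spaces with exponent 2/(1+s), -1 < s ≤ 1, and a majorant which is
uniform in time gives continuity by dominated convergence (`IsPicardSolution.solutionClass`).

The linear part is simple since for Prandtl number 1 the dissipation is scalar: the semigroup is the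
heat kernel times the exponential of a bounded matrix. On short times that exponential is merely
bounded, and the free evolution is small in Z by absolute continuity of the integral: this is (i).
In the unknowns (u, √g θ/𝒩) the matrix is skew-Hermitian and its exponential unitary
(`semigroupBound_energy`), so no constant depends on Ω, g or 𝒩. The Duhamel map and the free
evolution each cost ν^(-1/2), so smallness is measured against ν: this is (ii). -/

/-! ### Integral inequalities -/

section Minkowski

variable {α β : Type*} [MeasurableSpace α] [MeasurableSpace β]

/-- The step of Minkowski's integral inequality for a minorant with finite `L^p` norm. -/
theorem lintegral_rpow_le_of_le_lintegral {μ : Measure α} {ν : Measure β} [SFinite μ] [SFinite ν]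
    {f : α → β → ℝ≥0∞} (hf : Measurable (Function.uncurry f)) {p : ℝ} (hp : 1 ≤ p)
    {g : α → ℝ≥0∞} (hg : Measurable g) (hgf : ∀ a, g a ≤ ∫⁻ b, f a b ∂ν)
    (hfin : ∫⁻ a, g a ^ p ∂μ ≠ ∞) :
    (∫⁻ a, g a ^ p ∂μ) ^ (1 / p) ≤ ∫⁻ b, (∫⁻ a, f a b ^ p ∂μ) ^ (1 / p) ∂ν := by
  have hp0 : 0 < p := by linarith
  have hp1 : 1 / p ≤ 1 := by rw [div_le_one hp0]; exact hp
  set I := ∫⁻ a, g a ^ p ∂μ with hI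
  -- One factor `g` is replaced by the integral of `f`. After Tonelli, Hölder turns the remaining `g
  -- ^ (p - 1)` into `I ^ (1 - 1 / p)`, which is finite and can be divided out.
  have hpt : ∀ a, g a ^ p ≤ ∫⁻ b, g a ^ (p - 1) * f a b ∂ν := by
    intro a
    rw [lintegral_const_mul _ (by exact hf.of_uncurry_left)]
    calc g a ^ p = g a ^ (p - 1) * g a ^ (1 : ℝ) := by
          rw [← ENNReal.rpow_add_of_nonneg _ _ (by linarith) (by norm_num)]; ring_nf
      _ ≤ _ := by rw [ENNReal.rpow_one]; gcongr; exact hgf a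
  have h1 : I ≤ I ^ (1 - 1 / p) * ∫⁻ b, (∫⁻ a, f a b ^ p ∂μ) ^ (1 / p) ∂ν := by
    calc I ≤ ∫⁻ a, ∫⁻ b, g a ^ (p - 1) * f a b ∂ν ∂μ := lintegral_mono hpt
      _ = ∫⁻ b, ∫⁻ a, g a ^ (p - 1) * f a b ∂μ ∂ν := by
          apply lintegral_lintegral_swap
          exact (((hg.comp measurable_fst).pow_const _).mul hf).aemeasurable
      _ ≤ ∫⁻ b, I ^ (1 - 1 / p) * (∫⁻ a, f a b ^ p ∂μ) ^ (1 / p) ∂ν := by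
          apply lintegral_mono
          intro b
          have := ENNReal.lintegral_mul_norm_pow_le (μ := μ) (f := fun a => g a ^ p)
            (g := fun a => f a b ^ p) (hg.pow_const _).aemeasurable
            ((hf.of_uncurry_right (y := b)).pow_const _).aemeasurable
            (p := 1 - 1 / p) (q := 1 / p) (by linarith) (by positivity) (by ring)
          refine le_trans (le_of_eq ?_) this
          apply lintegral_congr
          intro a
          rw [← ENNReal.rpow_mul, ← ENNReal.rpow_mul, mul_one_div_cancel hp0.ne', ENNReal.rpow_one]
          congr 2
          field_simp
      _ = _ := by
          rw [lintegral_const_mul]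
          exact (Measurable.lintegral_prod_left' (hf.pow_const p)).pow_const _
  rcases eq_or_ne I 0 with h0 | h0
  · rw [h0, ENNReal.zero_rpow_of_pos (by positivity)]; exact zero_le
  · have h2 : I = I ^ (1 - 1 / p) * I ^ (1 / p) := by
      rw [← ENNReal.rpow_add _ _ h0 hfin]; simp
    have h3 : I ^ (1 - 1 / p) ≠ 0 := by
      simp [ENNReal.rpow_eq_zero_iff, h0, hfin]
    have h4 : I ^ (1 - 1 / p) ≠ ∞ := ENNReal.rpow_ne_top_of_nonneg (by linarith) hfin
    nth_rewrite 1 [h2] at h1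
    exact (ENNReal.mul_le_mul_iff_right h3 h4).1 h1

/-- **Minkowski's integral inequality**. -/
theorem lintegral_lintegral_rpow_le {μ : Measure α} {ν : Measure β} [SigmaFinite μ] [SFinite ν]
    {f : α → β → ℝ≥0∞} (hf : Measurable (Function.uncurry f)) {p : ℝ} (hp : 1 ≤ p) :
    (∫⁻ a, (∫⁻ b, f a b ∂ν) ^ p ∂μ) ^ (1 / p) ≤ ∫⁻ b, (∫⁻ a, f a b ^ p ∂μ) ^ (1 / p) ∂ν := by
  have hp0 : 0 < p := by linarith
  set G : α → ℝ≥0∞ := fun a => ∫⁻ b, f a b ∂ν with hG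
  have hGm : Measurable G := Measurable.lintegral_prod_right' hf
  -- Truncation in height and to sets of finite measure provides the finiteness which the division
  -- requires; monotone convergence removes it.
  let g : ℕ → α → ℝ≥0∞ := fun n => (spanningSets μ n).indicator (fun a => min (G a) n)
  have hgm : ∀ n, Measurable (g n) := fun n =>
    (hGm.min measurable_const).indicator (measurableSet_spanningSets μ n)
  have hmono : Monotone g := by
    intro n m hnm a
    refine (indicator_le_indicator_of_subset (f := fun a => min (G a) (n : ℝ≥0∞))
      (monotone_spanningSets μ hnm) (fun _ => bot_le) a).trans ?_
    refine indicator_le_indicator (min_le_min_left _ ?_)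
    exact_mod_cast hnm
  have hsup : ∀ a, ⨆ n, g n a ^ p = G a ^ p := by
    intro a
    have hlim : Tendsto (fun n => g n a) atTop (𝓝 (G a)) := by
      have h1 : Tendsto (fun n : ℕ => min (G a) (n : ℝ≥0∞)) atTop (𝓝 (min (G a) ∞)) :=
        tendsto_const_nhds.min ENNReal.tendsto_nat_nhds_top
      rw [min_eq_left le_top] at h1
      refine h1.congr' ?_
      filter_upwards [eventually_ge_atTop (spanningSetsIndex μ a)] with n hn
      simp only [g, indicator_of_mem (mem_spanningSets_of_index_le μ a hn)]
    refine iSup_eq_of_tendsto (fun n m h => ?_)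
      ((ENNReal.continuous_rpow_const.tendsto _).comp hlim)
    exact ENNReal.rpow_le_rpow (hmono h a) hp0.le
  have hmono' : Monotone fun n a => g n a ^ p :=
    fun n m h a => ENNReal.rpow_le_rpow (hmono h a) hp0.le
  have hfin : ∀ n, ∫⁻ a, g n a ^ p ∂μ ≠ ∞ := by
    intro n
    have : ∫⁻ a, g n a ^ p ∂μ ≤ ∫⁻ a, (spanningSets μ n).indicator (fun _ => (n : ℝ≥0∞) ^ p) a ∂μ := by
      apply lintegral_mono
      intro a
      by_cases ha : a ∈ spanningSets μ n
      · simp only [g, indicator_of_mem ha]; gcongr; exact min_le_right _ _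
      · simp only [g, indicator_of_notMem ha, ENNReal.zero_rpow_of_pos hp0, le_refl]
    rw [lintegral_indicator_const (measurableSet_spanningSets μ n)] at this
    refine ne_top_of_le_ne_top (ENNReal.mul_ne_top ?_ (measure_spanningSets_lt_top μ n).ne) this
    exact ENNReal.rpow_ne_top_of_nonneg hp0.le (ENNReal.natCast_ne_top n)
  have hle : ∫⁻ a, G a ^ p ∂μ ≤ (∫⁻ b, (∫⁻ a, f a b ^ p ∂μ) ^ (1 / p) ∂ν) ^ p := by
    simp_rw [← hsup]
    rw [lintegral_iSup (fun n => (hgm n).pow_const _) hmono']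
    refine iSup_le fun n => ?_
    have := lintegral_rpow_le_of_le_lintegral (μ := μ) (ν := ν) hf hp (hgm n) (fun a => ?_) (hfin n)
    · rw [← ENNReal.rpow_le_rpow_iff hp0, ← ENNReal.rpow_mul, one_div_mul_cancel hp0.ne',
        ENNReal.rpow_one] at this
      exact this
    · refine (indicator_le_self _ _ a).trans (min_le_left _ _)
  rw [← ENNReal.rpow_le_rpow_iff hp0, ← ENNReal.rpow_mul, one_div_mul_cancel hp0.ne',
    ENNReal.rpow_one]
  exact hle

end Minkowski

/-- The distance of two Bochner integrals is bounded by the integral of the distance, without any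
integrability assumption. -/
theorem enorm_integral_sub_integral_le {α F : Type*} [MeasurableSpace α] [NormedAddCommGroup F]
    [NormedSpace ℝ F] {μ : Measure α} {f g : α → F} (hf : AEStronglyMeasurable f μ)
    (hg : AEStronglyMeasurable g μ) :
    ‖∫ a, f a ∂μ - ∫ a, g a ∂μ‖ₑ ≤ ∫⁻ a, ‖f a - g a‖ₑ ∂μ := by
  by_cases h : ∫⁻ a, ‖f a - g a‖ₑ ∂μ = ∞
  · rw [h]; exact le_top
  have hi : Integrable (f - g) μ := ⟨hf.sub hg, lt_top_iff_ne_top.2 h⟩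
  by_cases hfi : Integrable f μ
  · have hgi : Integrable g μ := by simpa using hfi.sub hi
    rw [← integral_sub hfi hgi]
    exact enorm_integral_le_lintegral_enorm _
  -- The difference is integrable, so `f` and `g` fail to be integrable together, and both integrals
  -- take the default value 0.
  · have hgi : ¬ Integrable g μ := fun hgi => hfi (by simpa using hi.add hgi)
    rw [integral_undef hfi, integral_undef hgi]
    simp

/-! ### A uniqueness criterion -/

theorem sq_lintegral_mul_le {α : Type*} [MeasurableSpace α] {μ : Measure α} {f g : α → ℝ≥0∞}
    (hf : AEMeasurable f μ) (hg : AEMeasurable g μ) :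
    (∫⁻ a, f a * g a ∂μ) ^ 2 ≤ (∫⁻ a, f a ^ 2 ∂μ) * ∫⁻ a, g a ^ 2 ∂μ := by
  have h := ENNReal.lintegral_mul_norm_pow_le (hf.pow_const 2) (hg.pow_const 2)
    (p := 1 / 2) (q := 1 / 2) (by norm_num) (by norm_num) (by norm_num)
  have hs : ∀ x : ℝ≥0∞, (x ^ 2) ^ (1 / 2 : ℝ) = x := by
    intro x
    rw [← ENNReal.rpow_natCast, ← ENNReal.rpow_mul]; norm_num
  simp only [hs] at h
  calc _ ≤ _ := pow_le_pow_left' h 2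
    _ = _ := by
      have hs' : ∀ x : ℝ≥0∞, (x ^ (1 / 2 : ℝ)) ^ 2 = x := by
        intro x
        rw [← ENNReal.rpow_natCast, ← ENNReal.rpow_mul]; norm_num
      rw [mul_pow, hs', hs']

/-- A continuation argument: let `c` be the last time up to which `w` vanishes. On `[0, b]` with `b
> c` only `[c, b]` contributes to the right-hand side, and Cauchy-Schwarz bounds it by `K ∫_c^b n²`
times `∫_0^b w²`. For `b` close to `c` the first factor is less than 1, so `w` vanishes beyond `c`.
In the application `w` is the L¹ norm of a difference of solutions and `n` the sum of their norms.
-/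
theorem setLIntegral_sq_eq_zero_of_le {w n : ℝ → ℝ≥0∞} (hw : Measurable w) (hn : Measurable n)
    {T : ℝ} (hT : 0 ≤ T) {K : ℝ≥0∞} (hK : K ≠ ∞) (hwT : ∫⁻ t in Icc 0 T, w t ^ 2 ≠ ∞)
    (hnT : ∫⁻ t in Icc 0 T, n t ^ 2 ≠ ∞)
    (h : ∀ b ∈ Icc 0 T, ∫⁻ t in Icc 0 b, w t ^ 2 ≤ K * (∫⁻ t in Icc 0 b, w t * n t) ^ 2) :
    ∫⁻ t in Icc 0 T, w t ^ 2 = 0 := by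
  let S : Set ℝ := {b | b ∈ Icc 0 T ∧ ∫⁻ t in Icc 0 b, w t ^ 2 = 0}
  have hS0 : (0 : ℝ) ∈ S := ⟨⟨le_rfl, hT⟩, by simp⟩
  have hSb : BddAbove S := ⟨T, fun b hb => hb.1.2⟩
  set c := sSup S with hc
  have hc0 : 0 ≤ c := le_csSup hSb hS0
  have hcT : c ≤ T := csSup_le ⟨0, hS0⟩ fun b hb => hb.1.2
  have hcS : ∫⁻ t in Icc 0 c, w t ^ 2 = 0 := by
    obtain ⟨u, -, hu, huS⟩ := exists_seq_tendsto_sSup ⟨0, hS0⟩ hSb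
    have h1 : ∫⁻ t in ⋃ k, Icc 0 (u k), w t ^ 2 = 0 :=
      le_antisymm ((lintegral_iUnion_le _ _).trans (by simp [(huS _).2])) zero_le
    -- The supremum need not be attained a priori: the intervals `[0, u k]` may miss the point `c`,
    -- which is a null set.
    have hsub : Icc 0 c ≤ᵐ[volume] ⋃ k, Icc 0 (u k) := by
      have hne : ∀ᵐ t : ℝ, t ≠ c := by simp [ae_iff]
      filter_upwards [hne] with t htc ht
      have htlt : t < c := lt_of_le_of_ne ht.2 htc
      obtain ⟨k, hk⟩ := (hu.eventually (lt_mem_nhds htlt)).exists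
      exact mem_iUnion.2 ⟨k, ht.1, hk.le⟩
    exact le_antisymm ((lintegral_mono' (Measure.restrict_mono_ae hsub) le_rfl).trans h1.le)
      zero_le
  rcases hcT.eq_or_lt with hcT' | hcT'
  · rw [← hcT']; exact hcS
  exfalso
  -- The threshold is chosen so that `K * (K + 1)⁻¹ < 1`.
  obtain ⟨δ, hδ, hsmall⟩ := exists_pos_setLIntegral_lt_of_measure_lt hnT
    (ε := (K + 1)⁻¹) (by simp [hK])
  obtain ⟨b, hcb, hbT, hbδ⟩ : ∃ b, c < b ∧ b ≤ T ∧ volume (Icc c b) < δ := by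
    rcases eq_or_ne δ ∞ with rfl | hδt
    · exact ⟨T, hcT', le_rfl, by simp⟩
    · have hδ' : 0 < δ.toReal := ENNReal.toReal_pos hδ.ne' hδt
      refine ⟨min T (c + δ.toReal / 2), lt_min hcT' (by linarith), min_le_left _ _, ?_⟩
      rw [Real.volume_Icc, ENNReal.ofReal_lt_iff_lt_toReal _ hδt]
      · linarith [min_le_right T (c + δ.toReal / 2)]
      · linarith [lt_min hcT' (show c < c + δ.toReal / 2 by linarith)]
  have hb : b ∈ Icc 0 T := ⟨hc0.trans hcb.le, hbT⟩
  have hn2 : ∫⁻ t in Icc c b, n t ^ 2 < (K + 1)⁻¹ := by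
    have := hsmall _ ((Measure.restrict_apply_le _ _).trans_lt hbδ)
    rwa [Measure.restrict_restrict measurableSet_Icc,
      inter_eq_left.2 (Icc_subset_Icc hc0 hbT)] at this
  have hw0 : ∫⁻ t in Icc 0 c, w t * n t = 0 := by
    refine (lintegral_eq_zero_iff (hw.mul hn)).2 ?_
    rw [lintegral_eq_zero_iff (hw.pow_const 2)] at hcS
    filter_upwards [hcS] with t ht
    have : w t = 0 := by simpa using ht
    simp [this]
  have hsplit : ∫⁻ t in Icc 0 b, w t * n t ≤ ∫⁻ t in Icc c b, w t * n t := by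
    rw [← Icc_union_Icc_eq_Icc hc0 hcb.le]
    refine (lintegral_union_le _ _ _).trans ?_
    rw [hw0, zero_add]
  have hW : ∫⁻ t in Icc 0 b, w t ^ 2 ≠ ∞ :=
    ne_top_of_le_ne_top hwT (lintegral_mono_set (Icc_subset_Icc le_rfl hbT))
  have hfinal : ∫⁻ t in Icc 0 b, w t ^ 2 ≤ (K * (K + 1)⁻¹) * ∫⁻ t in Icc 0 b, w t ^ 2 := by
    calc _ ≤ _ := h b hb
      _ ≤ K * ((∫⁻ t in Icc c b, w t ^ 2) * ∫⁻ t in Icc c b, n t ^ 2) := by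
          gcongr
          exact (pow_le_pow_left' hsplit 2).trans
            (sq_lintegral_mul_le hw.aemeasurable hn.aemeasurable)
      _ ≤ K * ((∫⁻ t in Icc 0 b, w t ^ 2) * (K + 1)⁻¹) := by
          gcongr
      _ = _ := by ring
  have hb0 : ∫⁻ t in Icc 0 b, w t ^ 2 = 0 := by
    by_contra hne
    have hlt : K * (K + 1)⁻¹ < 1 := by
      rw [← div_eq_mul_inv, ENNReal.div_lt_iff (by simp) (by simp [hK]), one_mul]
      exact ENNReal.lt_add_right hK one_ne_zero
    have := ENNReal.mul_lt_mul_left hne hW hlt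
    rw [one_mul] at this
    exact absurd hfinal (not_le.2 this)
  exact absurd (le_csSup hSb ⟨hb, hb0⟩) (not_le.2 hcb)

/-! ### Sequence spaces -/

theorem eLpNorm_count_eq (f : ℤ → ℝ≥0∞) {p : ℝ≥0∞} (hp0 : p ≠ 0) (hp : p ≠ ∞) :
    eLpNorm f p Measure.count = (∑' k, f k ^ p.toReal) ^ (1 / p.toReal) := by
  rw [eLpNorm_eq_lintegral_rpow_enorm_toReal hp0 hp, lintegral_count]
  simp

theorem eLpNorm_count_rpow (f : ℤ → ℝ≥0∞) {p : ℝ≥0∞} (hp0 : p ≠ 0) (hp : p ≠ ∞) :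
    eLpNorm f p Measure.count ^ p.toReal = ∑' k, f k ^ p.toReal := by
  rw [eLpNorm_count_eq f hp0 hp, ← ENNReal.rpow_mul,
    one_div_mul_cancel (ENNReal.toReal_pos hp0 hp).ne', ENNReal.rpow_one]

theorem le_eLpNorm_count (f : ℤ → ℝ≥0∞) {p : ℝ≥0∞} (hp0 : p ≠ 0) (k : ℤ) :
    f k ≤ eLpNorm f p Measure.count := by
  simpa using enorm_le_eLpNorm_count f k hp0

/-- Every term is at most the ℓ^p norm `S`, so `f ^ q ≤ S ^ (q - p) * f ^ p`. This is used to pass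
from ℓ^r to ℓ² when `r ≤ 2`, and from ℓ¹ to ℓ^r. -/
theorem eLpNorm_count_le_of_exponent_le (f : ℤ → ℝ≥0∞) {p q : ℝ≥0∞} (hp0 : p ≠ 0) (hpq : p ≤ q)
    (hq : q ≠ ∞) : eLpNorm f q Measure.count ≤ eLpNorm f p Measure.count := by
  have hp : p ≠ ∞ := ne_top_of_le_ne_top hq hpq
  have hq0 : q ≠ 0 := (hp0.bot_lt.trans_le hpq).ne'
  have hqr : 0 < q.toReal := ENNReal.toReal_pos hq0 hq
  have hpr : 0 < p.toReal := ENNReal.toReal_pos hp0 hp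
  have hpq' : p.toReal ≤ q.toReal := ENNReal.toReal_mono hq hpq
  rw [← ENNReal.rpow_le_rpow_iff hqr, eLpNorm_count_rpow f hq0 hq]
  set S := eLpNorm f p Measure.count
  calc ∑' k, f k ^ q.toReal ≤ ∑' k, S ^ (q.toReal - p.toReal) * f k ^ p.toReal := by
        apply ENNReal.tsum_le_tsum
        intro k
        calc f k ^ q.toReal = f k ^ (q.toReal - p.toReal) * f k ^ p.toReal := by
              rw [← ENNReal.rpow_add_of_nonneg _ _ (by linarith) hpr.le]; ring_nf
          _ ≤ _ := by gcongr; exact le_eLpNorm_count f hp0 k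
    _ = S ^ (q.toReal - p.toReal) * S ^ p.toReal := by
        rw [ENNReal.tsum_mul_left, eLpNorm_count_rpow f hp0 hp]
    _ = S ^ q.toReal := by
        rw [← ENNReal.rpow_add_of_nonneg _ _ (by linarith) hpr.le]; ring_nf

theorem eLpNorm_count_one (f : ℤ → ℝ≥0∞) : eLpNorm f 1 Measure.count = ∑' k, f k := by
  rw [eLpNorm_count_eq f one_ne_zero ENNReal.one_ne_top]; simp

theorem eLpNorm_count_mono {f g : ℤ → ℝ≥0∞} (p : ℝ≥0∞) (h : ∀ k, f k ≤ g k) :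
    eLpNorm f p Measure.count ≤ eLpNorm g p Measure.count :=
  eLpNorm_mono_enorm (by simpa using h)

theorem eLpNorm_count_const_mul (c : ℝ≥0∞) (f : ℤ → ℝ≥0∞) {p : ℝ≥0∞} (hp0 : p ≠ 0) (hp : p ≠ ∞) :
    eLpNorm (fun k => c * f k) p Measure.count = c * eLpNorm f p Measure.count := by
  have hpr : 0 < p.toReal := ENNReal.toReal_pos hp0 hp
  rw [eLpNorm_count_eq _ hp0 hp, eLpNorm_count_eq _ hp0 hp]
  simp_rw [ENNReal.mul_rpow_of_nonneg _ _ hpr.le]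
  rw [ENNReal.tsum_mul_left, ENNReal.mul_rpow_of_nonneg _ _ (by positivity), ← ENNReal.rpow_mul,
    mul_one_div_cancel hpr.ne', ENNReal.rpow_one]

theorem eLpNorm_count_sum_le {ι : Type*} (s : Finset ι) (f : ι → ℤ → ℝ≥0∞) {p : ℝ≥0∞}
    (hp : 1 ≤ p) :
    eLpNorm (fun k => ∑ i ∈ s, f i k) p Measure.count ≤
      ∑ i ∈ s, eLpNorm (f i) p Measure.count := by
  classical
  induction s using Finset.induction_on with
  | empty => simp
  | insert a s ha ih =>
    simp_rw [Finset.sum_insert ha]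
    refine (eLpNorm_add_le (f := f a) (g := fun k => ∑ i ∈ s, f i k)
      (measurable_from_top.aestronglyMeasurable) (measurable_from_top.aestronglyMeasurable) hp).trans ?_
    gcongr

theorem lintegral_mul_le_eLpNorm_mul_eLpNorm {α : Type*} [MeasurableSpace α] {μ : Measure α}
    {f g : α → ℝ≥0∞} (hf : AEMeasurable f μ) (hg : AEMeasurable g μ) {p q : ℝ}
    (hpq : p.HolderConjugate q) :
    ∫⁻ a, f a * g a ∂μ ≤ eLpNorm f (ENNReal.ofReal p) μ * eLpNorm g (ENNReal.ofReal q) μ := by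
  have h := ENNReal.lintegral_mul_le_Lp_mul_Lq μ hpq hf hg
  rw [eLpNorm_eq_lintegral_rpow_enorm_toReal (by simpa using hpq.pos) (by simp),
    eLpNorm_eq_lintegral_rpow_enorm_toReal (by simpa using hpq.symm.pos) (by simp),
    ENNReal.toReal_ofReal hpq.nonneg, ENNReal.toReal_ofReal hpq.symm.nonneg]
  simpa using h

/-- The sum `∑_m 2^{-σ|m|}`. -/
def geomConst (σ : ℝ) : ℝ≥0∞ := ∑' m : ℤ, (2 : ℝ≥0∞) ^ (-(σ * |(m : ℝ)|))

theorem geomConst_ne_top {σ : ℝ} (hσ : 0 < σ) : geomConst σ ≠ ∞ := by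
  have hlt : (2 : ℝ≥0∞) ^ (-σ) < 1 := ENNReal.rpow_lt_one_of_one_lt_of_neg (by norm_num) (by linarith)
  have hnat : ∑' m : ℕ, (2 : ℝ≥0∞) ^ (-(σ * (m : ℝ))) ≠ ∞ := by
    have : ∀ m : ℕ, (2 : ℝ≥0∞) ^ (-(σ * (m : ℝ))) = ((2 : ℝ≥0∞) ^ (-σ)) ^ m := by
      intro m
      rw [← ENNReal.rpow_natCast, ← ENNReal.rpow_mul]; ring_nf
    simp_rw [this]
    rw [ENNReal.tsum_geometric]
    simp [tsub_eq_zero_iff_le, hlt]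
  have hle : geomConst σ ≤ ∑' m : ℕ, (2 : ℝ≥0∞) ^ (-(σ * (m : ℝ))) +
      ∑' m : ℕ, (2 : ℝ≥0∞) ^ (-(σ * (m : ℝ))) := by
    have key : ∀ m : ℤ, (2 : ℝ≥0∞) ^ (-(σ * |(m : ℝ)|)) ≤
        ∑' n : ℕ, (if (n : ℤ) = m then (2 : ℝ≥0∞) ^ (-(σ * (n : ℝ))) else 0) +
        ∑' n : ℕ, (if -(n : ℤ) = m then (2 : ℝ≥0∞) ^ (-(σ * (n : ℝ))) else 0) := by
      intro m
      rcases Int.eq_nat_or_neg m with ⟨n, rfl | rfl⟩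
      · refine le_add_right (le_trans ?_ (ENNReal.le_tsum n))
        simp
      · refine le_add_left (le_trans ?_ (ENNReal.le_tsum n))
        simp
    refine (ENNReal.tsum_le_tsum key).trans (le_of_eq ?_)
    rw [ENNReal.tsum_add, ENNReal.tsum_comm]
    nth_rewrite 2 [ENNReal.tsum_comm]
    simp only [tsum_ite_eq']
  exact ne_top_of_le_ne_top (ENNReal.add_ne_top.2 ⟨hnat, hnat⟩) hle

theorem tsum_mul_shift_le (A B : ℤ → ℝ≥0∞) (m : ℤ) :
    ∑' k, B k * A (k + m) ≤ eLpNorm B 2 Measure.count * eLpNorm A 2 Measure.count := by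
  have h := lintegral_mul_le_eLpNorm_mul_eLpNorm (μ := (Measure.count : Measure ℤ)) (f := B)
    (g := fun k => A (k + m)) measurable_from_top.aemeasurable measurable_from_top.aemeasurable
    (p := 2) (q := 2) Real.HolderConjugate.two_two
  rw [lintegral_count] at h
  refine h.trans (le_of_eq ?_)
  have h2 : ENNReal.ofReal 2 = 2 := by simp
  rw [h2, eLpNorm_count_eq (fun k => A (k + m)) (by norm_num) (by norm_num),
    eLpNorm_count_eq A (by norm_num) (by norm_num)]
  congr 2
  exact (Equiv.addRight m).tsum_eq fun k => A k ^ (2 : ℝ≥0∞).toReal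

/-- Discrete Schur test for the kernel `2^{-σ|k-l|}`. -/
theorem tsum_tsum_geom_le (A B : ℤ → ℝ≥0∞) (σ : ℝ) :
    ∑' k : ℤ, ∑' l : ℤ, (2 : ℝ≥0∞) ^ (-(σ * |(l : ℝ) - k|)) * (B k * A l) ≤
      geomConst σ * (eLpNorm B 2 Measure.count * eLpNorm A 2 Measure.count) := by
  have h1 : ∀ k : ℤ, ∑' l : ℤ, (2 : ℝ≥0∞) ^ (-(σ * |(l : ℝ) - k|)) * (B k * A l) =
      ∑' m : ℤ, (2 : ℝ≥0∞) ^ (-(σ * |(m : ℝ)|)) * (B k * A (k + m)) := by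
    intro k
    rw [← (Equiv.addLeft k).tsum_eq]
    simp
  simp_rw [h1]
  rw [ENNReal.tsum_comm]
  simp_rw [ENNReal.tsum_mul_left]
  rw [geomConst, ← ENNReal.tsum_mul_right]
  gcongr with m
  exact tsum_mul_shift_le A B m

/-- A sum of functions which is controlled in two Chemin-Lerner norms of opposite regularity and
conjugate time exponents is square integrable in time. -/
theorem lintegral_sq_tsum_le {α : Type*} [MeasurableSpace α] {μ : Measure α} {a : ℤ → α → ℝ≥0∞}
    (ha : ∀ k, AEMeasurable (a k) μ) {p q : ℝ} (hpq : p.HolderConjugate q) (σ : ℝ) :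
    ∫⁻ x, (∑' k, a k x) ^ 2 ∂μ ≤ 2 * geomConst σ *
      (eLpNorm (fun k : ℤ => (2 : ℝ≥0∞) ^ ((k : ℝ) * -σ) * eLpNorm (a k) (ENNReal.ofReal q) μ) 2
          Measure.count *
        eLpNorm (fun k : ℤ => (2 : ℝ≥0∞) ^ ((k : ℝ) * σ) * eLpNorm (a k) (ENNReal.ofReal p) μ) 2
          Measure.count) := by
  set A : ℤ → ℝ≥0∞ := fun k => (2 : ℝ≥0∞) ^ ((k : ℝ) * σ) * eLpNorm (a k) (ENNReal.ofReal p) μ with hA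
  set B : ℤ → ℝ≥0∞ := fun k => (2 : ℝ≥0∞) ^ ((k : ℝ) * -σ) * eLpNorm (a k) (ENNReal.ofReal q) μ with hB
  have h2 : (2 : ℝ≥0∞) ≠ 0 := by norm_num
  have h2' : (2 : ℝ≥0∞) ≠ ∞ := by norm_num
  -- Hölder in time with `a k` in L^q and `a l` in L^p; the weights contained in `B k` and `A l`
  -- have to be compensated by `2 ^ (-σ(l - k))`.
  have hone : ∀ k l : ℤ, ∫⁻ x, a k x * a l x ∂μ ≤ (2 : ℝ≥0∞) ^ (-(σ * ((l : ℝ) - k))) * (B k * A l) := by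
    intro k l
    refine (lintegral_mul_le_eLpNorm_mul_eLpNorm (ha k) (ha l) hpq.symm).trans (le_of_eq ?_)
    calc _ = ((2 : ℝ≥0∞) ^ (-(σ * ((l : ℝ) - k))) * ((2 : ℝ≥0∞) ^ ((k : ℝ) * -σ) *
            (2 : ℝ≥0∞) ^ ((l : ℝ) * σ))) *
          (eLpNorm (a k) (ENNReal.ofReal q) μ * eLpNorm (a l) (ENNReal.ofReal p) μ) := by
          rw [← ENNReal.rpow_add _ _ h2 h2', ← ENNReal.rpow_add _ _ h2 h2']
          ring_nf
          simp
      _ = _ := by simp only [hA, hB]; ring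
  -- The larger of the two indices receives the norm of regularity `σ`, so that the exponent is
  -- always `-σ|l - k|`.
  have hkl : ∀ k l : ℤ, ∫⁻ x, a k x * a l x ∂μ ≤
      (2 : ℝ≥0∞) ^ (-(σ * |(l : ℝ) - k|)) * (B k * A l) +
        (2 : ℝ≥0∞) ^ (-(σ * |(k : ℝ) - l|)) * (B l * A k) := by
    intro k l
    rcases le_total (k : ℝ) l with h | h
    · refine le_add_right ((hone k l).trans ?_)
      rw [abs_of_nonneg (by linarith)]
    · refine le_add_left ?_
      rw [abs_of_nonneg (by linarith)]
      simp_rw [mul_comm (a k _)]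
      exact hone l k
  calc ∫⁻ x, (∑' k, a k x) ^ 2 ∂μ = ∑' k, ∑' l, ∫⁻ x, a k x * a l x ∂μ := by
        have : ∀ x, (∑' k, a k x) ^ 2 = ∑' k, ∑' l, a k x * a l x := by
          intro x
          rw [sq, ← ENNReal.tsum_mul_right]
          simp_rw [ENNReal.tsum_mul_left]
        simp_rw [this]
        have hm : ∀ k l, AEMeasurable (fun x => a k x * a l x) μ := fun k l => (ha k).mul (ha l)
        rw [lintegral_tsum fun k => AEMeasurable.tsum (hm k)]
        congr 1; ext k
        rw [lintegral_tsum (hm k)]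
    _ ≤ ∑' k : ℤ, ∑' l : ℤ, ((2 : ℝ≥0∞) ^ (-(σ * |(l : ℝ) - k|)) * (B k * A l) +
        (2 : ℝ≥0∞) ^ (-(σ * |(k : ℝ) - l|)) * (B l * A k)) :=
        ENNReal.tsum_le_tsum fun k => ENNReal.tsum_le_tsum fun l => hkl k l
    _ = (∑' k : ℤ, ∑' l : ℤ, (2 : ℝ≥0∞) ^ (-(σ * |(l : ℝ) - k|)) * (B k * A l)) +
        ∑' k : ℤ, ∑' l : ℤ, (2 : ℝ≥0∞) ^ (-(σ * |(l : ℝ) - k|)) * (B k * A l) := by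
        simp_rw [ENNReal.tsum_add]
        congr 1
        rw [ENNReal.tsum_comm]
    _ ≤ geomConst σ * (eLpNorm B 2 Measure.count * eLpNorm A 2 Measure.count) +
        geomConst σ * (eLpNorm B 2 Measure.count * eLpNorm A 2 Measure.count) :=
        add_le_add (tsum_tsum_geom_le A B σ) (tsum_tsum_geom_le A B σ)
    _ = _ := by ring

/-! ### Littlewood-Paley symbols -/

namespace LittlewoodPaley

variable (L : LittlewoodPaley)

theorem continuous_symbol (j : ℤ) : Continuous (L.symbol j) :=
  (L.symbol_hasTemperateGrowth j).1.continuous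

theorem exists_norm_symbol_le : ∃ C : ℝ, 0 ≤ C ∧ ∀ j ξ, ‖L.symbol j ξ‖ ≤ C :=
  ⟨_, apply_nonneg _ _, fun _ _ => SchwartzMap.norm_le_seminorm ℝ (𝓕 L.ψ : 𝓢(E, ℂ)) _⟩

/-- The closed dyadic annulus which carries the `j`-th symbol. -/
def annulus (j : ℤ) : Set E := {ξ | 3 / 4 * (2 : ℝ) ^ j ≤ ‖ξ‖ ∧ ‖ξ‖ ≤ 8 / 3 * (2 : ℝ) ^ j}

theorem isClosed_annulus (j : ℤ) : IsClosed (annulus j) :=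
  (isClosed_le continuous_const continuous_norm).inter (isClosed_le continuous_norm continuous_const)

theorem isCompact_annulus (j : ℤ) : IsCompact (annulus j) :=
  (isCompact_closedBall (0 : E) (8 / 3 * (2 : ℝ) ^ j)).of_isClosed_subset (isClosed_annulus j)
    fun ξ hξ => by simpa using hξ.2

theorem annulus_subset_compl_zero (j : ℤ) : annulus j ⊆ ({0}ᶜ : Set E) := by
  intro ξ hξ h0
  rw [mem_singleton_iff] at h0
  have h1 := hξ.1
  rw [h0, norm_zero] at h1
  have : (0 : ℝ) < 2 ^ j := by positivity
  linarith

theorem mem_annulus_of_symbol_ne_zero {j : ℤ} {ξ : E} (h : L.symbol j ξ ≠ 0) : ξ ∈ annulus j := by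
  have h1 := L.support (subset_tsupport _ (Function.mem_support.2 h))
  have h2 : (0 : ℝ) < 2 ^ j := by positivity
  simp only [mem_ofPred_eq, norm_smul, zpow_neg, norm_inv, Real.norm_of_nonneg h2.le] at h1
  rw [inv_mul_eq_div, le_div_iff₀ h2, div_le_iff₀ h2] at h1
  exact h1

theorem symbol_eq_zero {j : ℤ} {ξ : E} (h : ξ ∉ annulus j) : L.symbol j ξ = 0 := by
  by_contra h0
  exact h (L.mem_annulus_of_symbol_ne_zero h0)

theorem tsupport_symbol_subset (j : ℤ) : tsupport (L.symbol j) ⊆ annulus j :=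
  closure_minimal (fun _ h => L.mem_annulus_of_symbol_ne_zero h) (isClosed_annulus j)

theorem hasCompactSupport_symbol (j : ℤ) : HasCompactSupport (L.symbol j) :=
  (isCompact_annulus j).of_isClosed_subset (isClosed_tsupport _) (L.tsupport_symbol_subset j)

/-- Annuli whose indices differ by 2 or more are disjoint, because `4 · 3/4 > 8/3`. Hence at most
the three symbols of index `k - 1`, `k`, `k + 1` are nonzero at a point of the `k`-th annulus. -/
theorem index_le_of_mem_annulus {j k : ℤ} {ξ : E} (hj : ξ ∈ annulus j) (hk : ξ ∈ annulus k) :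
    j ≤ k + 1 := by
  by_contra h
  have h1 : k + 2 ≤ j := by omega
  have h2 : (2 : ℝ) ^ (k + 2) ≤ 2 ^ j := zpow_le_zpow_right₀ (by norm_num) h1
  rw [zpow_add₀ (by norm_num)] at h2
  have h3 : (0 : ℝ) < 2 ^ k := by positivity
  have := hj.1.trans hk.2
  norm_num at h2
  linarith

theorem symbol_eq_zero_of_notMem {k : ℤ} {ξ : E} (hk : ξ ∈ annulus k) {j : ℤ}
    (hj : j ∉ Finset.Icc (k - 1) (k + 1)) : L.symbol j ξ = 0 := by
  apply L.symbol_eq_zero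
  intro h
  apply hj
  rw [Finset.mem_Icc]
  have h1 := index_le_of_mem_annulus h hk
  have h2 := index_le_of_mem_annulus hk h
  omega

theorem exists_symbol_ne_zero {ξ : E} (hξ : ξ ≠ 0) : ∃ j, L.symbol j ξ ≠ 0 := by
  by_contra! h
  have := L.partition ξ hξ
  change HasSum (fun j => L.symbol j ξ) 1 at this
  simp_rw [h] at this
  exact zero_ne_one (hasSum_zero.unique this)

theorem sum_symbol_eq_one {ξ : E} (hξ : ξ ≠ 0) {J : Finset ℤ} (hJ : ∀ j ∉ J, L.symbol j ξ = 0) :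
    ∑ j ∈ J, L.symbol j ξ = 1 :=
  (hasSum_sum_of_ne_finset_zero hJ).unique (L.partition ξ hξ)

/-- The symbols need not be nonnegative, so the partition of unity gives only a lower bound for the
sum of their moduli. That bound is what controls an L¹ norm by the sum over the blocks. -/
theorem one_le_tsum_enorm_symbol {ξ : E} (hξ : ξ ≠ 0) : 1 ≤ ∑' j, ‖L.symbol j ξ‖ₑ := by
  obtain ⟨k, hk⟩ := L.exists_symbol_ne_zero hξ
  have h := L.sum_symbol_eq_one hξ
    fun j hj => L.symbol_eq_zero_of_notMem (L.mem_annulus_of_symbol_ne_zero hk) hj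
  calc (1 : ℝ≥0∞) = ‖∑ j ∈ Finset.Icc (k - 1) (k + 1), L.symbol j ξ‖ₑ := by rw [h]; simp
    _ ≤ ∑ j ∈ Finset.Icc (k - 1) (k + 1), ‖L.symbol j ξ‖ₑ := enorm_sum_le _ _
    _ ≤ _ := ENNReal.sum_le_tsum _

theorem exists_tsum_enorm_symbol_le : ∃ C : ℝ≥0∞, C ≠ ∞ ∧ ∀ ξ, ∑' j, ‖L.symbol j ξ‖ₑ ≤ C := by
  obtain ⟨C, hC, h⟩ := L.exists_norm_symbol_le
  refine ⟨3 * ENNReal.ofReal C, by finiteness, fun ξ => ?_⟩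
  by_cases hξ : ∃ k, L.symbol k ξ ≠ 0
  · obtain ⟨k, hk⟩ := hξ
    rw [tsum_eq_sum (s := Finset.Icc (k - 1) (k + 1)) fun j hj => by
      rw [L.symbol_eq_zero_of_notMem (L.mem_annulus_of_symbol_ne_zero hk) hj, enorm_zero]]
    refine (Finset.sum_le_card_nsmul _ _ (ENNReal.ofReal C) fun j _ => ?_).trans (le_of_eq ?_)
    · rw [← ofReal_norm]; exact ENNReal.ofReal_le_ofReal (h j ξ)
    · have : (k + 1 + 1 - (k - 1)).toNat = 3 := by omega
      simp [this]
  · push Not at hξ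
    simp [hξ]

theorem two_rpow_intCast_mul (j : ℤ) (s : ℝ) :
    (2 : ℝ≥0∞) ^ ((j : ℝ) * s) = ENNReal.ofReal ((2 : ℝ) ^ j) ^ s := by
  rw [ENNReal.rpow_mul, ← Real.rpow_intCast, ← ENNReal.ofReal_rpow_of_pos (by norm_num)]
  simp

theorem rpow_le_four_rpow_mul {x y : ℝ≥0∞} (h1 : x ≤ 4 * y)
    (h2 : y ≤ 4 * x) (s : ℝ) : x ^ s ≤ 4 ^ |s| * y ^ s := by
  rcases le_total 0 s with hs | hs
  · rw [abs_of_nonneg hs, ← ENNReal.mul_rpow_of_nonneg _ _ hs]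
    exact ENNReal.rpow_le_rpow h1 hs
  · rw [abs_of_nonpos hs]
    have h3 : x⁻¹ ≤ 4 * y⁻¹ := by
      rw [← ENNReal.inv_le_inv, inv_inv, ENNReal.mul_inv (by simp) (by simp), inv_inv, mul_comm,
        ← div_eq_mul_inv]
      exact ENNReal.div_le_of_le_mul' h2
    calc x ^ s = x⁻¹ ^ (-s) := by rw [ENNReal.inv_rpow, ENNReal.rpow_neg, inv_inv]
      _ ≤ (4 * y⁻¹) ^ (-s) := ENNReal.rpow_le_rpow h3 (by linarith)
      _ = 4 ^ (-s) * y ^ s := by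
        rw [ENNReal.mul_rpow_of_nonneg _ _ (by linarith), ENNReal.inv_rpow, ENNReal.rpow_neg y,
          inv_inv]

/-- The factor 4 is a common upper bound for `8/3` and `(3/4)⁻¹`. -/
theorem enorm_comparable {j : ℤ} {ξ : E} (h : ξ ∈ annulus j) :
    ‖ξ‖ₑ ≤ 4 * ENNReal.ofReal ((2 : ℝ) ^ j) ∧ ENNReal.ofReal ((2 : ℝ) ^ j) ≤ 4 * ‖ξ‖ₑ := by
  have h3 : (0 : ℝ) < 2 ^ j := by positivity
  have h4 : (4 : ℝ≥0∞) = ENNReal.ofReal 4 := by simp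
  rw [← ofReal_norm, h4, ← ENNReal.ofReal_mul (by norm_num), ← ENNReal.ofReal_mul (by norm_num)]
  exact ⟨ENNReal.ofReal_le_ofReal (by linarith [h.2]), ENNReal.ofReal_le_ofReal (by linarith [h.1])⟩

theorem two_rpow_mul_enorm_symbol_le (j : ℤ) (s : ℝ) (ξ : E) :
    (2 : ℝ≥0∞) ^ ((j : ℝ) * s) * ‖L.symbol j ξ‖ₑ ≤ 4 ^ |s| * ‖ξ‖ₑ ^ s * ‖L.symbol j ξ‖ₑ := by
  by_cases h : ξ ∈ annulus j
  · gcongr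
    rw [two_rpow_intCast_mul]
    exact rpow_le_four_rpow_mul (enorm_comparable h).2 (enorm_comparable h).1 s
  · simp [L.symbol_eq_zero h]

theorem enorm_rpow_mul_enorm_symbol_le (j : ℤ) (s : ℝ) (ξ : E) :
    ‖ξ‖ₑ ^ s * ‖L.symbol j ξ‖ₑ ≤ 4 ^ |s| * (2 : ℝ≥0∞) ^ ((j : ℝ) * s) * ‖L.symbol j ξ‖ₑ := by
  by_cases h : ξ ∈ annulus j
  · gcongr
    rw [two_rpow_intCast_mul]
    exact rpow_le_four_rpow_mul (enorm_comparable h).1 (enorm_comparable h).2 s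
  · simp [L.symbol_eq_zero h]

theorem measurable_enorm_symbol (j : ℤ) : Measurable fun ξ => ‖L.symbol j ξ‖ₑ :=
  (L.continuous_symbol j).enorm.measurable

end LittlewoodPaley

section

open scoped ContDiff

/-! ### Cutoff of Schwartz functions -/

/-- The complement of a smooth cutoff, its derivatives being dominated by the distance to `0`. -/
theorem exists_smooth_cutoff : ∃ g : E → ℂ, ContDiff ℝ ∞ g ∧ HasCompactSupport (fun x => 1 - g x) ∧
    ∀ n : ℕ, ∃ B : ℝ, 0 ≤ B ∧ ∀ x, ‖iteratedFDeriv ℝ n g x‖ ≤ B * ‖x‖ := by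
  let b : ContDiffBump (0 : E) := ⟨1, 2, one_pos, by norm_num⟩
  let χ : E → ℂ := fun x => ((b x : ℝ) : ℂ)
  have hχ : ContDiff ℝ ∞ χ := Complex.ofRealCLM.contDiff.comp b.contDiff
  have hχc : HasCompactSupport χ := b.hasCompactSupport.comp_left (g := fun x : ℝ => (x : ℂ)) rfl
  let g : E → ℂ := fun x => 1 - χ x
  have hg : ContDiff ℝ ∞ g := contDiff_const.sub hχ
  refine ⟨g, hg, by simpa [g] using hχc, fun n => ?_⟩
  obtain ⟨B, hB⟩ : ∃ B, ∀ x, ‖iteratedFDeriv ℝ n g x‖ ≤ B := by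
    have h1 : ∃ B, ∀ x, ‖iteratedFDeriv ℝ n χ x‖ ≤ B :=
      (hχ.continuous_iteratedFDeriv (m := n) (mod_cast le_top)).bounded_above_of_compact_support
        (hχc.iteratedFDeriv n)
    obtain ⟨B, hB⟩ := h1
    refine ⟨‖(1 : ℂ)‖ + B, fun x => ?_⟩
    have h2 : iteratedFDeriv ℝ n g x = iteratedFDeriv ℝ n (fun _ : E => (1 : ℂ)) x -
        iteratedFDeriv ℝ n χ x := by
      exact iteratedFDeriv_sub_apply (f := fun _ : E => (1 : ℂ)) (g := χ) contDiff_const.contDiffAt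
        (hχ.of_le (mod_cast le_top)).contDiffAt
    rw [h2]
    refine (norm_sub_le _ _).trans (add_le_add ?_ (hB x))
    rcases Nat.eq_zero_or_pos n with rfl | hn
    · rw [norm_iteratedFDeriv_zero]
    · rw [iteratedFDeriv_const_of_ne hn.ne']; simp
  refine ⟨max B 0, le_max_right _ _, fun x => ?_⟩
  -- `g` vanishes on the unit ball, and outside of it a bounded derivative is dominated by a
  -- multiple of `‖x‖`.
  by_cases hx : ‖x‖ < 1
  · have hev : g =ᶠ[𝓝 x] fun _ => (0 : ℂ) := by
      have : ∀ᶠ y in 𝓝 x, ‖y‖ < 1 := (continuous_norm.tendsto x).eventually (gt_mem_nhds hx)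
      filter_upwards [this] with y hy
      have : b y = 1 := b.one_of_mem_closedBall (by simpa [b] using hy.le)
      simp [g, χ, this]
    have h0 : iteratedFDeriv ℝ n g x = 0 := by
      rw [(hev.iteratedFDeriv (𝕜 := ℝ) n).self_of_nhds]
      rw [iteratedFDeriv_fun_zero]; rfl
    rw [h0, norm_zero]; positivity
  · push Not at hx
    calc _ ≤ B := hB x
      _ ≤ max B 0 * 1 := by rw [mul_one]; exact le_max_left _ _
      _ ≤ _ := by gcongr

/-- A Schwartz function is a limit of compactly supported ones with no larger support. -/
theorem exists_seq_hasCompactSupport_tendsto (φ : 𝓢(E, ℂ)) :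
    ∃ u : ℕ → 𝓢(E, ℂ), (∀ n, HasCompactSupport (u n)) ∧ (∀ n, tsupport (u n) ⊆ tsupport φ) ∧
      Tendsto u atTop (𝓝 φ) := by
  obtain ⟨g, hg, hgc, hB⟩ := exists_smooth_cutoff
  choose B hB0 hB using hB
  -- The approximants are `(1 - g (ε x)) φ`. The error `g (ε x) φ` is `O(ε)` in every seminorm: the
  -- bound of `g` by `‖x‖` produces `ε ‖x‖`, and the factor `‖x‖` is paid for by one more power in
  -- the weight of the seminorm of `φ`.
  let ε : ℕ → ℝ := fun n => 1 / ((n : ℝ) + 1)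
  have hε0 : ∀ n, 0 < ε n := fun n => by positivity
  have hε1 : ∀ n, ε n ≤ 1 := fun n => by
    rw [div_le_one (by positivity)]; linarith [(Nat.cast_nonneg n : (0 : ℝ) ≤ n)]
  let A : ℕ → E →L[ℝ] E := fun n => ε n • ContinuousLinearMap.id ℝ E
  have hA : ∀ n, ‖A n‖ ≤ 1 := by
    intro n
    refine (norm_smul_le (ε n) (ContinuousLinearMap.id ℝ E)).trans ?_
    rw [Real.norm_of_nonneg (hε0 n).le]
    calc _ ≤ 1 * (1 : ℝ) := by gcongr; exacts [hε1 n, ContinuousLinearMap.norm_id_le]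
      _ = 1 := one_mul 1
  let G : ℕ → E → ℂ := fun n x => g (A n x)
  have hG : ∀ n, ContDiff ℝ ∞ (G n) := fun n => hg.comp (A n).contDiff
  have hGd : ∀ n i x, ‖iteratedFDeriv ℝ i (G n) x‖ ≤ B i * (ε n * ‖x‖) := by
    intro n i x
    have h1 : iteratedFDeriv ℝ i (G n) x =
        (iteratedFDeriv ℝ i g (A n x)).compContinuousLinearMap fun _ => A n :=
      (A n).iteratedFDeriv_comp_right hg x (mod_cast le_top)
    rw [h1]
    refine (ContinuousMultilinearMap.norm_compContinuousLinearMap_le _ _).trans ?_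
    calc _ ≤ (B i * ‖A n x‖) * 1 := by
          gcongr
          · exact mul_nonneg (hB0 i) (norm_nonneg _)
          · exact hB i _
          · exact Finset.prod_le_one (fun _ _ => norm_nonneg _) fun _ _ => hA n
      _ = _ := by simp [A, norm_smul, abs_of_pos (hε0 n)]
  have hcs : ∀ n, HasCompactSupport fun x => (1 - G n x) * φ x := by
    intro n
    have : HasCompactSupport fun x => 1 - G n x := by
      let e : E ≃ₜ E := Homeomorph.smulOfNeZero (ε n) (hε0 n).ne'
      exact hgc.comp_homeomorph e
    exact this.mul_right
  have hsm : ∀ n, ContDiff ℝ ∞ fun x => (1 - G n x) * φ x := fun n =>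
    (contDiff_const.sub (hG n)).mul (φ.smooth ⊤)
  refine ⟨fun n => (hcs n).toSchwartzMap (hsm n), hcs, fun n => ?_, ?_⟩
  · exact closure_mono fun x hx h => hx (by simp [h])
  rw [(schwartz_withSeminorms ℝ E ℂ).tendsto_nhds _ _]
  rintro ⟨k, m⟩ δ hδ
  let C : ℝ := ∑ i ∈ Finset.range (m + 1),
    (m.choose i : ℝ) * B i * SchwartzMap.seminorm ℝ (k + 1) (m - i) φ
  have hC : 0 ≤ C := Finset.sum_nonneg fun i _ =>
    mul_nonneg (mul_nonneg (by positivity) (hB0 i)) (apply_nonneg _ _)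
  have hbound : ∀ n, SchwartzMap.seminorm ℝ k m ((hcs n).toSchwartzMap (hsm n) - φ) ≤ ε n * C := by
    intro n
    refine SchwartzMap.seminorm_le_bound ℝ k m _ (mul_nonneg (hε0 n).le hC) fun x => ?_
    have hfun : (((hcs n).toSchwartzMap (hsm n) - φ : 𝓢(E, ℂ)) : E → ℂ) =
        fun x => -(G n x * φ x) := by
      ext x; simp; ring
    rw [hfun]
    have hneg : ‖iteratedFDeriv ℝ m (fun x => -(G n x * φ x)) x‖ =
        ‖iteratedFDeriv ℝ m (fun x => G n x * φ x) x‖ := by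
      have : (fun x => -(G n x * φ x)) = -(fun x => G n x * φ x) := rfl
      rw [this, iteratedFDeriv_neg_apply, norm_neg]
    rw [hneg]
    calc ‖x‖ ^ k * ‖iteratedFDeriv ℝ m (fun x => G n x * φ x) x‖
        ≤ ‖x‖ ^ k * ∑ i ∈ Finset.range (m + 1), (m.choose i : ℝ) *
          ‖iteratedFDeriv ℝ i (G n) x‖ * ‖iteratedFDeriv ℝ (m - i) φ x‖ := by
          gcongr
          exact norm_iteratedFDeriv_mul_le (hG n) (φ.smooth ⊤) x (mod_cast le_top)
      _ ≤ ‖x‖ ^ k * ∑ i ∈ Finset.range (m + 1), (m.choose i : ℝ) *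
          (B i * (ε n * ‖x‖)) * ‖iteratedFDeriv ℝ (m - i) φ x‖ := by
          gcongr with i hi
          exact hGd n i x
      _ = ε n * ∑ i ∈ Finset.range (m + 1), (m.choose i : ℝ) * B i *
          (‖x‖ ^ (k + 1) * ‖iteratedFDeriv ℝ (m - i) φ x‖) := by
          rw [Finset.mul_sum, Finset.mul_sum]
          refine Finset.sum_congr rfl fun i _ => ?_
          ring
      _ ≤ ε n * C := by
          refine mul_le_mul_of_nonneg_left ?_ (hε0 n).le
          · refine Finset.sum_le_sum fun i _ => ?_
            refine mul_le_mul_of_nonneg_left ?_ (mul_nonneg (by positivity) (hB0 i))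
            exact SchwartzMap.le_seminorm ℝ _ _ _ _
  have hlim : Tendsto (fun n => ε n * C) atTop (𝓝 0) := by
    simpa [ε] using (tendsto_one_div_add_atTop_nhds_zero_nat (𝕜 := ℝ)).mul_const C
  filter_upwards [hlim.eventually (gt_mem_nhds hδ)] with n hn
  exact (hbound n).trans_lt hn

/-- `IsVanishingOn` tests against all Schwartz functions supported in `s`, `HasFourier` only against
compactly supported ones. Cutting off without enlarging the support bridges the two. -/
theorem isVanishingOn_of_hasCompactSupport {w : 𝓢'(E, ℂ)} {s : Set E}
    (h : ∀ φ : 𝓢(E, ℂ), HasCompactSupport φ → tsupport φ ⊆ s → w φ = 0) : IsVanishingOn w s := by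
  intro φ hφ
  obtain ⟨u, hu, hus, hlim⟩ := exists_seq_hasCompactSupport_tendsto φ
  have h1 : Tendsto (fun n => w (u n)) atTop (𝓝 (w φ)) := (w.continuous.tendsto φ).comp hlim
  have h2 : ∀ n, w (u n) = 0 := fun n => h _ (hu n) ((hus n).trans hφ)
  simp_rw [h2] at h1
  exact (tendsto_nhds_unique h1 tendsto_const_nhds)

/-! ### Fourier transforms away from the origin -/

theorem integrable_mul_of_locallyIntegrableOn {f φ : E → ℂ}
    (hf : LocallyIntegrableOn f ({0}ᶜ : Set E)) (hφ : Continuous φ) (hc : HasCompactSupport φ)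
    (hs : tsupport φ ⊆ ({0}ᶜ : Set E)) : Integrable fun ξ => φ ξ * f ξ := by
  have h1 : IntegrableOn f (tsupport φ) := hf.integrableOn_compact_subset hs hc
  have h2 : IntegrableOn (fun ξ => φ ξ * f ξ) (tsupport φ) :=
    h1.continuousOn_mul hφ.continuousOn hc
  refine (integrableOn_iff_integrable_of_support_subset ?_).1 h2
  intro ξ hξ
  exact subset_tsupport _ fun h => hξ (by simp [h])

theorem ae_ne_zero : ∀ᵐ ξ : E, ξ ≠ 0 := by simp [ae_iff]

theorem HasFourier.aestronglyMeasurable {u : HomDist} {f : E → ℂ} (h : HasFourier u f) :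
    AEStronglyMeasurable f volume := by
  have h1 := h.1.aestronglyMeasurable
  rwa [restrict_compl_singleton] at h1

theorem fourier_eq_of_mk_eq {w w' : 𝓢'(E, ℂ)}
    (h : (Submodule.Quotient.mk w : HomDist) = Submodule.Quotient.mk w') {φ : 𝓢(E, ℂ)}
    (hφ : tsupport φ ⊆ ({0}ᶜ : Set E)) : (𝓕 w : 𝓢'(E, ℂ)) φ = (𝓕 w' : 𝓢'(E, ℂ)) φ := by
  have h1 : w - w' ∈ polynomials := (Submodule.Quotient.eq _).1 h
  have h2 : (𝓕 (w - w') : 𝓢'(E, ℂ)) φ = 0 := h1 φ hφ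
  exact sub_eq_zero.1 h2

/-- The function part of `HasFourier` is unique. -/
theorem HasFourier.ae_eq {u : HomDist} {f g : E → ℂ} (hf : HasFourier u f) (hg : HasFourier u g) :
    f =ᵐ[volume] g := by
  obtain ⟨hf1, w, hw, hfw⟩ := hf
  obtain ⟨hg1, w', hw', hgw⟩ := hg
  have hli : LocallyIntegrableOn (fun ξ => f ξ - g ξ) ({0}ᶜ : Set E) := hf1.sub hg1
  have key := (isOpen_compl_singleton (x := (0 : E))).ae_eq_zero_of_integral_contDiff_smul_eq_zero
    hli fun ψ hψ hψc hψs => by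
    have hc : HasCompactSupport (fun x => ((ψ x : ℝ) : ℂ)) :=
      hψc.comp_left (g := fun x : ℝ => (x : ℂ)) rfl
    have hsm : ContDiff ℝ ∞ (fun x => ((ψ x : ℝ) : ℂ)) := Complex.ofRealCLM.contDiff.comp hψ
    have hs : tsupport (fun x => ((ψ x : ℝ) : ℂ)) ⊆ ({0}ᶜ : Set E) :=
      (tsupport_comp_subset (g := fun x : ℝ => (x : ℂ)) rfl ψ).trans hψs
    let φ : 𝓢(E, ℂ) := hc.toSchwartzMap hsm
    have h1 := hfw φ hc hs
    have h2 := hgw φ hc hs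
    rw [fourier_eq_of_mk_eq (hw.trans hw'.symm) hs, h2] at h1
    have e : ∀ x, ψ x • (f x - g x) = φ x * f x - φ x * g x := by
      intro x
      have : φ x = ((ψ x : ℝ) : ℂ) := rfl
      rw [this, Complex.real_smul]; ring
    simp_rw [e]
    rw [integral_sub (integrable_mul_of_locallyIntegrableOn hf1 φ.continuous hc hs)
      (integrable_mul_of_locallyIntegrableOn hg1 φ.continuous hc hs), h1, sub_self]
  filter_upwards [key, ae_ne_zero] with ξ h1 h2
  exact sub_eq_zero.1 (h1 h2)

theorem HasFourier.congr {u : HomDist} {f g : E → ℂ} (hf : HasFourier u f) (h : f =ᵐ[volume] g) :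
    HasFourier u g := by
  obtain ⟨hf1, w, hw, hfw⟩ := hf
  refine ⟨hf1.congr (ae_restrict_of_ae h), w, hw, fun φ hφ hs => ?_⟩
  rw [hfw φ hφ hs]
  apply integral_congr_ae
  filter_upwards [h] with ξ hξ
  rw [hξ]

theorem HasFourier.sub {u v : HomDist} {f g : E → ℂ} (hf : HasFourier u f) (hg : HasFourier v g) :
    HasFourier (u - v) (fun ξ => f ξ - g ξ) := by
  obtain ⟨hf1, w, hw, hfw⟩ := hf
  obtain ⟨hg1, w', hw', hgw⟩ := hg
  refine ⟨hf1.sub hg1, w - w', by rw [← hw, ← hw']; rfl, fun φ hφ hs => ?_⟩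
  have h1 : (𝓕 (w - w') : 𝓢'(E, ℂ)) φ = (𝓕 w : 𝓢'(E, ℂ)) φ - (𝓕 w' : 𝓢'(E, ℂ)) φ := rfl
  refine h1.trans ?_
  rw [hfw φ hφ hs, hgw φ hφ hs, ← integral_sub
    (integrable_mul_of_locallyIntegrableOn hf1 φ.continuous hφ hs)
    (integrable_mul_of_locallyIntegrableOn hg1 φ.continuous hφ hs)]
  simp_rw [mul_sub]

theorem HasFourier.const_smul {u : HomDist} {f : E → ℂ} (hf : HasFourier u f) (c : ℂ) :
    HasFourier (c • u) (fun ξ => c * f ξ) := by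
  obtain ⟨hf1, w, hw, hfw⟩ := hf
  refine ⟨hf1.smul c, c • w, by rw [← hw]; rfl, fun φ hφ hs => ?_⟩
  have h1 : (𝓕 (c • w) : 𝓢'(E, ℂ)) φ = c * (𝓕 w : 𝓢'(E, ℂ)) φ := rfl
  refine h1.trans ?_
  rw [hfw φ hφ hs, ← integral_const_mul]
  congr 1; ext ξ; ring

theorem HasFourier.eq_zero {u : HomDist} (h : HasFourier u 0) : u = 0 := by
  obtain ⟨-, w, hw, hfw⟩ := h
  rw [← hw, Submodule.Quotient.mk_eq_zero]
  exact isVanishingOn_of_hasCompactSupport fun φ hφ hs => by simpa using hfw φ hφ hs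

/-- The Fourier transform determines a distribution modulo polynomials. -/
theorem HasFourier.unique {u v : HomDist} {f g : E → ℂ} (hf : HasFourier u f) (hg : HasFourier v g)
    (h : f =ᵐ[volume] g) : u = v := by
  refine sub_eq_zero.1 (HasFourier.eq_zero ((hf.sub hg).congr ?_))
  filter_upwards [h] with ξ hξ
  simp [hξ]

/-- Functions of weighted `L¹` type are Fourier transforms of tempered distributions. -/
theorem exists_hasFourier {f : E → ℂ}
    (hf : Integrable fun ξ : E => ((1 + ‖ξ‖ ^ 2 : ℝ) : ℂ)⁻¹ * f ξ) : ∃ u, HasFourier u f := by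
  let m : E → ℂ := fun ξ => ((1 + ‖ξ‖ ^ 2 : ℝ) : ℂ)
  have hm0 : ∀ ξ, m ξ ≠ 0 := fun ξ => by
    simp only [m, ne_eq, Complex.ofReal_eq_zero]; positivity
  have hm : m.HasTemperateGrowth := by
    have : (fun ξ : E => (1 + ‖ξ‖ ^ 2 : ℝ)).HasTemperateGrowth :=
      (Function.HasTemperateGrowth.const 1).add (Function.hasTemperateGrowth_norm_sq E)
    exact Function.HasTemperateGrowth.comp Function.Complex.hasTemperateGrowth_ofReal this
  let h : E → ℂ := fun ξ => (m ξ)⁻¹ * f ξ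
  have hh : MemLp h 1 := memLp_one_iff_integrable.2 hf
  let w₁ : 𝓢'(E, ℂ) := TemperedDistribution.smulLeftCLM ℂ m (Lp.toTemperedDistribution (hh.toLp h))
  have hmh : (fun ξ => m ξ * h ξ) = f := by ext ξ; simp only [h]; field_simp [hm0 ξ]
  refine ⟨Submodule.Quotient.mk (𝓕⁻ w₁), ?_, 𝓕⁻ w₁, rfl, fun φ _ _ => ?_⟩
  · rw [← hmh]
    exact (hf.locallyIntegrable.locallyIntegrableOn _).continuousOn_mul hm.1.continuous.continuousOn
      isOpen_compl_singleton.isLocallyClosed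
  · rw [FourierTransform.fourier_fourierInv_eq]
    simp only [w₁, TemperedDistribution.smulLeftCLM_apply_apply, Lp.toTemperedDistribution_apply]
    apply integral_congr_ae
    filter_upwards [hh.coeFn_toLp] with ξ hξ
    rw [SchwartzMap.smulLeftCLM_apply_apply hm, hξ, ← congrFun hmh ξ]
    simp only [smul_eq_mul]; ring

/-! ### Blocks on the Fourier side -/

/-- The infimum in `distLpNorm` is over a single element, since an integrable function is determined
by the distribution that it defines. -/
theorem distLpNorm_one_eq {w : 𝓢'(E, ℂ)} {g : E → ℂ} (hg : Integrable g)
    (h : ∀ φ : 𝓢(E, ℂ), w φ = ∫ ξ, φ ξ * g ξ) : distLpNorm 1 w = ∫⁻ ξ, ‖g ξ‖ₑ := by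
  have hg1 : MemLp g 1 := memLp_one_iff_integrable.2 hg
  have hw : Lp.toTemperedDistribution (hg1.toLp g) = w := by
    ext φ
    rw [Lp.toTemperedDistribution_apply, h]
    apply integral_congr_ae
    filter_upwards [hg1.coeFn_toLp] with ξ hξ
    rw [hξ, smul_eq_mul]
  have hn : ‖hg1.toLp g‖ₑ = ∫⁻ ξ, ‖g ξ‖ₑ := by
    rw [Lp.enorm_toLp, eLpNorm_one_eq_lintegral_enorm]
  rw [← hn]
  refine le_antisymm (iInf₂_le (f := fun (f : Lp ℂ 1 (volume : Measure E))
    (_ : Lp.toTemperedDistribution f = w) => ‖f‖ₑ) _ hw) (le_iInf₂ fun f hf => ?_)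
  have hker := Lp.ker_toTemperedDistributionCLM_eq_bot (F := ℂ) (μ := (volume : Measure E)) (p := 1)
  have : f = hg1.toLp g := by
    refine LinearMap.ker_eq_bot.1 hker ?_
    exact hf.trans hw.symm
  rw [this]

theorem fourier_block_apply (L : LittlewoodPaley) (j : ℤ) (w : 𝓢'(E, ℂ)) (φ : 𝓢(E, ℂ)) :
    (𝓕 (L.block j (Submodule.Quotient.mk w)) : 𝓢'(E, ℂ)) φ =
      (𝓕 w : 𝓢'(E, ℂ)) (SchwartzMap.smulLeftCLM ℂ (L.symbol j) φ) := by
  have h1 : L.block j (Submodule.Quotient.mk w) =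
    TemperedDistribution.fourierMultiplierCLM ℂ (L.symbol j) w := rfl
  rw [h1, TemperedDistribution.fourierMultiplierCLM_apply, FourierTransform.fourier_fourierInv_eq]
  rfl

theorem hasCompactSupport_smulLeftCLM_symbol (L : LittlewoodPaley) (j : ℤ) (φ : 𝓢(E, ℂ)) :
    HasCompactSupport (SchwartzMap.smulLeftCLM ℂ (L.symbol j) φ) :=
  (L.hasCompactSupport_symbol j).of_isClosed_subset (isClosed_tsupport _)
    ((SchwartzMap.tsupport_smulLeftCLM_subset _ _).trans inter_subset_right)

theorem tsupport_smulLeftCLM_symbol_subset (L : LittlewoodPaley) (j : ℤ) (φ : 𝓢(E, ℂ)) :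
    tsupport (SchwartzMap.smulLeftCLM ℂ (L.symbol j) φ) ⊆ LittlewoodPaley.annulus j :=
  ((SchwartzMap.tsupport_smulLeftCLM_subset _ _).trans inter_subset_right).trans
    (L.tsupport_symbol_subset j)

theorem HasFourier.integrable_symbol_mul {u : HomDist} {f : E → ℂ} (hf : HasFourier u f)
    (L : LittlewoodPaley) (j : ℤ) : Integrable fun ξ => L.symbol j ξ * f ξ :=
  integrable_mul_of_locallyIntegrableOn hf.1 (L.continuous_symbol j) (L.hasCompactSupport_symbol j)
    ((L.tsupport_symbol_subset j).trans (LittlewoodPaley.annulus_subset_compl_zero j))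

theorem HasFourier.distLpNorm_block {u : HomDist} {f : E → ℂ} (hf : HasFourier u f)
    (L : LittlewoodPaley) (j : ℤ) :
    distLpNorm 1 (𝓕 (L.block j u)) = ∫⁻ ξ, ‖L.symbol j ξ‖ₑ * ‖f ξ‖ₑ := by
  rw [distLpNorm_one_eq (hf.integrable_symbol_mul L j)]
  · simp_rw [enorm_mul]
  · intro φ
    obtain ⟨hf1, w, rfl, hfw⟩ := hf
    rw [fourier_block_apply, hfw _ (hasCompactSupport_smulLeftCLM_symbol L j φ)
      ((tsupport_smulLeftCLM_symbol_subset L j φ).trans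
        (LittlewoodPaley.annulus_subset_compl_zero j))]
    congr 1; ext ξ
    rw [SchwartzMap.smulLeftCLM_apply_apply (L.symbol_hasTemperateGrowth j), smul_eq_mul]
    ring

theorem exists_integrable_of_distLpNorm_lt_top {w : 𝓢'(E, ℂ)} (h : distLpNorm 1 w < ⊤) :
    ∃ g : E → ℂ, Integrable g ∧ ∀ φ : 𝓢(E, ℂ), w φ = ∫ ξ, φ ξ * g ξ := by
  by_cases hex : ∃ f : Lp ℂ 1 (volume : Measure E), Lp.toTemperedDistribution f = w
  · obtain ⟨f, hf⟩ := hex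
    refine ⟨f, L1.integrable_coeFn f, fun φ => ?_⟩
    rw [← hf, Lp.toTemperedDistribution_apply]
    rfl
  · exfalso
    push Not at hex
    simp [distLpNorm, hex] at h

/-- A function representing the Fourier transform of a block is supported in an annulus. -/
theorem ae_eq_zero_of_fourier_block {L : LittlewoodPaley} {j : ℤ} {w : 𝓢'(E, ℂ)} {g : E → ℂ}
    (hg : Integrable g) (h : ∀ φ : 𝓢(E, ℂ),
      (𝓕 (L.block j (Submodule.Quotient.mk w)) : 𝓢'(E, ℂ)) φ = ∫ ξ, φ ξ * g ξ) :
    ∀ᵐ ξ : E, ξ ∉ LittlewoodPaley.annulus j → g ξ = 0 := by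
  refine (LittlewoodPaley.isClosed_annulus j).isOpen_compl.ae_eq_zero_of_integral_contDiff_smul_eq_zero
    (hg.locallyIntegrable.locallyIntegrableOn _) fun ψ hψ hψc hψs => ?_
  have hc : HasCompactSupport (fun x => ((ψ x : ℝ) : ℂ)) :=
    hψc.comp_left (g := fun x : ℝ => (x : ℂ)) rfl
  have hsm : ContDiff ℝ ∞ (fun x => ((ψ x : ℝ) : ℂ)) := Complex.ofRealCLM.contDiff.comp hψ
  let φ : 𝓢(E, ℂ) := hc.toSchwartzMap hsm
  have hφ : ∀ x, φ x = ((ψ x : ℝ) : ℂ) := fun _ => rfl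
  have h1 := h φ
  have h0 : SchwartzMap.smulLeftCLM ℂ (L.symbol j) φ = 0 := by
    ext x
    rw [SchwartzMap.smulLeftCLM_apply_apply (L.symbol_hasTemperateGrowth j), hφ]
    by_cases hx : x ∈ LittlewoodPaley.annulus j
    · have : ψ x = 0 := image_eq_zero_of_notMem_tsupport fun hx' => hψs hx' hx
      simp [this]
    · simp [L.symbol_eq_zero hx]
  rw [fourier_block_apply, h0, map_zero] at h1
  rw [h1]
  congr 1

/-- On the support of a test function away from the origin the Littlewood-Paley sum is finite, so it
commutes with distributions and integrals without any question of convergence. -/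
theorem exists_finset_annulus {K : Set E} (hK : IsCompact K) (hK0 : K ⊆ ({0}ᶜ : Set E)) :
    ∃ J : Finset ℤ, ∀ ξ ∈ K, ∀ j, ξ ∈ LittlewoodPaley.annulus j → j ∈ J := by
  rcases K.eq_empty_or_nonempty with rfl | hne
  · exact ⟨∅, by simp⟩
  obtain ⟨a, haK, ha⟩ := hK.exists_isMinOn hne continuous_norm.continuousOn
  obtain ⟨b, hbK, hb⟩ := hK.exists_isMaxOn hne continuous_norm.continuousOn
  have ha0 : 0 < ‖a‖ := norm_pos_iff.2 (hK0 haK)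
  obtain ⟨m, hm, -⟩ := exists_mem_Ico_zpow ha0 (one_lt_two (α := ℝ))
  obtain ⟨n, -, hn⟩ := exists_mem_Ico_zpow (norm_pos_iff.2 (hK0 hbK)) (one_lt_two (α := ℝ))
  refine ⟨Finset.Icc (m - 2) (n + 2), fun ξ hξ j hj => ?_⟩
  have hj0 : (0 : ℝ) < 2 ^ j := by positivity
  have h1 : (2 : ℝ) ^ m < 2 ^ (j + 2) := by
    rw [zpow_add₀ (by norm_num)]
    have := (hm.trans (ha hξ)).trans hj.2
    norm_num
    linarith
  have h2 : (2 : ℝ) ^ (j - 1) < 2 ^ (n + 1) := by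
    rw [zpow_sub₀ (by norm_num)]
    have := (hj.1.trans (hb hξ)).trans_lt hn
    norm_num
    linarith
  rw [zpow_lt_zpow_iff_right₀ (by norm_num)] at h1 h2
  rw [Finset.mem_Icc]
  omega

/-- Every element of a Fourier-Besov space has a Fourier transform which is a function. -/
theorem exists_hasFourier_of_forall_block (L : LittlewoodPaley) {u : HomDist}
    (h : ∀ j, distLpNorm 1 (𝓕 (L.block j u)) < ⊤) : ∃ f, HasFourier u f := by
  obtain ⟨w, rfl⟩ := Submodule.Quotient.mk_surjective _ u
  choose g hgi hg using fun j => exists_integrable_of_distLpNorm_lt_top (h j)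
  -- The function of each block vanishes outside its annulus almost everywhere only; truncating it
  -- there makes the sum `f` locally finite at every point.
  let G : ℤ → E → ℂ := fun j => (LittlewoodPaley.annulus j).indicator (g j)
  have hG : ∀ j, Integrable (G j) := fun j =>
    (hgi j).indicator (LittlewoodPaley.isClosed_annulus j).measurableSet
  have hGg : ∀ j, G j =ᵐ[volume] g j := by
    intro j
    filter_upwards [ae_eq_zero_of_fourier_block (hgi j) (hg j)] with ξ hξ
    by_cases hm : ξ ∈ LittlewoodPaley.annulus j
    · exact indicator_of_mem hm _
    · rw [hξ hm]; exact indicator_of_notMem hm _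
  let f : E → ℂ := fun ξ => ∑' j, G j ξ
  have hfK : ∀ {K : Set E} {J : Finset ℤ},
      (∀ ξ ∈ K, ∀ j, ξ ∈ LittlewoodPaley.annulus j → j ∈ J) → ∀ ξ ∈ K, f ξ = ∑ j ∈ J, G j ξ := by
    intro K J hJ ξ hξ
    exact tsum_eq_sum fun j hj => indicator_of_notMem (fun hm => hj (hJ ξ hξ j hm)) _
  refine ⟨f, ?_, w, rfl, fun φ hφ hs => ?_⟩
  · rw [locallyIntegrableOn_iff isOpen_compl_singleton.isLocallyClosed]
    intro K hK0 hK
    obtain ⟨J, hJ⟩ := exists_finset_annulus hK hK0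
    have h1 : IntegrableOn (fun ξ => ∑ j ∈ J, G j ξ) K :=
      (integrable_finsetSum J fun j _ => hG j).integrableOn
    refine h1.congr_fun_ae ?_
    filter_upwards [ae_restrict_mem hK.measurableSet] with ξ hξ
    exact (hfK hJ ξ hξ).symm
  · obtain ⟨J, hJ⟩ := exists_finset_annulus hφ hs
    -- The test function is decomposed instead of the distribution: `𝓕 w` tested on `symbol j · φ`
    -- is the `j`-th block tested on `φ`.
    have hsum : φ = ∑ j ∈ J, SchwartzMap.smulLeftCLM ℂ (L.symbol j) φ := by
      ext ξ
      rw [sum_apply]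
      simp_rw [SchwartzMap.smulLeftCLM_apply_apply (L.symbol_hasTemperateGrowth _)]
      rw [← Finset.sum_smul]
      by_cases hξ : ξ ∈ tsupport φ
      · rw [L.sum_symbol_eq_one (hs hξ) fun j hj => L.symbol_eq_zero fun hm => hj (hJ ξ hξ j hm),
          one_smul]
      · rw [image_eq_zero_of_notMem_tsupport hξ, smul_zero]
    have e1 : (𝓕 w : 𝓢'(E, ℂ)) φ = ∑ j ∈ J, ∫ ξ, φ ξ * G j ξ := by
      conv_lhs => rw [hsum]
      rw [map_sum]
      refine Finset.sum_congr rfl fun j _ => ?_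
      rw [← fourier_block_apply, hg]
      apply integral_congr_ae
      filter_upwards [hGg j] with ξ hξ
      rw [hξ]
    rw [e1, ← integral_finsetSum]
    · congr 1; ext ξ
      rw [← Finset.mul_sum]
      by_cases hξ : ξ ∈ tsupport φ
      · rw [hfK hJ ξ hξ]
      · rw [image_eq_zero_of_notMem_tsupport hξ, zero_mul, zero_mul]
    · intro j _
      obtain ⟨C, hC⟩ : ∃ C, ∀ ξ, ‖φ ξ‖ ≤ C := ⟨_, fun ξ => SchwartzMap.norm_le_seminorm ℝ φ ξ⟩
      exact (hG j).bdd_mul φ.continuous.aestronglyMeasurable (Eventually.of_forall hC)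

theorem MemBesov.distLpNorm_block_lt_top {L : LittlewoodPaley} {s : ℝ} {r : ℝ≥0∞} (hr : r ≠ 0)
    {u : HomDist} (h : MemBesov L s 1 r u) (j : ℤ) : distLpNorm 1 (𝓕 (L.block j u)) < ⊤ := by
  have h1 := (le_eLpNorm_count (fun j : ℤ => (2 : ℝ≥0∞) ^ ((j : ℝ) * s) *
    distLpNorm 1 (𝓕 (L.block j u))) hr j).trans_lt h
  refine lt_top_iff_ne_top.2 fun htop => ?_
  rw [htop, ENNReal.mul_top (by simp)] at h1
  exact lt_irrefl _ h1

theorem MemBesov.exists_hasFourier {L : LittlewoodPaley} {s : ℝ} {r : ℝ≥0∞} (hr : r ≠ 0)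
    {u : HomDist} (h : MemBesov L s 1 r u) : ∃ f, HasFourier u f :=
  exists_hasFourier_of_forall_block L (h.distLpNorm_block_lt_top hr)

theorem HasFourier.besovNorm_eq {u : HomDist} {f : E → ℂ} (hf : HasFourier u f)
    (L : LittlewoodPaley) (s : ℝ) (r : ℝ≥0∞) :
    besovNorm L s 1 r u = eLpNorm (fun j : ℤ => (2 : ℝ≥0∞) ^ ((j : ℝ) * s) *
      ∫⁻ ξ, ‖L.symbol j ξ‖ₑ * ‖f ξ‖ₑ) r Measure.count := by
  simp_rw [besovNorm, hf.distLpNorm_block]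

end

/-! ### The rescaled Euclidean norm and the semigroup -/

/-- The weights `(1, 1, 1, d)`. -/
def scaleWeight (d : ℝˣ) : Fin 4 → ℂ := ![1, 1, 1, ((d : ℝ) : ℂ)]

theorem scaleWeight_ne_zero (d : ℝˣ) (i : Fin 4) : scaleWeight d i ≠ 0 := by
  fin_cases i <;> simp [scaleWeight]

/-- The rescaling `(u, θ) ↦ (u, d θ)`, with values in the Hermitian space `ℂ⁴`. -/
def scale (d : ℝˣ) : (Fin 4 → ℂ) ≃L[ℂ] EuclideanSpace ℂ (Fin 4) :=
  LinearEquiv.toContinuousLinearEquiv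
    { toFun := fun x => WithLp.toLp 2 fun i => scaleWeight d i * x i
      invFun := fun y => fun i => (scaleWeight d i)⁻¹ * y i
      map_add' := fun x y => by ext i; simp [mul_add]
      map_smul' := fun c x => by ext i; simp; ring
      left_inv := fun x => by ext i; simp [scaleWeight_ne_zero]
      right_inv := fun x => by ext i; simp [scaleWeight_ne_zero] }

theorem scale_apply (d : ℝˣ) (x : Fin 4 → ℂ) :
    scale d x = WithLp.toLp 2 fun i => scaleWeight d i * x i := rfl

theorem scale_apply_apply (d : ℝˣ) (x : Fin 4 → ℂ) (i : Fin 4) :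
    scale d x i = scaleWeight d i * x i := rfl

theorem enorm_scaleWeight_mul_le (d : ℝˣ) (x : Fin 4 → ℂ) (i : Fin 4) :
    ‖scaleWeight d i‖ₑ * ‖x i‖ₑ ≤ ‖scale d x‖ₑ := by
  rw [← enorm_mul, ← scale_apply_apply, enorm_le_iff_norm_le]
  exact PiLp.norm_apply_le _ i

theorem enorm_velocity_le (d : ℝˣ) (x : Fin 4 → ℂ) {i : Fin 4} (hi : i ≠ 3) :
    ‖x i‖ₑ ≤ ‖scale d x‖ₑ := by
  refine le_trans (le_of_eq ?_) (enorm_scaleWeight_mul_le d x i)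
  fin_cases i <;> simp_all [scaleWeight]

theorem enorm_scale_le_sum (d : ℝˣ) (x : Fin 4 → ℂ) :
    ‖scale d x‖ₑ ≤ ∑ i, ‖scaleWeight d i‖ₑ * ‖x i‖ₑ := by
  have h : scale d x = ∑ i, EuclideanSpace.single i (scaleWeight d i * x i) := by
    ext j
    simp [scale_apply_apply, Finset.sum_apply, Pi.single_apply]
  rw [h]
  refine (enorm_sum_le _ _).trans (Finset.sum_le_sum fun i _ => ?_)
  rw [← enorm_mul, enorm_le_iff_norm_le]
  simp

/-! ### Operator norms of the Helmholtz projection and of the semigroup. -/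

open scoped Matrix.Norms.L2Operator

theorem norm_toLp_mulVec_le (A : Matrix (Fin 4) (Fin 4) ℂ) (x : Fin 4 → ℂ) :
    ‖(WithLp.toLp 2 (A.mulVec x) : EuclideanSpace ℂ (Fin 4))‖ ≤
      ‖A‖ * ‖(WithLp.toLp 2 x : EuclideanSpace ℂ (Fin 4))‖ :=
  Matrix.l2_opNorm_mulVec A (WithLp.toLp 2 x)

theorem norm_matrix_exp_le (A : Matrix (Fin 4) (Fin 4) ℂ) :
    ‖NormedSpace.exp A‖ ≤ Real.exp ‖A‖ := by
  have h1 := NormedSpace.exp_series_hasSum_exp' (𝕂 := ℂ) A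
  have h2 := NormedSpace.exp_series_hasSum_exp' (𝕂 := ℝ) ‖A‖
  rw [← Real.exp_eq_exp_ℝ] at h2
  refine h1.norm_le_of_bounded h2 fun n => ?_
  refine (norm_smul_le _ _).trans ?_
  rw [smul_eq_mul, norm_inv, Complex.norm_natCast]
  gcongr
  exact norm_pow_le A n

theorem extFreq_dotProduct (ξ : E) : extFreq ξ ⬝ᵥ extFreq ξ = ((‖ξ‖ ^ 2 : ℝ) : ℂ) := by
  rw [EuclideanSpace.norm_sq_eq]
  simp [extFreq, dotProduct, Fin.sum_univ_succ, sq]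

theorem helmholtz_isHermitian (ξ : E) : (helmholtz ξ).conjTranspose = helmholtz ξ := by
  ext i j
  fin_cases i <;> fin_cases j <;>
    simp [helmholtz, extFreq, Matrix.conjTranspose_apply, mul_comm]

theorem helmholtz_mul_self (ξ : E) : helmholtz ξ * helmholtz ξ = helmholtz ξ := by
  have h1 : Matrix.vecMulVec (extFreq ξ) (extFreq ξ) * Matrix.vecMulVec (extFreq ξ) (extFreq ξ) =
      ((‖ξ‖ : ℂ) ^ 2) • Matrix.vecMulVec (extFreq ξ) (extFreq ξ) := by
    rw [Matrix.vecMulVec_mul_vecMulVec, extFreq_dotProduct]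
    ext i j
    simp [Matrix.vecMulVec_apply]; ring
  rcases eq_or_ne ξ 0 with rfl | hξ
  · simp [helmholtz]
  · have h2 : ((‖ξ‖ : ℂ) ^ 2) ≠ 0 := by simpa using hξ
    simp only [helmholtz, sub_mul, mul_sub, one_mul, mul_one, Matrix.smul_mul, Matrix.mul_smul, h1,
      smul_smul]
    rw [inv_mul_cancel₀ h2]
    simp

/-- The matrix is Hermitian and idempotent, so the C*-identity reads `‖H‖ = ‖H‖²`. This includes `ξ
= 0`, where the matrix is the identity. -/
theorem norm_helmholtz_le (ξ : E) : ‖helmholtz ξ‖ ≤ 1 := by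
  have h := CStarRing.norm_star_mul_self (x := helmholtz ξ)
  rw [Matrix.star_eq_conjTranspose, helmholtz_isHermitian, helmholtz_mul_self] at h
  by_contra hlt
  push Not at hlt
  nlinarith

/-- The diagonal matrix of the weights. -/
def scaleMatrix (d : ℝˣ) : Matrix (Fin 4) (Fin 4) ℂ := Matrix.diagonal (scaleWeight d)

theorem scale_eq_mulVec (d : ℝˣ) (x : Fin 4 → ℂ) :
    scale d x = WithLp.toLp 2 ((scaleMatrix d).mulVec x) := by
  rw [scale_apply]
  congr 1; ext i
  rw [scaleMatrix, Matrix.mulVec_diagonal]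

theorem scaleMatrix_mul_inv (d : ℝˣ) :
    scaleMatrix d * Matrix.diagonal (fun i => (scaleWeight d i)⁻¹) = 1 := by
  rw [scaleMatrix, Matrix.diagonal_mul_diagonal, ← Matrix.diagonal_one]
  congr 1; ext i
  exact mul_inv_cancel₀ (scaleWeight_ne_zero d i)

theorem isUnit_scaleMatrix (d : ℝˣ) : IsUnit (scaleMatrix d) :=
  IsUnit.of_mul_eq_one _ (scaleMatrix_mul_inv d)

theorem scaleMatrix_inv (d : ℝˣ) :
    (scaleMatrix d)⁻¹ = Matrix.diagonal (fun i => (scaleWeight d i)⁻¹) :=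
  Matrix.inv_eq_right_inv (scaleMatrix_mul_inv d)

/-- The weights are constant on the first three components, and the projection does not mix these
with the fourth. -/
theorem scaleMatrix_mul_helmholtz (d : ℝˣ) (ξ : E) :
    scaleMatrix d * helmholtz ξ = helmholtz ξ * scaleMatrix d := by
  ext i j
  rw [scaleMatrix, Matrix.diagonal_mul, Matrix.mul_diagonal]
  fin_cases i <;> fin_cases j <;>
    simp [helmholtz, extFreq, scaleWeight]

theorem norm_scale_helmholtz_le (d : ℝˣ) (ξ : E) (x : Fin 4 → ℂ) :
    ‖scale d ((helmholtz ξ).mulVec x)‖ ≤ ‖scale d x‖ := by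
  rw [scale_eq_mulVec, scale_eq_mulVec, Matrix.mulVec_mulVec, scaleMatrix_mul_helmholtz,
    ← Matrix.mulVec_mulVec]
  refine (norm_toLp_mulVec_le _ _).trans ?_
  calc _ ≤ 1 * ‖(WithLp.toLp 2 ((scaleMatrix d).mulVec x) : EuclideanSpace ℂ (Fin 4))‖ := by
        gcongr
        exact norm_helmholtz_le ξ
    _ = _ := one_mul _

/-- The coupling in the rescaled unknowns. -/
def scaledCoupling (P : Parameters) (d : ℝˣ) : Matrix (Fin 4) (Fin 4) ℂ :=
  scaleMatrix d * coupling P * (scaleMatrix d)⁻¹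

/-- This is what Prandtl number 1 is for: a scalar dissipation commutes with the coupling, so the
semigroup splits into the heat kernel and the exponential of a matrix bounded uniformly in `ξ`. -/
theorem dissipation_eq (P : Parameters) (hP : P.ν / P.μ = 1) (ξ : E) :
    dissipation P ξ = ((4 * Real.pi ^ 2 * P.ν * ‖ξ‖ ^ 2 : ℝ) : ℂ) • (1 : Matrix (Fin 4) (Fin 4) ℂ) := by
  have hμ : P.μ = P.ν := ((div_eq_one_iff_eq P.μ_pos.ne').1 hP).symm
  rw [dissipation, hμ]
  ext i j
  fin_cases i <;> fin_cases j <;> simp <;> ring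

/-- Conjugation by the weights passes through the exponential and through the projection, so it only
replaces the coupling by its rescaled form; the scalar dissipation then factors out. -/
theorem scaleMatrix_mul_semigroup (P : Parameters) (hP : P.ν / P.μ = 1) (d : ℝˣ) (t : ℝ) (ξ : E) :
    scaleMatrix d * semigroup P t ξ =
      ((Real.exp (-(4 * Real.pi ^ 2 * P.ν * ‖ξ‖ ^ 2) * t) : ℂ) •
        NormedSpace.exp (-(t : ℂ) • (helmholtz ξ * scaledCoupling P d * helmholtz ξ))) *
        scaleMatrix d := by
  set D := scaleMatrix d
  set H := helmholtz ξ
  have hD := isUnit_scaleMatrix d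
  have hDinv : D⁻¹ * D = 1 := by
    rw [Matrix.nonsing_inv_mul _ ((Matrix.isUnit_iff_isUnit_det _).1 hD)]
  have hDinv' : D * D⁻¹ = 1 := by
    rw [Matrix.mul_nonsing_inv _ ((Matrix.isUnit_iff_isUnit_det _).1 hD)]
  have hHD : H * D⁻¹ = D⁻¹ * H := by
    calc H * D⁻¹ = D⁻¹ * D * (H * D⁻¹) := by rw [hDinv, one_mul]
      _ = D⁻¹ * (D * H) * D⁻¹ := by simp only [mul_assoc]
      _ = D⁻¹ * H * (D * D⁻¹) := by rw [scaleMatrix_mul_helmholtz]; simp only [mul_assoc]; rfl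
      _ = D⁻¹ * H := by rw [hDinv', mul_one]
  set a : ℝ := 4 * Real.pi ^ 2 * P.ν * ‖ξ‖ ^ 2 with ha
  have hconj : D * (-(t : ℂ) • (dissipation P ξ + H * coupling P * H)) * D⁻¹ =
      ((-a * t : ℝ) : ℂ) • (1 : Matrix (Fin 4) (Fin 4) ℂ) +
        -(t : ℂ) • (H * scaledCoupling P d * H) := by
    rw [dissipation_eq P hP]
    have e1 : D * (H * coupling P * H) * D⁻¹ = H * scaledCoupling P d * H := by
      calc D * (H * coupling P * H) * D⁻¹ = (D * H) * coupling P * (H * D⁻¹) := by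
            simp only [mul_assoc]
        _ = _ := by
          rw [hHD, scaleMatrix_mul_helmholtz, scaledCoupling]; simp only [mul_assoc]; rfl
    rw [Matrix.mul_smul, Matrix.smul_mul, mul_add, add_mul, e1, Matrix.mul_smul, Matrix.smul_mul,
      mul_one, hDinv', smul_add, smul_smul]
    congr 2
    rw [ha]
    push_cast
    ring
  have hexp : D * semigroup P t ξ * D⁻¹ = ((Real.exp (-a * t) : ℂ) •
        NormedSpace.exp (-(t : ℂ) • (H * scaledCoupling P d * H))) := by
    rw [semigroup, ← Matrix.exp_conj _ _ hD, hconj,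
      Matrix.exp_add_of_commute _ _ (Commute.smul_left (Commute.one_left _) _)]
    have e2 : NormedSpace.exp (((-a * t : ℝ) : ℂ) • (1 : Matrix (Fin 4) (Fin 4) ℂ)) =
        (Real.exp (-a * t) : ℂ) • (1 : Matrix (Fin 4) (Fin 4) ℂ) := by
      rw [Matrix.smul_one_eq_diagonal, Matrix.exp_diagonal, Matrix.smul_one_eq_diagonal]
      congr 1; ext i
      rw [Pi.coe_exp, ← Complex.exp_eq_exp_ℂ, Complex.ofReal_exp]
    rw [e2, Matrix.smul_mul, one_mul]
  rw [← hexp, mul_assoc, hDinv, mul_one]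

/-- The bound `|T(t, ξ) x| ≤ M e^{-4π²ν|ξ|²t} |x|` for all `t ∈ I`. -/
def SemigroupBound (P : Parameters) (d : ℝˣ) (M : ℝ) (I : Set ℝ) : Prop :=
  ∀ t ∈ I, ∀ (ξ : E) (x : Fin 4 → ℂ), ‖scale d ((semigroup P t ξ).mulVec x)‖ ≤
    M * Real.exp (-(4 * Real.pi ^ 2 * P.ν * ‖ξ‖ ^ 2) * t) * ‖scale d x‖

theorem norm_scale_semigroup_le (P : Parameters) (hP : P.ν / P.μ = 1) (d : ℝˣ) (t : ℝ) (ξ : E)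
    (x : Fin 4 → ℂ) {M : ℝ}
    (hM : ‖NormedSpace.exp (-(t : ℂ) • (helmholtz ξ * scaledCoupling P d * helmholtz ξ))‖ ≤ M) :
    ‖scale d ((semigroup P t ξ).mulVec x)‖ ≤
      M * Real.exp (-(4 * Real.pi ^ 2 * P.ν * ‖ξ‖ ^ 2) * t) * ‖scale d x‖ := by
  rw [scale_eq_mulVec, scale_eq_mulVec, Matrix.mulVec_mulVec, scaleMatrix_mul_semigroup P hP,
    ← Matrix.mulVec_mulVec]
  refine (norm_toLp_mulVec_le _ _).trans ?_
  gcongr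
  refine (norm_smul_le _ _).trans ?_
  rw [Complex.norm_real, Real.norm_of_nonneg (Real.exp_nonneg _), mul_comm]
  gcongr

/-- On bounded time intervals the semigroup is bounded. -/
theorem exists_semigroupBound (P : Parameters) (hP : P.ν / P.μ = 1) :
    ∃ M : ℝ, 0 < M ∧ SemigroupBound P 1 M (Icc 0 1) := by
  refine ⟨Real.exp ‖scaledCoupling P 1‖, Real.exp_pos _, fun t ht ξ x => ?_⟩
  refine norm_scale_semigroup_le P hP 1 t ξ x ?_
  refine (norm_matrix_exp_le _).trans ?_
  rw [Real.exp_le_exp]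
  refine (norm_smul_le _ _).trans ?_
  rw [norm_neg, Complex.norm_real, Real.norm_of_nonneg ht.1]
  calc t * ‖helmholtz ξ * scaledCoupling P 1 * helmholtz ξ‖
      ≤ 1 * (1 * ‖scaledCoupling P 1‖ * 1) := by
        have h := norm_helmholtz_le ξ
        gcongr
        · exact ht.2
        · refine (norm_mul_le _ _).trans ?_
          gcongr
          refine (norm_mul_le _ _).trans ?_
          gcongr
    _ = _ := by ring

/-- In the energy scaling the coupling is skew-Hermitian and the semigroup is bounded by the heat
semigroup. -/
theorem semigroupBound_energy (P : Parameters) (hP : P.ν / P.μ = 1) (h𝒩 : 0 < P.𝒩) (d : ℝˣ)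
    (hd : (d : ℝ) = √P.g / P.𝒩) : SemigroupBound P d 1 (Ici 0) := by
  intro t _ ξ x
  refine norm_scale_semigroup_le P hP d t ξ x ?_
  -- With the weight `√g / 𝒩` on the fourth component, the entries `-g` and `𝒩²` become `-√g 𝒩` and
  -- `√g 𝒩`; the Coriolis block is already skew.
  have hskew : (scaledCoupling P d).conjTranspose = -scaledCoupling P d := by
    have hs : √P.g ≠ 0 := (Real.sqrt_pos.2 P.g_pos).ne'
    have hsg : ((√P.g : ℝ) : ℂ) * ((√P.g : ℝ) : ℂ) = (P.g : ℂ) := by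
      rw [← Complex.ofReal_mul, Real.mul_self_sqrt P.g_pos.le]
    have hs' : ((√P.g : ℝ) : ℂ) ≠ 0 := by exact_mod_cast hs
    have hN : (P.𝒩 : ℂ) ≠ 0 := by exact_mod_cast h𝒩.ne'
    rw [scaledCoupling, scaleMatrix_inv, scaleMatrix]
    ext i j
    rw [Matrix.conjTranspose_apply, Matrix.neg_apply, Matrix.mul_diagonal, Matrix.diagonal_mul,
      Matrix.mul_diagonal, Matrix.diagonal_mul]
    fin_cases i <;> fin_cases j <;> simp [coupling, scaleWeight, hd]
    all_goals (field_simp; rw [sq, hsg])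
  set K := -(t : ℂ) • (helmholtz ξ * scaledCoupling P d * helmholtz ξ) with hK
  have hKs : star K = -K := by
    rw [Matrix.star_eq_conjTranspose, hK, Matrix.conjTranspose_smul, Matrix.conjTranspose_mul,
      Matrix.conjTranspose_mul, helmholtz_isHermitian, hskew]
    simp [mul_assoc]
  have hu : NormedSpace.exp K ∈ unitary (Matrix (Fin 4) (Fin 4) ℂ) := by
    have h1 : star (NormedSpace.exp K) = NormedSpace.exp (-K) := by
      rw [Matrix.star_eq_conjTranspose, ← Matrix.exp_conjTranspose, ← Matrix.star_eq_conjTranspose,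
        hKs]
    rw [Unitary.mem_iff, h1]
    constructor
    · rw [← Matrix.exp_add_of_commute _ _ (Commute.neg_left (Commute.refl K))]; simp
    · rw [← Matrix.exp_add_of_commute _ _ (Commute.neg_right (Commute.refl K))]; simp
  exact (CStarRing.norm_of_mem_unitary hu).le

/-! ### Duhamel's formula: measurability -/

/-- The nonlinear term of the mild formulation. -/
def duhamelIntegrand (P : Parameters) (V : ℝ → E → Fin 4 → ℂ) (t : ℝ) (ξ : E) (τ : ℝ) : Fin 4 → ℂ :=
  (semigroup P (t - τ) ξ).mulVec ((helmholtz ξ).mulVec (advection (V τ) ξ))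

/-- The Duhamel term of the mild formulation. -/
def duhamel (P : Parameters) (V : ℝ → E → Fin 4 → ℂ) (t : ℝ) (ξ : E) : Fin 4 → ℂ :=
  ∫ τ in (0 : ℝ)..t, duhamelIntegrand P V t ξ τ

/-- The right-hand side of the mild formulation. -/
def picard (P : Parameters) (V₀ : E → Fin 4 → ℂ) (V : ℝ → E → Fin 4 → ℂ) (t : ℝ) (ξ : E) :
    Fin 4 → ℂ :=
  (semigroup P t ξ).mulVec (V₀ ξ) - duhamel P V t ξ

section Measurability

open scoped Matrix.Norms.L2Operator

theorem continuous_extFreq : Continuous extFreq := by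
  refine continuous_pi fun i => ?_
  fin_cases i <;> simp [extFreq] <;> fun_prop

theorem stronglyMeasurable_helmholtz : StronglyMeasurable helmholtz := by
  refine stronglyMeasurable_const.sub ?_
  have h1 : StronglyMeasurable fun ξ : E => ((‖ξ‖ : ℂ) ^ 2)⁻¹ := by
    have : Measurable fun ξ : E => ((‖ξ‖ : ℂ) ^ 2)⁻¹ := by fun_prop
    exact this.stronglyMeasurable
  have h2 : StronglyMeasurable fun ξ : E => Matrix.vecMulVec (extFreq ξ) (extFreq ξ) :=
    (Continuous.matrix_vecMulVec continuous_extFreq continuous_extFreq).stronglyMeasurable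
  exact h1.smul h2

theorem stronglyMeasurable_semigroup (P : Parameters) :
    StronglyMeasurable fun p : ℝ × E => semigroup P p.1 p.2 := by
  have hexp : Continuous (NormedSpace.exp : Matrix (Fin 4) (Fin 4) ℂ → Matrix (Fin 4) (Fin 4) ℂ) := by
    let _ : NormedAlgebra ℚ (Matrix (Fin 4) (Fin 4) ℂ) := NormedAlgebra.restrictScalars ℚ ℂ _
    exact NormedSpace.exp_continuous
  refine hexp.comp_stronglyMeasurable ?_
  have h1 : StronglyMeasurable fun p : ℝ × E => -((p.1 : ℝ) : ℂ) := by
    have : Continuous fun p : ℝ × E => -((p.1 : ℝ) : ℂ) := by fun_prop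
    exact this.stronglyMeasurable
  have h2 : StronglyMeasurable fun p : ℝ × E => dissipation P p.2 := by
    have : Continuous fun p : ℝ × E => ((4 * Real.pi ^ 2 * ‖p.2‖ ^ 2 : ℝ) : ℂ) := by fun_prop
    exact this.stronglyMeasurable.smul stronglyMeasurable_const
  have h3 : StronglyMeasurable fun p : ℝ × E => helmholtz p.2 :=
    stronglyMeasurable_helmholtz.comp_measurable measurable_snd
  exact h1.smul (h2.add ((h3.mul stronglyMeasurable_const).mul h3))

theorem measurable_mulVec {α : Type*} [MeasurableSpace α] {A : α → Matrix (Fin 4) (Fin 4) ℂ}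
    {v : α → Fin 4 → ℂ} (hA : StronglyMeasurable A) (hv : Measurable v) :
    Measurable fun a => (A a).mulVec (v a) := by
  have hc : Continuous fun p : Matrix (Fin 4) (Fin 4) ℂ × (Fin 4 → ℂ) => p.1.mulVec p.2 :=
    Continuous.matrix_mulVec continuous_fst continuous_snd
  exact (hc.comp_stronglyMeasurable (hA.prodMk hv.stronglyMeasurable)).measurable

end Measurability

theorem measurable_advection {V : ℝ → E → Fin 4 → ℂ} (hV : Measurable (Function.uncurry V)) :
    Measurable fun p : ℝ × E => advection (V p.1) p.2 := by
  refine measurable_pi_lambda _ fun k => ?_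
  refine Finset.measurable_sum _ fun j _ => ?_
  refine Measurable.mul ?_ ?_
  · have : Continuous fun p : ℝ × E => 2 * (Real.pi : ℂ) * Complex.I * extFreq p.2 j :=
      continuous_const.mul ((continuous_apply j).comp (continuous_extFreq.comp continuous_snd))
    exact this.measurable
  · have h1 : Measurable fun q : (ℝ × E) × E => V q.1.1 q.2 j * V q.1.1 (q.1.2 - q.2) k := by
      have hj : Measurable fun q : (ℝ × E) × E => V q.1.1 q.2 :=
        hV.comp (measurable_fst.fst.prodMk measurable_snd)
      have hk : Measurable fun q : (ℝ × E) × E => V q.1.1 (q.1.2 - q.2) :=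
        hV.comp (measurable_fst.fst.prodMk (measurable_fst.snd.sub measurable_snd))
      exact ((measurable_pi_apply j).comp hj).mul ((measurable_pi_apply k).comp hk)
    exact (h1.stronglyMeasurable.integral_prod_right' (ν := (volume : Measure E))).measurable

theorem measurable_duhamelIntegrand (P : Parameters) {V : ℝ → E → Fin 4 → ℂ}
    (hV : Measurable (Function.uncurry V)) :
    Measurable fun q : (ℝ × E) × ℝ => duhamelIntegrand P V q.1.1 q.1.2 q.2 := by
  refine measurable_mulVec ((stronglyMeasurable_semigroup P).comp_measurable
    ((measurable_fst.fst.sub measurable_snd).prodMk measurable_fst.snd)) ?_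
  exact measurable_mulVec (stronglyMeasurable_helmholtz.comp_measurable measurable_fst.snd)
    ((measurable_advection hV).comp (measurable_snd.prodMk measurable_fst.snd))

/-- An integral with a variable endpoint is the difference of two integrals over `ℝ` of the
integrand cut off to measurable sets of `(t, ξ, τ)`, one for each orientation of the interval.
Measurability of parameter integrals then applies. -/
theorem measurable_duhamel (P : Parameters) {V : ℝ → E → Fin 4 → ℂ}
    (hV : Measurable (Function.uncurry V)) : Measurable (Function.uncurry (duhamel P V)) := by
  have hF := measurable_duhamelIntegrand P hV
  have key : ∀ s : Set ((ℝ × E) × ℝ), MeasurableSet s → Measurable fun p : ℝ × E =>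
      ∫ τ, s.indicator (fun q => duhamelIntegrand P V q.1.1 q.1.2 q.2) (p, τ) := fun s hs =>
    ((hF.indicator hs).stronglyMeasurable.integral_prod_right' (ν := (volume : Measure ℝ))).measurable
  have h1 : MeasurableSet {q : (ℝ × E) × ℝ | 0 < q.2 ∧ q.2 ≤ q.1.1} :=
    (measurableSet_lt measurable_const measurable_snd).inter
      (measurableSet_le measurable_snd measurable_fst.fst)
  have h2 : MeasurableSet {q : (ℝ × E) × ℝ | q.1.1 < q.2 ∧ q.2 ≤ 0} :=
    (measurableSet_lt measurable_fst.fst measurable_snd).inter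
      (measurableSet_le measurable_snd measurable_const)
  have heq : Function.uncurry (duhamel P V) = fun p =>
      (∫ τ, {q : (ℝ × E) × ℝ | 0 < q.2 ∧ q.2 ≤ q.1.1}.indicator
          (fun q => duhamelIntegrand P V q.1.1 q.1.2 q.2) (p, τ)) -
        ∫ τ, {q : (ℝ × E) × ℝ | q.1.1 < q.2 ∧ q.2 ≤ 0}.indicator
          (fun q => duhamelIntegrand P V q.1.1 q.1.2 q.2) (p, τ) := by
    ext1 p
    rw [Function.uncurry, duhamel, intervalIntegral,
      ← integral_indicator measurableSet_Ioc, ← integral_indicator measurableSet_Ioc]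
    rfl
  rw [heq]
  exact (key _ h1).sub (key _ h2)

theorem measurable_picard (P : Parameters) {V₀ : E → Fin 4 → ℂ} (hV₀ : Measurable V₀)
    {V : ℝ → E → Fin 4 → ℂ} (hV : Measurable (Function.uncurry V)) :
    Measurable (Function.uncurry (picard P V₀ V)) :=
  (measurable_mulVec (stronglyMeasurable_semigroup P) (hV₀.comp measurable_snd)).sub
    (measurable_duhamel P hV)

/-! ### Pointwise bounds of the nonlinearity -/

/-- Convolution of nonnegative functions. -/
def lconv (a b : E → ℝ≥0∞) (ξ : E) : ℝ≥0∞ := ∫⁻ η, a η * b (ξ - η)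

theorem lintegral_lconv {a b : E → ℝ≥0∞} (ha : Measurable a) (hb : Measurable b) :
    ∫⁻ ξ, lconv a b ξ = (∫⁻ ξ, a ξ) * ∫⁻ ξ, b ξ := by
  simp only [lconv]
  rw [lintegral_lintegral_swap]
  · have : ∀ η, ∫⁻ ξ, a η * b (ξ - η) = a η * ∫⁻ ξ, b ξ := by
      intro η
      rw [lintegral_const_mul _ (by fun_prop), lintegral_sub_right_eq_self b η]
    simp_rw [this]
    rw [lintegral_mul_const _ ha]
  · exact ((ha.comp measurable_snd).mul (hb.comp (measurable_fst.sub measurable_snd))).aemeasurable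

theorem measurable_lconv {a b : ℝ → E → ℝ≥0∞} (ha : Measurable (Function.uncurry a))
    (hb : Measurable (Function.uncurry b)) :
    Measurable (Function.uncurry fun t => lconv (a t) (b t)) := by
  have : Measurable fun q : (ℝ × E) × E => a q.1.1 q.2 * b q.1.1 (q.1.2 - q.2) :=
    (ha.comp (measurable_fst.fst.prodMk measurable_snd)).mul
      (hb.comp (measurable_fst.fst.prodMk (measurable_fst.snd.sub measurable_snd)))
  exact this.lintegral_prod_right'

/-- The pointwise size of a field in the rescaled norm. -/
def size (d : ℝˣ) (V : E → Fin 4 → ℂ) (ξ : E) : ℝ≥0∞ := ‖scale d (V ξ)‖ₑ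

theorem measurable_size {d : ℝˣ} {V : E → Fin 4 → ℂ} (hV : Measurable V) : Measurable (size d V) :=
  ((scale d).continuous.measurable.comp hV).enorm

theorem measurable_uncurry_size {d : ℝˣ} {V : ℝ → E → Fin 4 → ℂ}
    (hV : Measurable (Function.uncurry V)) : Measurable (Function.uncurry fun t => size d (V t)) :=
  ((scale d).continuous.measurable.comp hV).enorm

theorem enorm_extFreq_le (ξ : E) (j : Fin 4) : ‖extFreq ξ j‖ₑ ≤ ‖ξ‖ₑ := by
  have h : ∀ i : Fin 3, ‖((ξ i : ℝ) : ℂ)‖ₑ ≤ ‖ξ‖ₑ := fun i => by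
    rw [enorm_le_iff_norm_le, Complex.norm_real]
    exact PiLp.norm_apply_le ξ i
  fin_cases j
  · exact h 0
  · exact h 1
  · exact h 2
  · simp [extFreq]

/-- The bilinear majorant of the difference of two advection terms. -/
def majorant (d : ℝˣ) (V W : E → Fin 4 → ℂ) (ξ : E) : ℝ≥0∞ :=
  lconv (size d V) (size d (V - W)) ξ + lconv (size d (V - W)) (size d W) ξ

/-- The quadratic term is split as `VV - WW = V(V - W) + (V - W)W`. The constant is `16 · 2π`: four
components, four derivatives, each with symbol bounded by `2π|ξ|`. Convergence of the convolutions
is not required, since `enorm_integral_sub_integral_le` covers divergent integrals. -/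
theorem size_advection_sub_le (d : ℝˣ) {V W : E → Fin 4 → ℂ} (hV : Measurable V) (hW : Measurable W)
    (ξ : E) : ‖scale d (advection V ξ - advection W ξ)‖ₑ ≤
      ENNReal.ofReal (32 * Real.pi) * (‖ξ‖ₑ * majorant d V W ξ) := by
  have hcomp : ∀ k, ‖scaleWeight d k‖ₑ * ‖(advection V ξ - advection W ξ) k‖ₑ ≤
      ∑ _j : Fin 4, ENNReal.ofReal (2 * Real.pi) * (‖ξ‖ₑ * majorant d V W ξ) := by
    intro k
    have e1 : (advection V ξ - advection W ξ) k = ∑ j, 2 * Real.pi * Complex.I * extFreq ξ j *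
        ((∫ η, V η j * V (ξ - η) k) - ∫ η, W η j * W (ξ - η) k) := by
      simp only [advection, Pi.sub_apply, mul_sub, Finset.sum_sub_distrib]
    rw [e1]
    refine (mul_le_mul_right (enorm_sum_le _ _) _).trans ?_
    rw [Finset.mul_sum]
    refine Finset.sum_le_sum fun j _ => ?_
    -- Only velocity components transport: the fourth entry of `extFreq` is zero. For the other `j`
    -- the factor of index `j` has weight 1, and the weight of component `k` goes to the other
    -- factor. The estimate is therefore independent of `d`.
    by_cases hj : j = 3
    · simp [hj, extFreq]
    have hmeas : ∀ U : E → Fin 4 → ℂ, Measurable U →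
        AEStronglyMeasurable (fun η => U η j * U (ξ - η) k) volume := fun U hU =>
      (((measurable_pi_apply j).comp hU).mul ((measurable_pi_apply k).comp
        (hU.comp (measurable_const.sub measurable_id)))).aestronglyMeasurable
    have hint : ‖scaleWeight d k‖ₑ * ‖(∫ η, V η j * V (ξ - η) k) - ∫ η, W η j * W (ξ - η) k‖ₑ ≤
        majorant d V W ξ := by
      refine (mul_le_mul_right (enorm_integral_sub_integral_le (hmeas V hV) (hmeas W hW)) _).trans ?_
      rw [← lintegral_const_mul' _ _ enorm_ne_top, majorant, lconv, lconv, ← lintegral_add_left]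
      · refine lintegral_mono fun η => ?_
        have e2 : V η j * V (ξ - η) k - W η j * W (ξ - η) k =
          V η j * (V - W) (ξ - η) k + (V - W) η j * W (ξ - η) k := by
          simp only [Pi.sub_apply]; ring
        rw [e2]
        calc _ ≤ ‖scaleWeight d k‖ₑ * (‖V η j‖ₑ * ‖(V - W) (ξ - η) k‖ₑ +
              ‖(V - W) η j‖ₑ * ‖W (ξ - η) k‖ₑ) := by
              gcongr
              refine (enorm_add_le _ _).trans ?_
              rw [enorm_mul, enorm_mul]
          _ = ‖V η j‖ₑ * (‖scaleWeight d k‖ₑ * ‖(V - W) (ξ - η) k‖ₑ) +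
              ‖(V - W) η j‖ₑ * (‖scaleWeight d k‖ₑ * ‖W (ξ - η) k‖ₑ) := by ring
          _ ≤ _ := by
              gcongr
              · exact enorm_velocity_le d _ hj
              · exact enorm_scaleWeight_mul_le d _ k
              · exact enorm_velocity_le d _ hj
              · exact enorm_scaleWeight_mul_le d _ k
      · exact (measurable_size hV).mul ((measurable_size (hV.sub hW)).comp
          (measurable_const.sub measurable_id))
    rw [enorm_mul, enorm_mul]
    have hpi : ‖2 * (Real.pi : ℂ) * Complex.I‖ₑ = ENNReal.ofReal (2 * Real.pi) := by
      rw [← ofReal_norm]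
      simp [abs_of_pos Real.pi_pos]
    rw [hpi]
    calc _ = ENNReal.ofReal (2 * Real.pi) * (‖extFreq ξ j‖ₑ * (‖scaleWeight d k‖ₑ *
          ‖(∫ η, V η j * V (ξ - η) k) - ∫ η, W η j * W (ξ - η) k‖ₑ)) := by ring
      _ ≤ _ := by
        gcongr
        exact enorm_extFreq_le ξ j
  refine (enorm_scale_le_sum d _).trans ((Finset.sum_le_sum fun k _ => hcomp k).trans (le_of_eq ?_))
  simp only [Finset.sum_const, Finset.card_univ, Fintype.card_fin, nsmul_eq_mul]
  have : ENNReal.ofReal (32 * Real.pi) = 16 * ENNReal.ofReal (2 * Real.pi) := by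
    rw [show (16 : ℝ≥0∞) = ENNReal.ofReal 16 by simp, ← ENNReal.ofReal_mul (by norm_num)]
    ring_nf
  rw [this]
  push_cast
  ring

/-! ### Smoothing estimates for the heat kernel -/

/-- The symbol of the heat semigroup. -/
def heatKer (P : Parameters) (t : ℝ) (ξ : E) : ℝ≥0∞ :=
  ENNReal.ofReal (Real.exp (-(4 * Real.pi ^ 2 * P.ν * ‖ξ‖ ^ 2) * t))

theorem measurable_heatKer (P : Parameters) :
    Measurable fun p : ℝ × E => heatKer P p.1 p.2 := by
  unfold heatKer; fun_prop

theorem measurable_heatKer_left (P : Parameters) (ξ : E) : Measurable fun t => heatKer P t ξ := by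
  unfold heatKer; fun_prop

theorem heatKer_le_one (P : Parameters) {t : ℝ} (ht : 0 ≤ t) (ξ : E) : heatKer P t ξ ≤ 1 := by
  rw [heatKer, ENNReal.ofReal_le_one, Real.exp_le_one_iff]
  have := P.ν_pos
  have : 0 ≤ 4 * Real.pi ^ 2 * P.ν * ‖ξ‖ ^ 2 := by positivity
  nlinarith

/-- The constant in the `L^p` smoothing estimate of the heat semigroup. -/
def heatConst (P : Parameters) (p : ℝ) : ℝ≥0∞ :=
  ENNReal.ofReal (1 / (4 * Real.pi ^ 2 * P.ν * p)) ^ (1 / p)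

theorem heatConst_ne_top (P : Parameters) {p : ℝ} (hp : 0 < p) : heatConst P p ≠ ∞ :=
  ENNReal.rpow_ne_top_of_nonneg (by positivity) ENNReal.ofReal_ne_top

theorem eLpNorm_ofReal_eq {α : Type*} [MeasurableSpace α] {μ : Measure α} (f : α → ℝ≥0∞) {p : ℝ}
    (hp : 0 < p) : eLpNorm f (ENNReal.ofReal p) μ = (∫⁻ a, f a ^ p ∂μ) ^ (1 / p) := by
  rw [eLpNorm_eq_lintegral_rpow_enorm_toReal (by simpa using hp) (by simp),
    ENNReal.toReal_ofReal hp.le]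
  simp

theorem eLpNorm_lintegral_le {α β : Type*} [MeasurableSpace α] [MeasurableSpace β] {μ : Measure α}
    {ν : Measure β} [SigmaFinite μ] [SFinite ν] {f : α → β → ℝ≥0∞}
    (hf : Measurable (Function.uncurry f)) {p : ℝ} (hp : 1 ≤ p) :
    eLpNorm (fun a => ∫⁻ b, f a b ∂ν) (ENNReal.ofReal p) μ ≤
      ∫⁻ b, eLpNorm (fun a => f a b) (ENNReal.ofReal p) μ ∂ν := by
  have hp0 : 0 < p := by linarith
  simp_rw [eLpNorm_ofReal_eq _ hp0]
  exact lintegral_lintegral_rpow_le hf hp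

theorem lintegral_Ici_exp {b : ℝ} (hb : 0 < b) (s : ℝ) :
    ∫⁻ t in Ici s, ENNReal.ofReal (Real.exp (-b * (t - s))) = ENNReal.ofReal (1 / b) := by
  have h1 : ∫⁻ t in Ici s, ENNReal.ofReal (Real.exp (-b * (t - s))) =
      ∫⁻ t in Ioi (0 : ℝ), ENNReal.ofReal (Real.exp (-b * t)) := by
    rw [setLIntegral_congr Ioi_ae_eq_Ici.symm, ← lintegral_indicator measurableSet_Ioi,
      ← lintegral_indicator measurableSet_Ioi,
      ← lintegral_sub_right_eq_self ((Ioi (0 : ℝ)).indicator _) s]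
    congr 1; ext t
    simp [indicator, sub_pos]
  rw [h1, ← ofReal_integral_eq_lintegral_ofReal]
  · have := integral_exp_mul_Ioi (a := -b) (by linarith) 0
    rw [this]; simp
  · exact integrableOn_exp_mul_Ioi (by linarith) 0
  · exact Eventually.of_forall fun t => Real.exp_nonneg _

/-- The integral of `exp(-4π²ν|ξ|²p(t - s))` over `t ≥ s` is `1/(4π²ν|ξ|²p)`, and its `p`-th root
gives the gain `|ξ|^(-2/p)`. The starting time `s` is free because in Duhamel's formula it becomes
the integration variable `τ`. -/
theorem eLpNorm_heatKer_le (P : Parameters) {p : ℝ} (hp : 0 < p) (I : Set ℝ) (s : ℝ) {ξ : E}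
    (hξ : ξ ≠ 0) :
    eLpNorm ((Ici s).indicator fun t => heatKer P (t - s) ξ) (ENNReal.ofReal p) (volume.restrict I) ≤
      heatConst P p * ‖ξ‖ₑ ^ (-(2 / p)) := by
  have hν := P.ν_pos
  have hξ' : 0 < ‖ξ‖ := norm_pos_iff.2 hξ
  refine (eLpNorm_mono_measure _ Measure.restrict_le_self).trans ?_
  rw [eLpNorm_ofReal_eq _ hp]
  have h1 : ∀ t, (Ici s).indicator (fun t => heatKer P (t - s) ξ) t ^ p =
      (Ici s).indicator (fun t =>
        ENNReal.ofReal (Real.exp (-(4 * Real.pi ^ 2 * P.ν * ‖ξ‖ ^ 2 * p) * (t - s)))) t := by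
    intro t
    by_cases ht : t ∈ Ici s
    · rw [indicator_of_mem ht, indicator_of_mem ht, heatKer,
        ENNReal.ofReal_rpow_of_pos (Real.exp_pos _), ← Real.exp_mul]
      ring_nf
    · rw [indicator_of_notMem ht, indicator_of_notMem ht, ENNReal.zero_rpow_of_pos hp]
  simp_rw [h1]
  rw [lintegral_indicator measurableSet_Ici, lintegral_Ici_exp (by positivity), heatConst]
  have h2 : ENNReal.ofReal (1 / (4 * Real.pi ^ 2 * P.ν * ‖ξ‖ ^ 2 * p)) =
      ENNReal.ofReal (1 / (4 * Real.pi ^ 2 * P.ν * p)) * ‖ξ‖ₑ ^ (-2 : ℝ) := by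
    rw [← ofReal_norm, ENNReal.ofReal_rpow_of_pos hξ', ← ENNReal.ofReal_mul (by positivity)]
    congr 1
    rw [Real.rpow_neg hξ'.le]
    norm_cast
    field_simp
  rw [h2, ENNReal.mul_rpow_of_nonneg _ _ (by positivity), ← ENNReal.rpow_mul]
  apply le_of_eq
  congr 2
  ring

/-- Minkowski's inequality takes the time norm inside the frequency integral, where only the heat
kernel depends on time. -/
theorem eLpNorm_lintegral_heatKer_le (P : Parameters) {p : ℝ} (hp : 1 ≤ p) {I : Set ℝ}
    (hI : MeasurableSet I) (hI0 : I ⊆ Ici 0) {φ a : E → ℝ≥0∞} (hφ : Measurable φ)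
    (ha : Measurable a) :
    eLpNorm (fun t => ∫⁻ ξ, φ ξ * (heatKer P t ξ * a ξ)) (ENNReal.ofReal p) (volume.restrict I) ≤
      heatConst P p * ∫⁻ ξ, φ ξ * (‖ξ‖ₑ ^ (-(2 / p)) * a ξ) := by
  have hp0 : 0 < p := by linarith
  have hm : Measurable (Function.uncurry fun (t : ℝ) (ξ : E) => φ ξ * (heatKer P t ξ * a ξ)) :=
    (hφ.comp measurable_snd).mul ((measurable_heatKer P).mul (ha.comp measurable_snd))
  refine (eLpNorm_lintegral_le hm hp).trans ?_
  rw [← lintegral_const_mul' _ _ (heatConst_ne_top P hp0)]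
  refine lintegral_mono_ae ?_
  filter_upwards [ae_ne_zero] with ξ hξ
  have h1 : eLpNorm (fun t => φ ξ * (heatKer P t ξ * a ξ)) (ENNReal.ofReal p) (volume.restrict I) =
      φ ξ * a ξ * eLpNorm ((Ici 0).indicator fun t => heatKer P (t - 0) ξ) (ENNReal.ofReal p)
        (volume.restrict I) := by
    rw [eLpNorm_ofReal_eq _ hp0, eLpNorm_ofReal_eq _ hp0]
    have hmk : Measurable fun t => heatKer P t ξ := measurable_heatKer_left P ξ
    have h2 : ∫⁻ t in I, (φ ξ * (heatKer P t ξ * a ξ)) ^ p =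
        (φ ξ * a ξ) ^ p * ∫⁻ t in I, (Ici (0 : ℝ)).indicator (fun t => heatKer P (t - 0) ξ) t ^ p := by
      rw [← lintegral_const_mul]
      · refine setLIntegral_congr_fun hI fun t ht => ?_
        simp only [indicator_of_mem (hI0 ht), sub_zero]
        rw [← ENNReal.mul_rpow_of_nonneg _ _ hp0.le]
        ring_nf
      · simp only [sub_zero]
        exact (hmk.indicator measurableSet_Ici).pow_const _
    rw [h2, ENNReal.mul_rpow_of_nonneg _ _ (by positivity), ← ENNReal.rpow_mul,
      mul_one_div_cancel hp0.ne', ENNReal.rpow_one]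
  rw [h1]
  calc _ ≤ φ ξ * a ξ * (heatConst P p * ‖ξ‖ₑ ^ (-(2 / p))) := by
        gcongr
        exact eLpNorm_heatKer_le P hp0 I 0 hξ
    _ = _ := by ring

/-- Minkowski's inequality over the pairs `(τ, ξ)`: the norm in `t` falls on the heat kernel alone.
The derivative `|ξ|` and the gain `|ξ|^(-2/p)` combine to `|ξ|^(1 - 2/p)`, with exact cancellation
for `p = 2`. -/
theorem eLpNorm_lintegral_duhamel_le (P : Parameters) {p : ℝ} (hp : 1 ≤ p) {I : Set ℝ}
    (hI : MeasurableSet I) (hIc : ∀ t ∈ I, Icc 0 t ⊆ I) {φ : E → ℝ≥0∞} (hφ : Measurable φ)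
    {h : ℝ → E → ℝ≥0∞} (hh : Measurable (Function.uncurry h)) :
    eLpNorm (fun t => ∫⁻ ξ, φ ξ * ∫⁻ τ in Ioc 0 t, heatKer P (t - τ) ξ * (‖ξ‖ₑ * h τ ξ))
        (ENNReal.ofReal p) (volume.restrict I) ≤
      heatConst P p * ∫⁻ τ in I, ∫⁻ ξ, φ ξ * (‖ξ‖ₑ ^ (1 - 2 / p) * h τ ξ) := by
  have hp0 : 0 < p := by linarith
  let f : ℝ → ℝ × E → ℝ≥0∞ := fun t q =>
    φ q.2 * (‖q.2‖ₑ * h q.1 q.2 * (Ici q.1).indicator (fun t => heatKer P (t - q.1) q.2) t)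
  have hind : Measurable fun z : ℝ × (ℝ × E) =>
      (Ici z.2.1).indicator (fun t => heatKer P (t - z.2.1) z.2.2) z.1 := by
    have h1 : Measurable fun z : ℝ × (ℝ × E) => heatKer P (z.1 - z.2.1) z.2.2 :=
      (measurable_heatKer P).comp ((measurable_fst.sub measurable_snd.fst).prodMk measurable_snd.snd)
    have h2 : MeasurableSet {z : ℝ × (ℝ × E) | z.2.1 ≤ z.1} :=
      measurableSet_le measurable_snd.fst measurable_fst
    exact h1.indicator h2
  have hf : Measurable (Function.uncurry f) := by
    refine (hφ.comp measurable_snd.snd).mul (Measurable.mul ?_ hind)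
    exact (measurable_snd.snd.enorm).mul (hh.comp measurable_snd)
  have hle : ∀ t ∈ I, ∫⁻ ξ, φ ξ * ∫⁻ τ in Ioc 0 t, heatKer P (t - τ) ξ * (‖ξ‖ₑ * h τ ξ) ≤
      ∫⁻ q, f t q ∂((volume.restrict I).prod volume) := by
    intro t ht
    have hft : Measurable fun q => f t q := hf.comp measurable_prodMk_left
    rw [lintegral_prod_symm' _ hft]
    refine lintegral_mono fun ξ => ?_
    have hm : Measurable fun τ => heatKer P (t - τ) ξ * (‖ξ‖ₑ * h τ ξ) :=
      ((measurable_heatKer P).comp ((measurable_const.sub measurable_id).prodMk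
        measurable_const)).mul (measurable_const.mul (hh.comp (measurable_id.prodMk measurable_const)))
    rw [← lintegral_const_mul _ hm]
    refine (lintegral_mono' (Measure.restrict_mono (Ioc_subset_Icc_self.trans (hIc t ht)) le_rfl)
      le_rfl).trans' ?_
    refine setLIntegral_mono (hft.comp measurable_prodMk_right) fun τ hτ => le_of_eq ?_
    simp only [f]
    rw [indicator_of_mem (show t ∈ Ici τ from hτ.2)]
    ring
  calc _ ≤ eLpNorm (fun t => ∫⁻ q, f t q ∂((volume.restrict I).prod volume)) (ENNReal.ofReal p)
        (volume.restrict I) := by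
        refine eLpNorm_mono_enorm_ae ?_
        filter_upwards [ae_restrict_mem hI] with t ht
        simpa using hle t ht
    _ ≤ ∫⁻ q, eLpNorm (fun t => f t q) (ENNReal.ofReal p) (volume.restrict I)
        ∂((volume.restrict I).prod volume) := eLpNorm_lintegral_le hf hp
    _ ≤ ∫⁻ q, heatConst P p * (φ q.2 * (‖q.2‖ₑ ^ (1 - 2 / p) * h q.1 q.2))
        ∂((volume.restrict I).prod volume) := by
        refine lintegral_mono_ae ?_
        have h0 : ∀ᵐ q : ℝ × E ∂((volume.restrict I).prod volume), q.2 ≠ 0 :=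
          Measure.quasiMeasurePreserving_snd.ae ae_ne_zero
        filter_upwards [h0] with q hq
        have e1 : eLpNorm (fun t => f t q) (ENNReal.ofReal p) (volume.restrict I) =
            φ q.2 * (‖q.2‖ₑ * h q.1 q.2) * eLpNorm ((Ici q.1).indicator
              fun t => heatKer P (t - q.1) q.2) (ENNReal.ofReal p) (volume.restrict I) := by
          rw [eLpNorm_ofReal_eq _ hp0, eLpNorm_ofReal_eq _ hp0]
          have hk : Measurable fun t => (Ici q.1).indicator (fun t => heatKer P (t - q.1) q.2) t :=
            hind.comp measurable_prodMk_right
          have e2 : ∫⁻ t in I, f t q ^ p = (φ q.2 * (‖q.2‖ₑ * h q.1 q.2)) ^ p *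
              ∫⁻ t in I, (Ici q.1).indicator (fun t => heatKer P (t - q.1) q.2) t ^ p := by
            rw [← lintegral_const_mul _ (hk.pow_const _)]
            refine lintegral_congr fun t => ?_
            rw [← ENNReal.mul_rpow_of_nonneg _ _ hp0.le]
            simp only [f]
            congr 1; ring
          rw [e2, ENNReal.mul_rpow_of_nonneg _ _ (by positivity), ← ENNReal.rpow_mul,
            mul_one_div_cancel hp0.ne', ENNReal.rpow_one]
        rw [e1]
        calc _ ≤ φ q.2 * (‖q.2‖ₑ * h q.1 q.2) * (heatConst P p * ‖q.2‖ₑ ^ (-(2 / p))) := by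
              gcongr
              exact eLpNorm_heatKer_le P hp0 I q.1 hq
          _ = heatConst P p * (φ q.2 * ((‖q.2‖ₑ ^ (1 : ℝ) * ‖q.2‖ₑ ^ (-(2 / p))) * h q.1 q.2)) := by
              rw [ENNReal.rpow_one]; ring
          _ = _ := by
              rw [← ENNReal.rpow_add _ _ (by simpa using hq) enorm_ne_top, ← sub_eq_add_neg]
    _ = _ := by
        have hg : Measurable fun q : ℝ × E => φ q.2 * (‖q.2‖ₑ ^ (1 - 2 / p) * h q.1 q.2) :=
          (hφ.comp measurable_snd).mul ((measurable_snd.enorm.pow_const _).mul hh)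
        rw [lintegral_const_mul _ hg, lintegral_prod _ hg.aemeasurable]

/-! ### The Duhamel term in the scaled norm -/

/-- The constant of the nonlinear estimates. -/
def duhamelConst (M : ℝ) : ℝ≥0∞ := ENNReal.ofReal M * ENNReal.ofReal (32 * Real.pi)

theorem duhamelConst_ne_top (M : ℝ) : duhamelConst M ≠ ∞ :=
  ENNReal.mul_ne_top ENNReal.ofReal_ne_top ENNReal.ofReal_ne_top

theorem SemigroupBound.enorm_le {P : Parameters} {d : ℝˣ} {M : ℝ} {I : Set ℝ}
    (hB : SemigroupBound P d M I) (hM : 0 ≤ M) {t : ℝ} (ht : t ∈ I) (ξ : E) (x : Fin 4 → ℂ) :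
    ‖scale d ((semigroup P t ξ).mulVec x)‖ₑ ≤ ENNReal.ofReal M * heatKer P t ξ * ‖scale d x‖ₑ := by
  rw [heatKer, ← ofReal_norm, ← ofReal_norm (scale d x), ← ENNReal.ofReal_mul hM,
    ← ENNReal.ofReal_mul (by positivity)]
  exact ENNReal.ofReal_le_ofReal (hB t ht ξ x)

theorem enorm_scale_duhamelIntegrand_sub_le {P : Parameters} {d : ℝˣ} {M : ℝ} {I : Set ℝ}
    (hB : SemigroupBound P d M I) (hM : 0 ≤ M) {V W : ℝ → E → Fin 4 → ℂ}
    (hV : Measurable (Function.uncurry V)) (hW : Measurable (Function.uncurry W)) {t τ : ℝ}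
    (ht : t - τ ∈ I) (ξ : E) :
    ‖scale d (duhamelIntegrand P V t ξ τ - duhamelIntegrand P W t ξ τ)‖ₑ ≤
      duhamelConst M * (heatKer P (t - τ) ξ * (‖ξ‖ₑ * majorant d (V τ) (W τ) ξ)) := by
  rw [duhamelIntegrand, duhamelIntegrand, ← Matrix.mulVec_sub, ← Matrix.mulVec_sub]
  refine (hB.enorm_le hM ht ξ _).trans ?_
  have h1 : ‖scale d ((helmholtz ξ).mulVec (advection (V τ) ξ - advection (W τ) ξ))‖ₑ ≤
      ENNReal.ofReal (32 * Real.pi) * (‖ξ‖ₑ * majorant d (V τ) (W τ) ξ) :=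
    (enorm_le_iff_norm_le.2 (norm_scale_helmholtz_le d ξ _)).trans
      (size_advection_sub_le d hV.of_uncurry_left hW.of_uncurry_left ξ)
  calc _ ≤ ENNReal.ofReal M * heatKer P (t - τ) ξ *
        (ENNReal.ofReal (32 * Real.pi) * (‖ξ‖ₑ * majorant d (V τ) (W τ) ξ)) := by gcongr
    _ = _ := by rw [duhamelConst]; ring

theorem size_duhamel_sub_le {P : Parameters} {d : ℝˣ} {M : ℝ} {I : Set ℝ}
    (hB : SemigroupBound P d M I) (hM : 0 ≤ M) {V W : ℝ → E → Fin 4 → ℂ}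
    (hV : Measurable (Function.uncurry V)) (hW : Measurable (Function.uncurry W)) {t : ℝ}
    (ht0 : 0 ≤ t) (ht : Icc 0 t ⊆ I) (ξ : E) :
    size d (duhamel P V t - duhamel P W t) ξ ≤ duhamelConst M *
      ∫⁻ τ in Ioc 0 t, heatKer P (t - τ) ξ * (‖ξ‖ₑ * majorant d (V τ) (W τ) ξ) := by
  have hmeas : ∀ {U : ℝ → E → Fin 4 → ℂ}, Measurable (Function.uncurry U) →
      AEStronglyMeasurable (fun τ => scale d (duhamelIntegrand P U t ξ τ))
        (volume.restrict (Ioc 0 t)) := fun {U} hU => by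
    have h0 : Measurable fun τ : ℝ => ((t, ξ), τ) := measurable_prodMk_left
    have h1 := (measurable_duhamelIntegrand P hU).comp h0
    simp only [Function.comp_def] at h1
    have h2 := (scale d).continuous.measurable.comp h1
    simp only [Function.comp_def] at h2
    exact h2.aestronglyMeasurable
  have e : ∀ U : ℝ → E → Fin 4 → ℂ, scale d (duhamel P U t ξ) =
      ∫ τ in Ioc 0 t, scale d (duhamelIntegrand P U t ξ τ) := by
    intro U
    rw [duhamel, intervalIntegral.integral_of_le ht0,
      ← ContinuousLinearEquiv.integral_comp_comm (scale d)]
  rw [size, Pi.sub_apply, map_sub, e, e]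
  refine (enorm_integral_sub_integral_le (hmeas hV) (hmeas hW)).trans ?_
  rw [← lintegral_const_mul' _ _ (duhamelConst_ne_top M)]
  refine setLIntegral_mono' measurableSet_Ioc fun τ hτ => ?_
  rw [← map_sub]
  exact enorm_scale_duhamelIntegrand_sub_le hB hM hV hW
    (ht ⟨by linarith [hτ.2], by linarith [hτ.1]⟩) ξ

theorem measurable_majorant {d : ℝˣ} {V W : ℝ → E → Fin 4 → ℂ}
    (hV : Measurable (Function.uncurry V)) (hW : Measurable (Function.uncurry W)) :
    Measurable (Function.uncurry fun τ => majorant d (V τ) (W τ)) := by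
  have hVW : Measurable (Function.uncurry fun τ => V τ - W τ) := hV.sub hW
  exact (measurable_lconv (measurable_uncurry_size hV) (measurable_uncurry_size hVW)).add
    (measurable_lconv (measurable_uncurry_size hVW) (measurable_uncurry_size hW))

theorem lintegral_majorant {d : ℝˣ} {V W : E → Fin 4 → ℂ} (hV : Measurable V) (hW : Measurable W) :
    ∫⁻ ξ, majorant d V W ξ =
      (∫⁻ ξ, size d (V - W) ξ) * ((∫⁻ ξ, size d V ξ) + ∫⁻ ξ, size d W ξ) := by
  have h1 := measurable_size (d := d) hV
  have h2 := measurable_size (d := d) hW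
  have h3 := measurable_size (d := d) (hV.sub hW)
  simp only [majorant]
  rw [lintegral_add_left, lintegral_lconv h1 h3, lintegral_lconv h3 h2]
  · ring
  · have := measurable_lconv (a := fun _ => size d V) (b := fun _ => size d (V - W))
      (h1.comp measurable_snd) (h3.comp measurable_snd)
    exact this.of_uncurry_left (x := 0)

/-- The norm of `L²(I; L¹)`. -/
def zNorm (d : ℝˣ) (I : Set ℝ) (V : ℝ → E → Fin 4 → ℂ) : ℝ≥0∞ :=
  eLpNorm (fun t => ∫⁻ ξ, size d (V t) ξ) (ENNReal.ofReal 2) (volume.restrict I)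

theorem measurable_lintegral_size {d : ℝˣ} {V : ℝ → E → Fin 4 → ℂ}
    (hV : Measurable (Function.uncurry V)) : Measurable fun t => ∫⁻ ξ, size d (V t) ξ :=
  (measurable_uncurry_size hV).lintegral_prod_right'

/-- The Lipschitz constant of the Duhamel term. -/
def lipConst (P : Parameters) (M : ℝ) : ℝ≥0∞ := duhamelConst M * heatConst P 2

theorem lipConst_ne_top (P : Parameters) (M : ℝ) : lipConst P M ≠ ∞ :=
  ENNReal.mul_ne_top (duhamelConst_ne_top M) (heatConst_ne_top P two_pos)

/-- For `p = 2` the weight `|ξ|^(1 - 2/p)` is 1 and the L¹ norm of a convolution is the product of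
the L¹ norms. The integral in time of that product is kept, rather than bounded by Cauchy-Schwarz,
because the uniqueness criterion needs it in this form. -/
theorem zNorm_duhamel_sub_le {P : Parameters} {d : ℝˣ} {M : ℝ} {I : Set ℝ}
    (hB : SemigroupBound P d M I) (hM : 0 ≤ M) (hI : MeasurableSet I) (hI0 : I ⊆ Ici 0)
    (hIc : ∀ t ∈ I, Icc 0 t ⊆ I) {V W : ℝ → E → Fin 4 → ℂ}
    (hV : Measurable (Function.uncurry V)) (hW : Measurable (Function.uncurry W)) :
    zNorm d I (fun t => duhamel P V t - duhamel P W t) ≤ lipConst P M *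
      ∫⁻ t in I, (∫⁻ ξ, size d (V t - W t) ξ) *
        ((∫⁻ ξ, size d (V t) ξ) + ∫⁻ ξ, size d (W t) ξ) := by
  have hmaj := measurable_majorant (d := d) hV hW
  have key := eLpNorm_lintegral_duhamel_le P (p := 2) (by norm_num) hI hIc
    (φ := fun _ => duhamelConst M) measurable_const hmaj
  calc _ ≤ _ := by
        refine eLpNorm_mono_enorm_ae (g := fun t => ∫⁻ ξ, duhamelConst M * ∫⁻ τ in Ioc 0 t,
          heatKer P (t - τ) ξ * (‖ξ‖ₑ * majorant d (V τ) (W τ) ξ)) ?_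
        filter_upwards [ae_restrict_mem hI] with t ht
        simp only [enorm_eq_self]
        exact lintegral_mono fun ξ => size_duhamel_sub_le hB hM hV hW (hI0 ht) (hIc t ht) ξ
    _ ≤ _ := key
    _ = _ := by
        have e : ∀ τ, ∫⁻ ξ, duhamelConst M * (‖ξ‖ₑ ^ (1 - 2 / 2 : ℝ) * majorant d (V τ) (W τ) ξ) =
            duhamelConst M * ((∫⁻ ξ, size d (V τ - W τ) ξ) *
              ((∫⁻ ξ, size d (V τ) ξ) + ∫⁻ ξ, size d (W τ) ξ)) := by
          intro τ
          rw [← lintegral_majorant hV.of_uncurry_left hW.of_uncurry_left,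
            ← lintegral_const_mul' _ _ (duhamelConst_ne_top M)]
          simp
        simp_rw [e]
        rw [lintegral_const_mul' _ _ (duhamelConst_ne_top M), lipConst]
        ring

theorem zNorm_duhamel_sub_le_mul {P : Parameters} {d : ℝˣ} {M : ℝ} {I : Set ℝ}
    (hB : SemigroupBound P d M I) (hM : 0 ≤ M) (hI : MeasurableSet I) (hI0 : I ⊆ Ici 0)
    (hIc : ∀ t ∈ I, Icc 0 t ⊆ I) {V W : ℝ → E → Fin 4 → ℂ}
    (hV : Measurable (Function.uncurry V)) (hW : Measurable (Function.uncurry W)) :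
    zNorm d I (fun t => duhamel P V t - duhamel P W t) ≤
      lipConst P M * (zNorm d I (fun t => V t - W t) * (zNorm d I V + zNorm d I W)) := by
  refine (zNorm_duhamel_sub_le hB hM hI hI0 hIc hV hW).trans ?_
  have hVW : Measurable (Function.uncurry fun τ => V τ - W τ) := hV.sub hW
  have h1 := measurable_lintegral_size (d := d) hV
  have h2 := measurable_lintegral_size (d := d) hW
  have h3 := measurable_lintegral_size (d := d) hVW
  gcongr
  refine (lintegral_mul_le_eLpNorm_mul_eLpNorm h3.aemeasurable (h1.add h2).aemeasurable
    Real.HolderConjugate.two_two).trans ?_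
  gcongr
  · exact le_rfl
  · exact eLpNorm_add_le h1.aestronglyMeasurable h2.aestronglyMeasurable (by simp)

/-! ### Calculus of the norm of `L²(I; L¹)` -/

theorem zNorm_mono {d : ℝˣ} {I : Set ℝ} (hI : MeasurableSet I) {V : ℝ → E → Fin 4 → ℂ}
    {a : ℝ → ℝ≥0∞} (h : ∀ t ∈ I, ∫⁻ ξ, size d (V t) ξ ≤ a t) :
    zNorm d I V ≤ eLpNorm a (ENNReal.ofReal 2) (volume.restrict I) := by
  refine eLpNorm_mono_enorm_ae ?_
  filter_upwards [ae_restrict_mem hI] with t ht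
  simpa using h t ht

theorem zNorm_le_add {d : ℝˣ} {I : Set ℝ} {U V W : ℝ → E → Fin 4 → ℂ}
    (hV : Measurable (Function.uncurry V)) (hW : Measurable (Function.uncurry W))
    (h : ∀ t ∈ I, ∀ ξ, size d (U t) ξ ≤ size d (V t) ξ + size d (W t) ξ) (hI : MeasurableSet I) :
    zNorm d I U ≤ zNorm d I V + zNorm d I W := by
  refine (zNorm_mono hI fun t ht => ?_).trans (eLpNorm_add_le
    (measurable_lintegral_size hV).aestronglyMeasurable
    (measurable_lintegral_size hW).aestronglyMeasurable (by simp))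
  simp only [Pi.add_apply]
  rw [← lintegral_add_left (measurable_size hV.of_uncurry_left)]
  exact lintegral_mono (h t ht)

theorem size_sub_le (d : ℝˣ) (U V W : E → Fin 4 → ℂ) (ξ : E) :
    size d (U - W) ξ ≤ size d (U - V) ξ + size d (V - W) ξ := by
  simp only [size, Pi.sub_apply, map_sub]
  rw [← sub_add_sub_cancel (scale d (U ξ)) (scale d (V ξ)) (scale d (W ξ))]
  exact enorm_add_le _ _

theorem size_sub_comm (d : ℝˣ) (U V : E → Fin 4 → ℂ) (ξ : E) :
    size d (U - V) ξ = size d (V - U) ξ := by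
  simp only [size, Pi.sub_apply, map_sub]
  exact enorm_sub_rev _ _

theorem size_le_add (d : ℝˣ) (U V : E → Fin 4 → ℂ) (ξ : E) :
    size d U ξ ≤ size d (U - V) ξ + size d V ξ := by
  simpa [size] using size_sub_le d U V 0 ξ

theorem ae_eq_of_zNorm_sub_eq_zero {d : ℝˣ} {I : Set ℝ} {V W : ℝ → E → Fin 4 → ℂ}
    (hV : Measurable (Function.uncurry V)) (hW : Measurable (Function.uncurry W))
    (h : zNorm d I (fun t => V t - W t) = 0) :
    ∀ᵐ t ∂volume.restrict I, V t =ᵐ[volume] W t := by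
  have hVW : Measurable (Function.uncurry fun t => V t - W t) := hV.sub hW
  rw [zNorm, eLpNorm_eq_zero_iff (measurable_lintegral_size hVW).aestronglyMeasurable
    (by simp)] at h
  filter_upwards [h] with t ht
  have h1 : ∫⁻ ξ, size d (V t - W t) ξ = 0 := ht
  rw [lintegral_eq_zero_iff (measurable_size hVW.of_uncurry_left)] at h1
  filter_upwards [h1] with ξ hξ
  have h2 : ‖scale d ((V t - W t) ξ)‖ₑ = 0 := hξ
  rw [enorm_eq_zero, map_eq_zero_iff _ (scale d).injective] at h2
  exact sub_eq_zero.1 h2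

/-- The hypothesis is almost everywhere, the conclusion at every frequency, since convolution
integrals do not see null sets. One application of `picard` thus upgrades an almost-everywhere fixed
point to an exact one. -/
theorem advection_congr {v w : E → Fin 4 → ℂ} (h : v =ᵐ[volume] w) : advection v = advection w := by
  ext ξ k
  simp only [advection]
  refine Finset.sum_congr rfl fun j _ => ?_
  congr 1
  refine integral_congr_ae ?_
  have h2 : ∀ᵐ η : E, v (ξ - η) = w (ξ - η) :=
    (quasiMeasurePreserving_sub_left volume ξ).ae h
  filter_upwards [h, h2] with η h1 h2
  rw [h1, h2]

theorem duhamel_congr (P : Parameters) {V W : ℝ → E → Fin 4 → ℂ} {t : ℝ} (ht : 0 ≤ t)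
    (h : ∀ᵐ τ ∂volume.restrict (Icc 0 t), V τ =ᵐ[volume] W τ) : duhamel P V t = duhamel P W t := by
  ext1 ξ
  simp only [duhamel]
  rw [intervalIntegral.integral_of_le ht, intervalIntegral.integral_of_le ht,
    ← integral_Icc_eq_integral_Ioc, ← integral_Icc_eq_integral_Ioc]
  refine integral_congr_ae ?_
  filter_upwards [h] with τ hτ
  rw [duhamelIntegrand, duhamelIntegrand, advection_congr hτ]

theorem size_picard_sub (d : ℝˣ) (P : Parameters) (V₀ : E → Fin 4 → ℂ) (V W : ℝ → E → Fin 4 → ℂ)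
    (t : ℝ) (ξ : E) : size d (picard P V₀ V t - picard P V₀ W t) ξ =
      size d (duhamel P V t - duhamel P W t) ξ := by
  rw [size_sub_comm d (duhamel P V t)]
  simp only [size, Pi.sub_apply, picard]
  congr 2
  abel

/-! ### Uniqueness -/

theorem zNorm_sq {d : ℝˣ} {I : Set ℝ} (V : ℝ → E → Fin 4 → ℂ) :
    zNorm d I V ^ 2 = ∫⁻ t in I, (∫⁻ ξ, size d (V t) ξ) ^ 2 := by
  rw [zNorm, eLpNorm_ofReal_eq _ two_pos, ← ENNReal.rpow_natCast, ← ENNReal.rpow_mul]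
  norm_num

/-- On every `[0, b]` the difference equals the difference of the Duhamel terms, so
`zNorm_duhamel_sub_le` is exactly the hypothesis of `setLIntegral_sq_eq_zero_of_le`. The equality is
stated for the Picard images, which are determined at the given time `T` although `V` and `W` solve
the equation only at almost every time. -/
theorem picard_eq_of_ae_eq {P : Parameters} {d : ℝˣ} {M : ℝ} {I : Set ℝ}
    (hB : SemigroupBound P d M I) (hM : 0 ≤ M) (hI0 : I ⊆ Ici 0) (hIc : ∀ t ∈ I, Icc 0 t ⊆ I)
    {V₀ : E → Fin 4 → ℂ} {V W : ℝ → E → Fin 4 → ℂ}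
    (hV : Measurable (Function.uncurry V)) (hW : Measurable (Function.uncurry W))
    (hVz : zNorm d I V ≠ ∞) (hWz : zNorm d I W ≠ ∞)
    (hVp : ∀ᵐ t ∂volume.restrict I, V t =ᵐ[volume] picard P V₀ V t)
    (hWp : ∀ᵐ t ∂volume.restrict I, W t =ᵐ[volume] picard P V₀ W t) {T : ℝ} (hT : T ∈ I) :
    picard P V₀ V T = picard P V₀ W T := by
  have hVW : Measurable (Function.uncurry fun t => V t - W t) := hV.sub hW
  have hT0 : 0 ≤ T := hI0 hT
  have hfin : ∀ U : ℝ → E → Fin 4 → ℂ, zNorm d I U ≠ ∞ →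
      ∫⁻ t in Icc 0 T, (∫⁻ ξ, size d (U t) ξ) ^ 2 ≠ ∞ := by
    intro U hU
    refine ne_top_of_le_ne_top (ENNReal.pow_ne_top (n := 2) hU) ?_
    rw [zNorm_sq]
    exact lintegral_mono_set (hIc T hT)
  have hmV := measurable_lintegral_size (d := d) hV
  have hmW := measurable_lintegral_size (d := d) hW
  have hmVW := measurable_lintegral_size (d := d) hVW
  have hsum : ∫⁻ t in Icc 0 T, ((∫⁻ ξ, size d (V t) ξ) + ∫⁻ ξ, size d (W t) ξ) ^ 2 ≠ ∞ := by
    have hle : ∀ x y : ℝ≥0∞, (x + y) ^ 2 ≤ 2 * (x ^ 2 + y ^ 2) := fun x y => by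
      have := ENNReal.rpow_add_le_mul_rpow_add_rpow x y (p := 2) (by norm_num)
      norm_num at this
      exact_mod_cast this
    refine ne_top_of_le_ne_top ?_ (lintegral_mono fun t => hle _ _)
    rw [lintegral_const_mul' _ _ (by simp), lintegral_add_left (hmV.pow_const 2)]
    exact ENNReal.mul_ne_top (by simp) (ENNReal.add_ne_top.2 ⟨hfin V hVz, hfin W hWz⟩)
  have hdiff : ∫⁻ t in Icc 0 T, (∫⁻ ξ, size d (V t - W t) ξ) ^ 2 ≠ ∞ := by
    refine ne_top_of_le_ne_top hsum (lintegral_mono fun t => ?_)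
    gcongr
    rw [← lintegral_add_left (measurable_size hV.of_uncurry_left)]
    refine lintegral_mono fun ξ => ?_
    simp only [size, Pi.sub_apply, map_sub]
    exact enorm_sub_le
  have hzero := setLIntegral_sq_eq_zero_of_le hmVW (hmV.add hmW) hT0
    (K := lipConst P M ^ 2) (ENNReal.pow_ne_top (lipConst_ne_top P M)) hdiff hsum fun b hb => by
    have hbI : Icc 0 b ⊆ I := (Icc_subset_Icc_right hb.2).trans (hIc T hT)
    have hBb : SemigroupBound P d M (Icc 0 b) := fun t ht => hB t (hbI ht)
    have key := zNorm_duhamel_sub_le hBb hM measurableSet_Icc (fun t ht => ht.1)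
      (fun t ht => Icc_subset_Icc_right ht.2) hV hW
    have heq : zNorm d (Icc 0 b) (fun t => V t - W t) =
        zNorm d (Icc 0 b) (fun t => duhamel P V t - duhamel P W t) := by
      refine eLpNorm_congr_ae ?_
      filter_upwards [ae_restrict_of_ae_restrict_of_subset hbI hVp,
        ae_restrict_of_ae_restrict_of_subset hbI hWp] with t h1 h2
      refine lintegral_congr_ae ?_
      filter_upwards [h1, h2] with ξ h3 h4
      rw [← size_picard_sub d P V₀]
      simp only [size, Pi.sub_apply, h3, h4]
    rw [← zNorm_sq, heq, ← mul_pow]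
    exact pow_le_pow_left' key 2
  have hz0 : zNorm d (Icc 0 T) (fun t => V t - W t) = 0 := by
    rw [← zNorm_sq] at hzero
    simpa using hzero
  ext1 ξ
  simp only [picard]
  rw [duhamel_congr P hT0 (ae_eq_of_zNorm_sub_eq_zero hV hW hz0)]

/-! ### Existence -/

theorem eLpNorm_tsum_le {α : Type*} [MeasurableSpace α] {μ : Measure α} [SigmaFinite μ]
    {f : ℕ → α → ℝ≥0∞} (hf : ∀ n, Measurable (f n)) {p : ℝ} (hp : 1 ≤ p) :
    eLpNorm (fun a => ∑' n, f n a) (ENNReal.ofReal p) μ ≤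
      ∑' n, eLpNorm (f n) (ENNReal.ofReal p) μ := by
  have h := eLpNorm_lintegral_le (μ := μ) (ν := (Measure.count : Measure ℕ))
    (f := fun a n => f n a) (measurable_from_prod_countable_left hf) hp
  simpa only [lintegral_count] using h

theorem lintegral_tsum_size {d : ℝˣ} {D : ℕ → ℝ → E → Fin 4 → ℂ}
    (hD : ∀ n, Measurable (Function.uncurry (D n))) (t : ℝ) :
    ∫⁻ ξ, ∑' n, size d (D n t) ξ = ∑' n, ∫⁻ ξ, size d (D n t) ξ :=
  lintegral_tsum fun n => (measurable_size (hD n).of_uncurry_left).aemeasurable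

theorem eLpNorm_tsum_size_le {d : ℝˣ} {I : Set ℝ} {D : ℕ → ℝ → E → Fin 4 → ℂ}
    (hD : ∀ n, Measurable (Function.uncurry (D n))) :
    eLpNorm (fun t => ∫⁻ ξ, ∑' n, size d (D n t) ξ) (ENNReal.ofReal 2) (volume.restrict I) ≤
      ∑' n, zNorm d I (D n) := by
  simp_rw [lintegral_tsum_size hD]
  exact eLpNorm_tsum_le (fun n => measurable_lintegral_size (hD n)) (by norm_num)

theorem ae_prod_of_ae_ae {I : Set ℝ} {p : ℝ × E → Prop} (hp : MeasurableSet {q | p q})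
    (h : ∀ᵐ t ∂volume.restrict I, ∀ᵐ ξ : E, p (t, ξ)) :
    ∀ᵐ q ∂(volume.restrict I).prod (volume : Measure E), p q :=
  (Measure.ae_prod_iff_ae_ae hp).2 h

/-- Completeness of `L²(I; L¹)`, for geometrically convergent sequences. -/
theorem exists_zNorm_limit {d : ℝˣ} {I : Set ℝ} {U : ℕ → ℝ → E → Fin 4 → ℂ}
    (hU : ∀ n, Measurable (Function.uncurry (U n))) {R : ℝ≥0∞} (hR : R ≠ ∞)
    (h : ∀ n, zNorm d I (fun t => U (n + 1) t - U n t) ≤ R * 2⁻¹ ^ n) :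
    ∃ V : ℝ → E → Fin 4 → ℂ, Measurable (Function.uncurry V) ∧
      ∀ n, zNorm d I (fun t => V t - U n t) ≤ 2 * R * 2⁻¹ ^ n := by
  have hD : ∀ n, Measurable (Function.uncurry fun t => U (n + 1) t - U n t) := fun n =>
    (hU (n + 1)).sub (hU n)
  have hgeom : ∀ n, ∑' m, zNorm d I (fun t => U (n + m + 1) t - U (n + m) t) ≤ 2 * R * 2⁻¹ ^ n := by
    intro n
    calc _ ≤ ∑' m, R * 2⁻¹ ^ n * 2⁻¹ ^ m := by
          refine ENNReal.tsum_le_tsum fun m => (h (n + m)).trans (le_of_eq ?_)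
          rw [pow_add]; ring
      _ = 2 * R * 2⁻¹ ^ n := by
          rw [ENNReal.tsum_mul_left, ENNReal.tsum_geometric, ENNReal.one_sub_inv_two, inv_inv]; ring
  -- The increments are summable in norm, so the sum of their sizes is finite at almost every `(t,
  -- ξ)`. This yields pointwise convergence, and the tails of the same series dominate the distance
  -- to the limit.
  have hae : ∀ᵐ q ∂(volume.restrict I).prod (volume : Measure E),
      ∑' n, size d (U (n + 1) q.1 - U n q.1) q.2 < ∞ := by
    have hmn : ∀ n, Measurable fun q : ℝ × E => size d (U (n + 1) q.1 - U n q.1) q.2 := fun n => by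
      have := measurable_uncurry_size (d := d) (hD n)
      exact this
    have hm : Measurable fun q : ℝ × E => ∑' n, size d (U (n + 1) q.1 - U n q.1) q.2 :=
      Measurable.tsum hmn
    refine ae_prod_of_ae_ae (measurableSet_lt hm measurable_const) ?_
    have h1 := (eLpNorm_tsum_size_le (d := d) (I := I) hD).trans_lt
      ((by simpa using hgeom 0 : _ ≤ 2 * R).trans_lt (ENNReal.mul_lt_top (by simp) hR.lt_top))
    have h2 : ∫⁻ t in I, (∫⁻ ξ, ∑' n, size d (U (n + 1) t - U n t) ξ) ^ (2 : ℝ) ≠ ∞ := by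
      rw [eLpNorm_ofReal_eq _ two_pos] at h1
      exact ((ENNReal.rpow_lt_top_iff_of_pos (by norm_num)).1 h1).ne
    have hm2 : Measurable fun t => ∫⁻ ξ, ∑' n, size d (U (n + 1) t - U n t) ξ :=
      hm.lintegral_prod_right'
    filter_upwards [ae_lt_top (hm2.pow_const _) h2] with t ht
    have ht' : ∫⁻ ξ, ∑' n, size d (U (n + 1) t - U n t) ξ ≠ ∞ := by
      intro htop
      rw [htop] at ht
      simp at ht
    have hmt : Measurable fun ξ => ∑' n, size d (U (n + 1) t - U n t) ξ :=
      Measurable.tsum fun n => measurable_size (hD n).of_uncurry_left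
    exact ae_lt_top hmt ht'
  have hedist : ∀ (q : ℝ × E) (n : ℕ), edist (scale d (U n q.1 q.2)) (scale d (U (n + 1) q.1 q.2)) ≤
      size d (U (n + 1) q.1 - U n q.1) q.2 := by
    intro q n
    rw [edist_comm, edist_eq_enorm_sub, ← map_sub]
    exact le_rfl
  obtain ⟨V, hVm, hV⟩ := measurable_limit_of_tendsto_metrizable_ae
    (μ := (volume.restrict I).prod (volume : Measure E))
    (f := fun n => Function.uncurry (U n)) (L := atTop) (fun n => (hU n).aemeasurable) (by
      filter_upwards [hae] with q hq
      obtain ⟨l, hl⟩ := cauchySeq_tendsto_of_complete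
        (cauchySeq_of_edist_le_of_tsum_ne_top _ (hedist q) hq.ne)
      refine ⟨(scale d).symm l, ?_⟩
      have := ((scale d).symm.continuous.tendsto l).comp hl
      refine this.congr fun n => ?_
      simp [Function.uncurry])
  refine ⟨Function.curry V, hVm, fun n => ?_⟩
  have hle : ∀ᵐ t ∂volume.restrict I, ∀ᵐ ξ : E, size d (Function.curry V t - U n t) ξ ≤
      ∑' m, size d (U (n + m + 1) t - U (n + m) t) ξ := by
    have hprod : ∀ᵐ q ∂(volume.restrict I).prod (volume : Measure E),
        size d (Function.curry V q.1 - U n q.1) q.2 ≤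
          ∑' m, size d (U (n + m + 1) q.1 - U (n + m) q.1) q.2 := by
      filter_upwards [hV] with q hq
      have h1 : Tendsto (fun n => scale d (U n q.1 q.2)) atTop (𝓝 (scale d (V q))) :=
        ((scale d).continuous.tendsto _).comp hq
      have h2 := edist_le_tsum_of_edist_le_of_tendsto _ (hedist q) h1 n
      rw [edist_comm, edist_eq_enorm_sub, ← map_sub] at h2
      exact h2
    exact Measure.ae_ae_of_ae_prod hprod
  refine le_trans ?_ ((eLpNorm_tsum_size_le (d := d) (I := I) fun m => hD (n + m)).trans (hgeom n))
  refine eLpNorm_mono_enorm_ae ?_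
  filter_upwards [hle] with t ht
  simpa using lintegral_mono_ae ht

theorem duhamel_zero (P : Parameters) (t : ℝ) : duhamel P (fun _ _ => 0) t = 0 := by
  ext1 ξ
  have : advection (fun _ : E => (0 : Fin 4 → ℂ)) = 0 := by
    ext ξ k; simp [advection]
  simp [duhamel, duhamelIntegrand, this]

theorem zNorm_zero (d : ℝˣ) (I : Set ℝ) : zNorm d I (fun _ _ => 0) = 0 := by
  simp [zNorm, size]

/-- Solution of the mild equation by Picard iteration, for small data. -/
theorem exists_picard_fixedPoint {P : Parameters} {d : ℝˣ} {M : ℝ} {I : Set ℝ}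
    (hB : SemigroupBound P d M I) (hM : 0 ≤ M) (hI : MeasurableSet I) (hI0 : I ⊆ Ici 0)
    (hIc : ∀ t ∈ I, Icc 0 t ⊆ I) {V₀ : E → Fin 4 → ℂ} (hV₀ : Measurable V₀)
    (hfin : zNorm d I (fun t ξ => (semigroup P t ξ).mulVec (V₀ ξ)) ≠ ∞)
    (hsmall : 8 * (lipConst P M * zNorm d I (fun t ξ => (semigroup P t ξ).mulVec (V₀ ξ))) ≤ 1) :
    ∃ V : ℝ → E → Fin 4 → ℂ, Measurable (Function.uncurry V) ∧ zNorm d I V ≠ ∞ ∧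
      ∀ t ∈ I, V t = picard P V₀ V t := by
  set lin : ℝ → E → Fin 4 → ℂ := fun t ξ => (semigroup P t ξ).mulVec (V₀ ξ) with hlin
  have hlinm : Measurable (Function.uncurry lin) :=
    measurable_mulVec (stronglyMeasurable_semigroup P) (hV₀.comp measurable_snd)
  set R := zNorm d I lin
  set Λ := lipConst P M
  -- On the ball of radius `2R` the two norms in the Lipschitz estimate add up to at most `4R`, so
  -- `8ΛR ≤ 1` makes `picard` a contraction of ratio `1/2`.
  have hsm2 : Λ * (4 * R) ≤ 2⁻¹ := by
    have h2 : (2 : ℝ≥0∞) * (Λ * (4 * R)) ≤ 1 := by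
      calc _ = 8 * (Λ * R) := by ring
        _ ≤ 1 := hsmall
    rw [← one_div]
    exact ENNReal.le_div_iff_mul_le (by simp) (by simp) |>.2 (by rwa [mul_comm])
  have hdiff : ∀ {V W : ℝ → E → Fin 4 → ℂ}, Measurable (Function.uncurry V) →
      Measurable (Function.uncurry W) → zNorm d I V ≤ 2 * R → zNorm d I W ≤ 2 * R →
      zNorm d I (fun t => picard P V₀ V t - picard P V₀ W t) ≤
        2⁻¹ * zNorm d I (fun t => V t - W t) := by
    intro V W hV hW hVR hWR
    calc _ = zNorm d I (fun t => duhamel P V t - duhamel P W t) := by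
          simp only [zNorm, size_picard_sub]
      _ ≤ Λ * (zNorm d I (fun t => V t - W t) * (zNorm d I V + zNorm d I W)) :=
          zNorm_duhamel_sub_le_mul hB hM hI hI0 hIc hV hW
      _ ≤ Λ * (zNorm d I (fun t => V t - W t) * (2 * R + 2 * R)) := by gcongr
      _ = (Λ * (4 * R)) * zNorm d I (fun t => V t - W t) := by ring
      _ ≤ _ := by gcongr
  have hzero : picard P V₀ (fun _ _ => 0) = lin := by
    ext1 t; ext1 ξ
    rw [picard, duhamel_zero]; simp [hlin]
  let U : ℕ → ℝ → E → Fin 4 → ℂ := fun n => (picard P V₀)^[n] (fun _ _ => 0)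
  have hUs : ∀ n, U (n + 1) = picard P V₀ (U n) := fun n => Function.iterate_succ_apply' _ _ _
  have hUm : ∀ n, Measurable (Function.uncurry (U n)) := by
    intro n
    induction n with
    | zero => exact measurable_const
    | succ n ih => rw [hUs]; exact measurable_picard P hV₀ ih
  have hUR : ∀ n, zNorm d I (U n) ≤ 2 * R := by
    intro n
    induction n with
    | zero => exact (zNorm_zero d I).le.trans zero_le
    | succ n ih =>
      rw [hUs]
      have h1 := hdiff (hUm n) (measurable_const (a := (0 : Fin 4 → ℂ))) ih
        ((zNorm_zero d I).le.trans zero_le)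
      rw [hzero] at h1
      have h2 : zNorm d I (fun t => U n t - fun _ => 0) = zNorm d I (U n) := by
        simp [zNorm, size]
      rw [h2] at h1
      calc zNorm d I (picard P V₀ (U n))
          ≤ zNorm d I (fun t => picard P V₀ (U n) t - lin t) + zNorm d I lin :=
            zNorm_le_add ((measurable_picard P hV₀ (hUm n)).sub hlinm) hlinm
              (fun t _ ξ => size_le_add d _ _ ξ) hI
        _ ≤ 2⁻¹ * (2 * R) + R := by
            gcongr
            exact h1.trans (by gcongr)
        _ = 2 * R := by
            rw [← mul_assoc, ENNReal.inv_mul_cancel (by simp) (by simp), two_mul, one_mul]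
  have hUd : ∀ n, zNorm d I (fun t => U (n + 1) t - U n t) ≤ R * 2⁻¹ ^ n := by
    intro n
    induction n with
    | zero =>
      rw [hUs]
      have : U 0 = fun _ _ => 0 := rfl
      rw [this, hzero]
      simp [zNorm, size, R]
    | succ n ih =>
      rw [hUs (n + 1), hUs n]
      refine (hdiff (hUs n ▸ hUm (n + 1)) (hUm n) (hUs n ▸ hUR (n + 1)) (hUR n)).trans ?_
      rw [← hUs n, pow_succ]
      calc _ ≤ 2⁻¹ * (R * 2⁻¹ ^ n) := by gcongr
        _ = _ := by ring
  obtain ⟨V, hVm, hVlim⟩ := exists_zNorm_limit hUm hfin hUd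
  have hVR : zNorm d I V ≤ 2 * R := by
    have h0 := hVlim 0
    have h2 : zNorm d I (fun t => V t - U 0 t) = zNorm d I V := by
      have : U 0 = fun _ _ => 0 := rfl
      rw [this]
      simp [zNorm, size]
    rw [h2] at h0
    simpa using h0
  have hVpm := measurable_picard P hV₀ hVm
  have hlim : ∀ n, zNorm d I (fun t => V t - picard P V₀ V t) ≤ 2 * R * 2⁻¹ ^ n := by
    intro n
    have h1 : zNorm d I (fun t => V t - picard P V₀ V t) ≤
        zNorm d I (fun t => V t - U (n + 1) t) +
          zNorm d I (fun t => U (n + 1) t - picard P V₀ V t) :=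
      zNorm_le_add (hVm.sub (hUm (n + 1))) ((hUm (n + 1)).sub hVpm) (fun t _ ξ => size_sub_le d _ _ _ ξ) hI
    have h2 := hdiff (hUm n) hVm (hUR n) hVR
    have h3 : zNorm d I (fun t => U n t - V t) = zNorm d I (fun t => V t - U n t) := by
      simp only [zNorm, size_sub_comm d (V _)]
    rw [h3, ← hUs n] at h2
    calc _ ≤ _ := h1
      _ ≤ 2 * R * 2⁻¹ ^ (n + 1) + 2⁻¹ * (2 * R * 2⁻¹ ^ n) := by
          gcongr
          · exact hVlim (n + 1)
          · exact h2.trans (by gcongr; exact hVlim n)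
      _ = 2 * R * 2⁻¹ ^ n * (2⁻¹ + 2⁻¹) := by rw [pow_succ]; ring
      _ = _ := by rw [ENNReal.inv_two_add_inv_two, mul_one]
  have hz : zNorm d I (fun t => V t - picard P V₀ V t) = 0 := by
    have ht : Tendsto (fun n : ℕ => 2 * R * (2⁻¹ : ℝ≥0∞) ^ n) atTop (𝓝 (2 * R * 0)) :=
      ENNReal.Tendsto.const_mul (ENNReal.tendsto_pow_atTop_nhds_zero_of_lt_one (by norm_num))
        (Or.inr (ENNReal.mul_ne_top (by simp) hfin))
    rw [mul_zero] at ht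
    exact le_antisymm (ge_of_tendsto' ht hlim) zero_le
  have hae := ae_eq_of_zNorm_sub_eq_zero hVm hVpm hz
  -- The limit `V` satisfies the equation only almost everywhere. Its Picard image agrees with it
  -- almost everywhere, hence has the same Picard image and satisfies the equation at every time in
  -- `I` and every frequency.
  refine ⟨picard P V₀ V, hVpm, ?_, fun t ht => ?_⟩
  · have : zNorm d I (picard P V₀ V) = zNorm d I V := by
      refine eLpNorm_congr_ae ?_
      filter_upwards [hae] with t ht
      refine lintegral_congr_ae ?_
      filter_upwards [ht] with ξ hξ
      simp only [size, hξ]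
    rw [this]
    exact ne_top_of_le_ne_top (ENNReal.mul_ne_top (by simp) hfin) hVR
  · ext1 ξ
    change _ - _ = _ - _
    rw [duhamel_congr P (hI0 ht) (ae_restrict_of_ae_restrict_of_subset (hIc t ht) hae)]

/-! ### Fourier-Besov norms of functions of the frequency -/

/-- The Fourier-Besov norm of a nonnegative function of the frequency. -/
def freqNorm (L : LittlewoodPaley) (s : ℝ) (r : ℝ≥0∞) (a : E → ℝ≥0∞) : ℝ≥0∞ :=
  eLpNorm (fun j : ℤ => (2 : ℝ≥0∞) ^ ((j : ℝ) * s) * ∫⁻ ξ, ‖L.symbol j ξ‖ₑ * a ξ) r Measure.count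

section FreqNorm

variable {L : LittlewoodPaley} {s : ℝ} {r : ℝ≥0∞}

theorem HasFourier.besovNorm_eq_freqNorm {u : HomDist} {f : E → ℂ} (hf : HasFourier u f)
    (L : LittlewoodPaley) (s : ℝ) (r : ℝ≥0∞) :
    besovNorm L s 1 r u = freqNorm L s r fun ξ => ‖f ξ‖ₑ := hf.besovNorm_eq L s r

theorem measurable_symbol_mul (L : LittlewoodPaley) (j : ℤ) {a : E → ℝ≥0∞} (ha : Measurable a) :
    Measurable fun ξ => ‖L.symbol j ξ‖ₑ * a ξ := (L.measurable_enorm_symbol j).mul ha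

theorem freqNorm_mono_ae {a b : E → ℝ≥0∞} (h : ∀ᵐ ξ : E, a ξ ≤ b ξ) :
    freqNorm L s r a ≤ freqNorm L s r b := by
  refine eLpNorm_count_mono r fun j => ?_
  gcongr _ * ?_
  refine lintegral_mono_ae ?_
  filter_upwards [h] with ξ hξ
  gcongr

theorem freqNorm_mono {a b : E → ℝ≥0∞} (h : ∀ ξ : E, a ξ ≤ b ξ) :
    freqNorm L s r a ≤ freqNorm L s r b := freqNorm_mono_ae (Eventually.of_forall h)

theorem freqNorm_const_mul (hr0 : r ≠ 0) (hr : r ≠ ∞) {c : ℝ≥0∞} (hc : c ≠ ∞) (a : E → ℝ≥0∞) :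
    freqNorm L s r (fun ξ => c * a ξ) = c * freqNorm L s r a := by
  rw [freqNorm, freqNorm, ← eLpNorm_count_const_mul c _ hr0 hr]
  congr 1; ext j
  rw [mul_left_comm, ← lintegral_const_mul' _ _ hc]
  simp_rw [mul_left_comm c]

theorem freqNorm_add_le (hr : 1 ≤ r) {a b : E → ℝ≥0∞} (ha : Measurable a) :
    freqNorm L s r (fun ξ => a ξ + b ξ) ≤ freqNorm L s r a + freqNorm L s r b := by
  refine le_trans (le_of_eq ?_) (eLpNorm_add_le measurable_from_top.aestronglyMeasurable
    measurable_from_top.aestronglyMeasurable hr)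
  rw [freqNorm]
  congr 1; ext j
  simp only [Pi.add_apply]
  rw [← mul_add, ← lintegral_add_left (measurable_symbol_mul L j ha)]
  simp_rw [mul_add]

theorem freqNorm_sum_le (hr : 1 ≤ r) {ι : Type*} (S : Finset ι) {a : ι → E → ℝ≥0∞}
    (ha : ∀ i, Measurable (a i)) :
    freqNorm L s r (fun ξ => ∑ i ∈ S, a i ξ) ≤ ∑ i ∈ S, freqNorm L s r (a i) := by
  refine le_trans (le_of_eq ?_) (eLpNorm_count_sum_le S _ hr)
  rw [freqNorm]
  congr 1; ext j
  rw [← Finset.mul_sum, ← lintegral_finsetSum _ fun i _ => measurable_symbol_mul L j (ha i)]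
  simp_rw [Finset.mul_sum]

/-- The weighted `L¹` space embeds into the Fourier-Besov space. -/
theorem exists_freqNorm_le_lintegral (L : LittlewoodPaley) (s : ℝ) : ∃ C : ℝ≥0∞, C ≠ ∞ ∧
    ∀ {r : ℝ≥0∞}, 1 ≤ r → r ≠ ∞ → ∀ a : E → ℝ≥0∞, Measurable a →
      freqNorm L s r a ≤ C * ∫⁻ ξ, ‖ξ‖ₑ ^ s * a ξ := by
  obtain ⟨C, hC, h⟩ := L.exists_tsum_enorm_symbol_le
  refine ⟨4 ^ |s| * C, ENNReal.mul_ne_top (ENNReal.rpow_ne_top_of_nonneg (abs_nonneg s) (by simp)) hC,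
    fun {r} hr hr' a ha => ?_⟩
  refine (eLpNorm_count_le_of_exponent_le _ one_ne_zero hr hr').trans ?_
  rw [eLpNorm_count_one]
  have h4 : (4 : ℝ≥0∞) ^ |s| ≠ ∞ := ENNReal.rpow_ne_top_of_nonneg (abs_nonneg s) (by simp)
  calc _ ≤ ∑' j : ℤ, ∫⁻ ξ, 4 ^ |s| * ‖ξ‖ₑ ^ s * ‖L.symbol j ξ‖ₑ * a ξ := by
        refine ENNReal.tsum_le_tsum fun j => ?_
        rw [← lintegral_const_mul' _ _ (ENNReal.rpow_ne_top_of_ne_zero (by simp) (by simp))]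
        refine lintegral_mono fun ξ => ?_
        rw [← mul_assoc]
        gcongr ?_ * _
        exact L.two_rpow_mul_enorm_symbol_le j s ξ
    _ = ∫⁻ ξ, ∑' j : ℤ, 4 ^ |s| * ‖ξ‖ₑ ^ s * ‖L.symbol j ξ‖ₑ * a ξ := by
        rw [lintegral_tsum]
        intro j
        exact (((measurable_enorm.pow_const s).const_mul _).mul
          (L.measurable_enorm_symbol j) |>.mul ha).aemeasurable
    _ ≤ ∫⁻ ξ, 4 ^ |s| * C * (‖ξ‖ₑ ^ s * a ξ) := by
        refine lintegral_mono fun ξ => ?_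
        simp_rw [mul_assoc _ _ (a ξ), ← mul_assoc]
        rw [ENNReal.tsum_mul_right, ENNReal.tsum_mul_left]
        calc _ ≤ 4 ^ |s| * ‖ξ‖ₑ ^ s * C * a ξ := by gcongr; exact h ξ
          _ = _ := by ring
    _ = _ := lintegral_const_mul' _ _ (ENNReal.mul_ne_top h4 hC)

theorem lintegral_symbol_ne_top (hr0 : r ≠ 0) {a : E → ℝ≥0∞} (h : freqNorm L s r a ≠ ∞) (j : ℤ) :
    ∫⁻ ξ, ‖L.symbol j ξ‖ₑ * a ξ ≠ ∞ := by
  intro htop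
  have h1 := le_eLpNorm_count (fun j : ℤ => (2 : ℝ≥0∞) ^ ((j : ℝ) * s) *
    ∫⁻ ξ, ‖L.symbol j ξ‖ₑ * a ξ) hr0 j
  rw [htop, ENNReal.mul_top (by simp)] at h1
  exact h (top_le_iff.1 h1)

theorem two_rpow_mul_lintegral_symbol_le (j : ℤ) (s σ : ℝ) (a : E → ℝ≥0∞) :
    (2 : ℝ≥0∞) ^ ((j : ℝ) * s) * ∫⁻ ξ, ‖L.symbol j ξ‖ₑ * (‖ξ‖ₑ ^ σ * a ξ) ≤
      4 ^ |σ| * ((2 : ℝ≥0∞) ^ ((j : ℝ) * (s + σ)) * ∫⁻ ξ, ‖L.symbol j ξ‖ₑ * a ξ) := by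
  have h4 : (4 : ℝ≥0∞) ^ |σ| * (2 : ℝ≥0∞) ^ ((j : ℝ) * σ) ≠ ∞ :=
    ENNReal.mul_ne_top (ENNReal.rpow_ne_top_of_nonneg (abs_nonneg σ) (by simp))
      (ENNReal.rpow_ne_top_of_ne_zero (by simp) (by simp))
  calc _ ≤ (2 : ℝ≥0∞) ^ ((j : ℝ) * s) * ∫⁻ ξ, 4 ^ |σ| * (2 : ℝ≥0∞) ^ ((j : ℝ) * σ) *
        (‖L.symbol j ξ‖ₑ * a ξ) := by
        gcongr _ * ?_
        refine lintegral_mono fun ξ => ?_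
        calc _ = ‖ξ‖ₑ ^ σ * ‖L.symbol j ξ‖ₑ * a ξ := by ring
          _ ≤ 4 ^ |σ| * (2 : ℝ≥0∞) ^ ((j : ℝ) * σ) * ‖L.symbol j ξ‖ₑ * a ξ := by
            gcongr ?_ * _
            exact L.enorm_rpow_mul_enorm_symbol_le j σ ξ
          _ = _ := by ring
    _ = _ := by
        rw [lintegral_const_mul' _ _ h4, mul_add, ENNReal.rpow_add _ _ (by simp) (by simp)]
        ring

theorem freqNorm_rpow_mul_le (hr0 : r ≠ 0) (hr : r ≠ ∞) (s σ : ℝ) (a : E → ℝ≥0∞) :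
    freqNorm L s r (fun ξ => ‖ξ‖ₑ ^ σ * a ξ) ≤ 4 ^ |σ| * freqNorm L (s + σ) r a := by
  rw [freqNorm, freqNorm, ← eLpNorm_count_const_mul _ _ hr0 hr]
  exact eLpNorm_count_mono r fun j => two_rpow_mul_lintegral_symbol_le j s σ a

theorem lintegral_le_tsum_symbol (L : LittlewoodPaley) {a : E → ℝ≥0∞} (ha : Measurable a) :
    ∫⁻ ξ, a ξ ≤ ∑' j : ℤ, ∫⁻ ξ, ‖L.symbol j ξ‖ₑ * a ξ := by
  rw [← lintegral_tsum fun j => (measurable_symbol_mul L j ha).aemeasurable]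
  refine lintegral_mono_ae ?_
  filter_upwards [ae_ne_zero] with ξ hξ
  rw [ENNReal.tsum_mul_right]
  calc a ξ = 1 * a ξ := (one_mul _).symm
    _ ≤ _ := by gcongr; exact L.one_le_tsum_enorm_symbol hξ

theorem lintegral_symbol_mul_le {k a : E → ℝ≥0∞} {A : ℝ≥0∞} (hA : A ≠ ∞) {σ : ℝ}
    (hk : ∀ ξ, ξ ≠ 0 → k ξ ≤ A * ‖ξ‖ₑ ^ σ) (hr0 : r ≠ 0) (j : ℤ) :
    ∫⁻ ξ, ‖L.symbol j ξ‖ₑ * (k ξ * a ξ) ≤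
      A * 4 ^ |σ| * ((2 : ℝ≥0∞) ^ ((j : ℝ) * (σ - s)) * freqNorm L s r a) := by
  have h0 := two_rpow_mul_lintegral_symbol_le (L := L) j 0 σ a
  rw [mul_zero, ENNReal.rpow_zero, one_mul, zero_add] at h0
  have h1 := le_eLpNorm_count (fun j : ℤ => (2 : ℝ≥0∞) ^ ((j : ℝ) * s) *
    ∫⁻ ξ, ‖L.symbol j ξ‖ₑ * a ξ) hr0 j
  calc _ ≤ ∫⁻ ξ, A * (‖L.symbol j ξ‖ₑ * (‖ξ‖ₑ ^ σ * a ξ)) := by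
        refine lintegral_mono_ae ?_
        filter_upwards [ae_ne_zero] with ξ hξ
        calc _ ≤ ‖L.symbol j ξ‖ₑ * ((A * ‖ξ‖ₑ ^ σ) * a ξ) := by gcongr; exact hk ξ hξ
          _ = _ := by ring
    _ = A * ∫⁻ ξ, ‖L.symbol j ξ‖ₑ * (‖ξ‖ₑ ^ σ * a ξ) := lintegral_const_mul' _ _ hA
    _ ≤ A * (4 ^ |σ| * ((2 : ℝ≥0∞) ^ ((j : ℝ) * (σ - s)) * ((2 : ℝ≥0∞) ^ ((j : ℝ) * s) *
          ∫⁻ ξ, ‖L.symbol j ξ‖ₑ * a ξ))) := by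
        gcongr
        refine h0.trans (le_of_eq ?_)
        rw [← mul_assoc (2 ^ _), ← ENNReal.rpow_add _ _ (by simp) (by simp)]
        ring_nf
    _ ≤ _ := by
        rw [mul_assoc]
        gcongr
        exact h1

/-- Integrability against weights which are small at low and at high frequencies. -/
theorem lintegral_mul_ne_top_of_freqNorm {k a : E → ℝ≥0∞} (hk : Measurable k) (ha : Measurable a)
    {A : ℝ≥0∞} (hA : A ≠ ∞) {σ₁ σ₂ : ℝ} (h₁ : σ₁ < s) (h₂ : s < σ₂)
    (hk₁ : ∀ ξ, ξ ≠ 0 → k ξ ≤ A * ‖ξ‖ₑ ^ σ₁) (hk₂ : ∀ ξ, ξ ≠ 0 → k ξ ≤ A * ‖ξ‖ₑ ^ σ₂)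
    (hr0 : r ≠ 0) (h : freqNorm L s r a ≠ ∞) : ∫⁻ ξ, k ξ * a ξ ≠ ∞ := by
  -- The bound with `σ₁ < s` serves the blocks `j ≥ 0` and the one with `σ₂ > s` the blocks `j ≤ 0`;
  -- both yield the summable factor `2^(-ε|j|)`.
  set ε := min (s - σ₁) (σ₂ - s) with hε
  have hε0 : 0 < ε := lt_min (by linarith) (by linarith)
  have h4 : ∀ σ : ℝ, (4 : ℝ≥0∞) ^ |σ| ≠ ∞ := fun σ =>
    ENNReal.rpow_ne_top_of_nonneg (abs_nonneg σ) (by simp)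
  refine ne_top_of_le_ne_top (b := A * (4 ^ |σ₁| + 4 ^ |σ₂|) * (geomConst ε * freqNorm L s r a)) ?_ ?_
  · exact ENNReal.mul_ne_top (ENNReal.mul_ne_top hA (ENNReal.add_ne_top.2 ⟨h4 _, h4 _⟩))
      (ENNReal.mul_ne_top (geomConst_ne_top hε0) h)
  refine (lintegral_le_tsum_symbol L (hk.mul ha)).trans ?_
  rw [geomConst, ← ENNReal.tsum_mul_right, ← ENNReal.tsum_mul_left]
  refine ENNReal.tsum_le_tsum fun j => ?_
  rcases le_total 0 j with hj | hj
  · have hj' : (0 : ℝ) ≤ j := by exact_mod_cast hj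
    refine (lintegral_symbol_mul_le (s := s) hA hk₁ hr0 j).trans ?_
    gcongr
    · exact le_self_add
    · norm_num
    · rw [abs_of_nonneg hj']
      have : ε ≤ s - σ₁ := min_le_left _ _
      nlinarith
  · have hj' : (j : ℝ) ≤ 0 := by exact_mod_cast hj
    refine (lintegral_symbol_mul_le (s := s) hA hk₂ hr0 j).trans ?_
    gcongr
    · exact le_add_self
    · norm_num
    · rw [abs_of_nonpos hj']
      have : ε ≤ σ₂ - s := min_le_right _ _
      nlinarith

/-- Dominated convergence twice: in `ξ` inside each block, then in `j` for the ℓ^r sum, where `r <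
∞` is essential. -/
theorem tendsto_freqNorm_zero {ι : Type*} {l : Filter ι} [l.IsCountablyGenerated]
    (hr : 1 ≤ r) (hr' : r ≠ ∞) {a : ι → E → ℝ≥0∞} {b : E → ℝ≥0∞} (ha : ∀ i, Measurable (a i))
    (hab : ∀ᶠ i in l, ∀ᵐ ξ : E, a i ξ ≤ b ξ) (hb : freqNorm L s r b ≠ ∞)
    (hlim : ∀ᵐ ξ : E, Tendsto (fun i => a i ξ) l (𝓝 0)) :
    Tendsto (fun i => freqNorm L s r (a i)) l (𝓝 0) := by
  have hr0 : r ≠ 0 := (zero_lt_one.trans_le hr).ne'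
  have hrr : 0 < r.toReal := ENNReal.toReal_pos hr0 hr'
  have h2 : ∀ j : ℤ, (2 : ℝ≥0∞) ^ ((j : ℝ) * s) ≠ ∞ := fun j =>
    ENNReal.rpow_ne_top_of_ne_zero (by simp) (by simp)
  have hinner : ∀ j : ℤ, Tendsto (fun i => ∫⁻ ξ, ‖L.symbol j ξ‖ₑ * a i ξ) l (𝓝 0) := by
    intro j
    have h := tendsto_lintegral_filter_of_dominated_convergence (l := l) (μ := (volume : Measure E))
      (F := fun i ξ => ‖L.symbol j ξ‖ₑ * a i ξ) (f := fun _ => 0) (fun ξ => ‖L.symbol j ξ‖ₑ * b ξ)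
      (Eventually.of_forall fun i => (L.measurable_enorm_symbol j).mul (ha i)) (by
        filter_upwards [hab] with i hi
        filter_upwards [hi] with ξ hξ
        gcongr) (lintegral_symbol_ne_top hr0 hb j) (by
        filter_upwards [hlim] with ξ hξ
        simpa using ENNReal.Tendsto.const_mul hξ (Or.inr enorm_ne_top))
    simpa using h
  have houter := tendsto_lintegral_filter_of_dominated_convergence (l := l)
    (μ := (Measure.count : Measure ℤ))
    (F := fun i (j : ℤ) => ((2 : ℝ≥0∞) ^ ((j : ℝ) * s) * ∫⁻ ξ, ‖L.symbol j ξ‖ₑ * a i ξ) ^ r.toReal)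
    (f := fun _ => 0)
    (fun j => ((2 : ℝ≥0∞) ^ ((j : ℝ) * s) * ∫⁻ ξ, ‖L.symbol j ξ‖ₑ * b ξ) ^ r.toReal)
    (Eventually.of_forall fun i => measurable_from_top) (by
      filter_upwards [hab] with i hi
      refine Eventually.of_forall fun j => ?_
      gcongr (_ * ?_) ^ _
      refine lintegral_mono_ae ?_
      filter_upwards [hi] with ξ hξ
      gcongr) (by
      rw [lintegral_count, ← eLpNorm_count_rpow _ hr0 hr']
      exact ENNReal.rpow_ne_top_of_nonneg hrr.le hb) (by
      refine Eventually.of_forall fun j => ?_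
      have := (ENNReal.continuous_rpow_const (y := r.toReal)).tendsto 0 |>.comp
        (f := fun i => (2 : ℝ≥0∞) ^ ((j : ℝ) * s) * ∫⁻ ξ, ‖L.symbol j ξ‖ₑ * a i ξ) (x := l) (by
          simpa using ENNReal.Tendsto.const_mul (hinner j) (Or.inr (h2 j)))
      rw [ENNReal.zero_rpow_of_pos hrr] at this
      exact this)
  simp only [lintegral_count, lintegral_zero] at houter
  have := (ENNReal.continuous_rpow_const (y := 1 / r.toReal)).tendsto 0 |>.comp houter
  rw [ENNReal.zero_rpow_of_pos (by positivity)] at this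
  refine this.congr fun i => ?_
  simp only [freqNorm, Function.comp_def]
  rw [eLpNorm_count_eq _ hr0 hr']

end FreqNorm

/-! ### Chemin-Lerner norms of functions of time and frequency -/

/-- The Chemin-Lerner norm of a nonnegative function of time and frequency. -/
def freqTimeNorm (L : LittlewoodPaley) (p s : ℝ) (r : ℝ≥0∞) (I : Set ℝ) (a : ℝ → E → ℝ≥0∞) : ℝ≥0∞ :=
  eLpNorm (fun j : ℤ => (2 : ℝ≥0∞) ^ ((j : ℝ) * s) *
    eLpNorm (fun t => ∫⁻ ξ, ‖L.symbol j ξ‖ₑ * a t ξ) (ENNReal.ofReal p) (volume.restrict I))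
      r Measure.count

section FreqTimeNorm

variable {L : LittlewoodPaley} {p s : ℝ} {r : ℝ≥0∞} {I : Set ℝ}

theorem cheminLernerNorm_eq_freqTimeNorm (hI : MeasurableSet I) {u : ℝ → HomDist} {f : ℝ → E → ℂ}
    (h : ∀ t ∈ I, HasFourier (u t) (f t)) :
    cheminLernerNorm L (ENNReal.ofReal p) s 1 r I u =
      freqTimeNorm L p s r I fun t ξ => ‖f t ξ‖ₑ := by
  rw [cheminLernerNorm, freqTimeNorm]
  congr 1; ext j
  congr 1
  refine eLpNorm_congr_ae ?_
  filter_upwards [ae_restrict_mem hI] with t ht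
  exact (h t ht).distLpNorm_block L j

theorem measurable_lintegral_symbol_mul (L : LittlewoodPaley) (j : ℤ) {a : ℝ → E → ℝ≥0∞}
    (ha : Measurable (Function.uncurry a)) :
    Measurable fun t => ∫⁻ ξ, ‖L.symbol j ξ‖ₑ * a t ξ := by
  have h1 : Measurable fun q : ℝ × E => ‖L.symbol j q.2‖ₑ * a q.1 q.2 :=
    ((L.measurable_enorm_symbol j).comp measurable_snd).mul ha
  exact h1.lintegral_prod_right'

theorem freqTimeNorm_mono {a b : ℝ → E → ℝ≥0∞}
    (h : ∀ᵐ t ∂volume.restrict I, ∀ᵐ ξ : E, a t ξ ≤ b t ξ) :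
    freqTimeNorm L p s r I a ≤ freqTimeNorm L p s r I b := by
  refine eLpNorm_count_mono r fun j => ?_
  gcongr _ * ?_
  refine eLpNorm_mono_enorm_ae ?_
  filter_upwards [h] with t ht
  simp only [enorm_eq_self]
  refine lintegral_mono_ae ?_
  filter_upwards [ht] with ξ hξ
  gcongr

theorem freqTimeNorm_const_mul (hp : 0 < p) (hr0 : r ≠ 0) (hr : r ≠ ∞) {c : ℝ≥0∞} (hc : c ≠ ∞)
    (a : ℝ → E → ℝ≥0∞) :
    freqTimeNorm L p s r I (fun t ξ => c * a t ξ) = c * freqTimeNorm L p s r I a := by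
  rw [freqTimeNorm, freqTimeNorm, ← eLpNorm_count_const_mul c _ hr0 hr]
  congr 1; ext j
  rw [mul_left_comm]
  congr 1
  have h1 : ∀ t, ∫⁻ ξ, ‖L.symbol j ξ‖ₑ * (c * a t ξ) = c * ∫⁻ ξ, ‖L.symbol j ξ‖ₑ * a t ξ := by
    intro t
    rw [← lintegral_const_mul' _ _ hc]
    simp_rw [mul_left_comm c]
  simp_rw [h1]
  rw [eLpNorm_ofReal_eq _ hp, eLpNorm_ofReal_eq _ hp]
  simp_rw [ENNReal.mul_rpow_of_nonneg _ _ hp.le]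
  rw [lintegral_const_mul' _ _ (ENNReal.rpow_ne_top_of_nonneg hp.le hc),
    ENNReal.mul_rpow_of_nonneg _ _ (by positivity), ← ENNReal.rpow_mul, mul_one_div_cancel hp.ne',
    ENNReal.rpow_one]

theorem freqTimeNorm_add_le (hp : 1 ≤ p) (hr : 1 ≤ r) {a b : ℝ → E → ℝ≥0∞}
    (ha : Measurable (Function.uncurry a)) (hb : Measurable (Function.uncurry b)) :
    freqTimeNorm L p s r I (fun t ξ => a t ξ + b t ξ) ≤
      freqTimeNorm L p s r I a + freqTimeNorm L p s r I b := by
  refine le_trans (eLpNorm_count_mono r fun j => ?_) (eLpNorm_add_le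
    measurable_from_top.aestronglyMeasurable measurable_from_top.aestronglyMeasurable hr)
  simp only [Pi.add_apply]
  rw [← mul_add]
  gcongr _ * ?_
  refine le_trans (le_of_eq ?_) (eLpNorm_add_le
    (measurable_lintegral_symbol_mul L j ha).aestronglyMeasurable
    (measurable_lintegral_symbol_mul L j hb).aestronglyMeasurable (by simpa using hp))
  congr 1; ext t
  simp only [Pi.add_apply]
  rw [← lintegral_add_left (measurable_symbol_mul L j ha.of_uncurry_left)]
  simp_rw [mul_add]

theorem freqTimeNorm_zero : freqTimeNorm L p s r I (fun _ _ => 0) = 0 := by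
  simp [freqTimeNorm]

theorem freqTimeNorm_sum_le (hp : 1 ≤ p) (hr : 1 ≤ r) {ι : Type*} (S : Finset ι)
    {a : ι → ℝ → E → ℝ≥0∞} (ha : ∀ i, Measurable (Function.uncurry (a i))) :
    freqTimeNorm L p s r I (fun t ξ => ∑ i ∈ S, a i t ξ) ≤ ∑ i ∈ S, freqTimeNorm L p s r I (a i) := by
  classical
  induction S using Finset.induction_on with
  | empty => simp [freqTimeNorm_zero]
  | insert i S hi ih =>
    simp_rw [Finset.sum_insert hi]
    have hS : Measurable (Function.uncurry fun t ξ => ∑ i ∈ S, a i t ξ) := by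
      have : Measurable fun q : ℝ × E => ∑ i ∈ S, a i q.1 q.2 :=
        Finset.measurable_sum _ fun i _ => ha i
      exact this
    refine (freqTimeNorm_add_le hp hr (ha i) hS).trans ?_
    gcongr

theorem freqTimeNorm_le_of_exponent_le {r' : ℝ≥0∞} (hr0 : r ≠ 0) (hrr : r ≤ r') (hr' : r' ≠ ∞)
    (a : ℝ → E → ℝ≥0∞) : freqTimeNorm L p s r' I a ≤ freqTimeNorm L p s r I a :=
  eLpNorm_count_le_of_exponent_le _ hr0 hrr hr'

/-- The time exponent `2/(1+s)` gains exactly the `1 + s` derivatives between regularity `-1` and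
regularity `s`; the condition `s ≤ 1` keeps the exponent at least 1. The cases `s = ±α` are the two
spaces of the solution class. -/
theorem freqTimeNorm_heatKer_le (P : Parameters) (hs : -1 < s) (hs1 : s ≤ 1) (hr0 : r ≠ 0) (hr : r ≠ ∞)
    (hI : MeasurableSet I) (hI0 : I ⊆ Ici 0) {a : E → ℝ≥0∞} (ha : Measurable a) :
    freqTimeNorm L (2 / (1 + s)) s r I (fun t ξ => heatKer P t ξ * a ξ) ≤
      heatConst P (2 / (1 + s)) * 4 ^ |(-(1 + s))| * freqNorm L (-1) r a := by
  have hs' : 0 < 1 + s := by linarith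
  have hp : 1 ≤ 2 / (1 + s) := by rw [le_div_iff₀ hs']; linarith
  rw [freqNorm, ← eLpNorm_count_const_mul _ _ hr0 hr]
  refine eLpNorm_count_mono r fun j => ?_
  have h1 := eLpNorm_lintegral_heatKer_le P hp hI hI0 (L.measurable_enorm_symbol j) ha
  have h2 := two_rpow_mul_lintegral_symbol_le (L := L) j s (-(1 + s)) a
  have e1 : (2 / (2 / (1 + s))) = 1 + s := by field_simp
  rw [e1] at h1
  rw [show s + -(1 + s) = -1 by ring] at h2
  calc _ ≤ (2 : ℝ≥0∞) ^ ((j : ℝ) * s) * (heatConst P (2 / (1 + s)) *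
        ∫⁻ ξ, ‖L.symbol j ξ‖ₑ * (‖ξ‖ₑ ^ (-(1 + s)) * a ξ)) := by gcongr
    _ = heatConst P (2 / (1 + s)) * ((2 : ℝ≥0∞) ^ ((j : ℝ) * s) *
        ∫⁻ ξ, ‖L.symbol j ξ‖ₑ * (‖ξ‖ₑ ^ (-(1 + s)) * a ξ)) := by ring
    _ ≤ _ := by rw [mul_assoc]; gcongr

/-- For the exponent `2/(1+s)` the smoothing estimate leaves the weight `|ξ|^(-s)`, which cancels
regularity `s`. What remains is the norm of regularity 0 of the time-integrated forcing, controlled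
by its L¹ norm. The estimate is carried out in ℓ¹, which is stronger than ℓ^r. -/
theorem freqTimeNorm_duhamel_ne_top (P : Parameters) (hs : -1 < s) (hs1 : s ≤ 1) (hr : 1 ≤ r)
    (hr' : r ≠ ∞) (hI : MeasurableSet I) (hIc : ∀ t ∈ I, Icc 0 t ⊆ I) {h : ℝ → E → ℝ≥0∞}
    (hh : Measurable (Function.uncurry h)) (hfin : ∫⁻ τ in I, ∫⁻ ξ, h τ ξ ≠ ∞) :
    freqTimeNorm L (2 / (1 + s)) s r I
      (fun t ξ => ∫⁻ τ in Ioc 0 t, heatKer P (t - τ) ξ * (‖ξ‖ₑ * h τ ξ)) ≠ ∞ := by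
  have hs' : 0 < 1 + s := by linarith
  have hp : 1 ≤ 2 / (1 + s) := by rw [le_div_iff₀ hs']; linarith
  have hp0 : 0 < 2 / (1 + s) := by positivity
  have e1 : 1 - (2 / (2 / (1 + s))) = -s := by field_simp; ring
  obtain ⟨C, hC, hCb⟩ := exists_freqNorm_le_lintegral L 0
  have hg : Measurable fun ξ : E => ∫⁻ τ in I, h τ ξ := by
    have h1 : Measurable fun q : E × ℝ => h q.2 q.1 := hh.comp measurable_swap
    exact h1.lintegral_prod_right'
  refine ne_top_of_le_ne_top (b := heatConst P (2 / (1 + s)) * (4 ^ |(-s)| * (C * ∫⁻ τ in I, ∫⁻ ξ, h τ ξ)))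
    (ENNReal.mul_ne_top (heatConst_ne_top P hp0) (ENNReal.mul_ne_top
      (ENNReal.rpow_ne_top_of_nonneg (abs_nonneg _) (by simp)) (ENNReal.mul_ne_top hC hfin))) ?_
  have hswap : ∀ φ : E → ℝ≥0∞, Measurable φ → ∫⁻ τ in I, ∫⁻ ξ, φ ξ * h τ ξ =
      ∫⁻ ξ, φ ξ * ∫⁻ τ in I, h τ ξ := by
    intro φ hφ
    rw [lintegral_lintegral_swap]
    · refine lintegral_congr fun ξ => ?_
      rw [lintegral_const_mul _ hh.of_uncurry_right]
    · exact ((hφ.comp measurable_snd).mul hh).aemeasurable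
  have hbound : freqTimeNorm L (2 / (1 + s)) s 1 I
      (fun t ξ => ∫⁻ τ in Ioc 0 t, heatKer P (t - τ) ξ * (‖ξ‖ₑ * h τ ξ)) ≤
        heatConst P (2 / (1 + s)) * freqNorm L s 1 (fun ξ => ‖ξ‖ₑ ^ (-s) * ∫⁻ τ in I, h τ ξ) := by
    rw [freqNorm, ← eLpNorm_count_const_mul _ _ one_ne_zero (by simp)]
    refine eLpNorm_count_mono 1 fun j => ?_
    have h1 := eLpNorm_lintegral_duhamel_le P hp hI hIc (L.measurable_enorm_symbol j) hh
    rw [e1] at h1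
    have h2 := hswap (fun ξ => ‖L.symbol j ξ‖ₑ * ‖ξ‖ₑ ^ (-s))
      ((L.measurable_enorm_symbol j).mul (measurable_enorm.pow_const _))
    simp only [mul_assoc] at h2
    rw [h2] at h1
    calc _ ≤ _ := mul_le_mul_right h1 _
      _ = _ := by ring
  refine (freqTimeNorm_le_of_exponent_le one_ne_zero hr hr' _).trans (hbound.trans ?_)
  gcongr
  refine (freqNorm_rpow_mul_le one_ne_zero (by simp) s (-s) _).trans ?_
  gcongr
  rw [add_neg_cancel]
  have h3 := hswap (fun _ => 1) measurable_const
  simp only [one_mul] at h3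
  rw [h3]
  simpa using hCb le_rfl ENNReal.one_ne_top _ hg

/-- The intersection of the two Chemin-Lerner spaces embeds into `L²(I; L¹)`. -/
theorem zNorm_sq_le_freqTimeNorm (L : LittlewoodPaley) {d : ℝˣ} {α : ℝ} (hα₀ : 0 < α) (hα₁ : α < 1)
    (hr1 : 1 ≤ r) (hr2 : r ≤ 2) {V : ℝ → E → Fin 4 → ℂ} (hV : Measurable (Function.uncurry V)) :
    zNorm d I V ^ 2 ≤ 2 * geomConst α *
      (freqTimeNorm L (2 / (1 - α)) (-α) r I (fun t => size d (V t)) *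
        freqTimeNorm L (2 / (1 + α)) α r I (fun t => size d (V t))) := by
  -- The reciprocals `(1 + α)/2` and `(1 - α)/2` add up to 1.
  have hpq : (2 / (1 + α)).HolderConjugate (2 / (1 - α)) := by
    rw [Real.holderConjugate_iff]
    have h1 : 0 < 1 - α := by linarith
    have h2 : 0 < 1 + α := by linarith
    refine ⟨by rw [lt_div_iff₀ h2]; linarith, by field_simp; ring⟩
  have hm := measurable_uncurry_size (d := d) hV
  have hr0 : r ≠ 0 := (zero_lt_one.trans_le hr1).ne'
  rw [zNorm_sq]
  calc _ ≤ ∫⁻ t in I, (∑' k : ℤ, ∫⁻ ξ, ‖L.symbol k ξ‖ₑ * size d (V t) ξ) ^ 2 := by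
        refine lintegral_mono fun t => ?_
        gcongr
        exact lintegral_le_tsum_symbol L (measurable_size hV.of_uncurry_left)
    _ ≤ _ := lintegral_sq_tsum_le
        (fun k => (measurable_lintegral_symbol_mul L k hm).aemeasurable) hpq α
    -- The Schur estimate lives in ℓ²; this is where `r ≤ 2` enters.
    _ ≤ _ := by
        gcongr
        · exact freqTimeNorm_le_of_exponent_le hr0 hr2 (by simp) _
        · exact freqTimeNorm_le_of_exponent_le hr0 hr2 (by simp) _

end FreqTimeNorm

/-! ### Regularity of solutions of the mild equation on the Fourier side -/

/-- A solution in `L²(I; L¹)` of the mild equation on the Fourier side. -/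
structure IsPicardSolution (P : Parameters) (d : ℝˣ) (M : ℝ) (I : Set ℝ) (V₀ : E → Fin 4 → ℂ)
    (V : ℝ → E → Fin 4 → ℂ) : Prop where
  bound : SemigroupBound P d M I
  M_nonneg : 0 ≤ M
  measurableSet : MeasurableSet I
  subset_Ici : I ⊆ Ici 0
  Icc_subset : ∀ t ∈ I, Icc 0 t ⊆ I
  measurable_data : Measurable V₀
  measurable : Measurable (Function.uncurry V)
  zNorm_ne_top : zNorm d I V ≠ ∞
  eq_picard : ∀ t ∈ I, V t = picard P V₀ V t

/-- The majorant of the quadratic nonlinearity. -/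
def forcing (d : ℝˣ) (V : ℝ → E → Fin 4 → ℂ) (τ : ℝ) (ξ : E) : ℝ≥0∞ := majorant d (V τ) 0 ξ

/-- A bound of the Fourier transform of a solution which is uniform in time. -/
def envelope (d : ℝˣ) (M : ℝ) (I : Set ℝ) (V₀ : E → Fin 4 → ℂ) (V : ℝ → E → Fin 4 → ℂ) (ξ : E) :
    ℝ≥0∞ :=
  ENNReal.ofReal M * size d V₀ ξ + duhamelConst M * (‖ξ‖ₑ * ∫⁻ τ in I, forcing d V τ ξ)

theorem measurable_forcing {d : ℝˣ} {V : ℝ → E → Fin 4 → ℂ} (hV : Measurable (Function.uncurry V)) :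
    Measurable (Function.uncurry (forcing d V)) :=
  measurable_majorant hV (W := fun _ => 0) measurable_const

theorem measurable_lintegral_forcing {d : ℝˣ} {V : ℝ → E → Fin 4 → ℂ} (I : Set ℝ)
    (hV : Measurable (Function.uncurry V)) : Measurable fun ξ => ∫⁻ τ in I, forcing d V τ ξ := by
  exact (measurable_forcing hV).lintegral_prod_left

theorem measurable_lintegral_Ioc {f : ℝ × E → ℝ → ℝ≥0∞} (hf : Measurable (Function.uncurry f)) :
    Measurable fun q : ℝ × E => ∫⁻ τ in Ioc 0 q.1, f q τ := by
  have h2 : MeasurableSet {z : (ℝ × E) × ℝ | 0 < z.2 ∧ z.2 ≤ z.1.1} :=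
    (measurableSet_lt measurable_const measurable_snd).inter
      (measurableSet_le measurable_snd measurable_fst.fst)
  have h3 := (hf.indicator h2).lintegral_prod_right' (ν := (volume : Measure ℝ))
  have e : (fun q : ℝ × E => ∫⁻ τ in Ioc 0 q.1, f q τ) = fun q => ∫⁻ τ,
      {z : (ℝ × E) × ℝ | 0 < z.2 ∧ z.2 ≤ z.1.1}.indicator (Function.uncurry f) (q, τ) := by
    ext1 q
    rw [← lintegral_indicator measurableSet_Ioc]
    rfl
  rw [e]
  exact h3

theorem measurable_lintegral_heatKer (P : Parameters) {h : ℝ → E → ℝ≥0∞}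
    (hh : Measurable (Function.uncurry h)) : Measurable fun q : ℝ × E =>
      ∫⁻ τ in Ioc 0 q.1, heatKer P (q.1 - τ) q.2 * (‖q.2‖ₑ * h τ q.2) := by
  refine measurable_lintegral_Ioc (f := fun q τ => heatKer P (q.1 - τ) q.2 * (‖q.2‖ₑ * h τ q.2)) ?_
  have h1 : Measurable fun z : (ℝ × E) × ℝ => heatKer P (z.1.1 - z.2) z.1.2 :=
    (measurable_heatKer P).comp ((measurable_fst.fst.sub measurable_snd).prodMk measurable_fst.snd)
  have h2 : Measurable fun z : (ℝ × E) × ℝ => h z.2 z.1.2 :=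
    hh.comp (measurable_snd.prodMk measurable_fst.snd)
  exact h1.mul (measurable_fst.snd.enorm.mul h2)

namespace IsPicardSolution

variable {P : Parameters} {d : ℝˣ} {M : ℝ} {I : Set ℝ} {V₀ : E → Fin 4 → ℂ}
  {V : ℝ → E → Fin 4 → ℂ}

/-- The forcing is the convolution square of the size of `V`, so its L¹ norm is the square of that
of `V`, and its integral in time is `zNorm d I V ^ 2`. -/
theorem lintegral_forcing_ne_top (h : IsPicardSolution P d M I V₀ V) :
    ∫⁻ τ in I, ∫⁻ ξ, forcing d V τ ξ ≠ ∞ := by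
  have e : ∀ τ, ∫⁻ ξ, forcing d V τ ξ = (∫⁻ ξ, size d (V τ) ξ) ^ 2 := by
    intro τ
    have h0 : ∀ ξ, size d (0 : E → Fin 4 → ℂ) ξ = 0 := fun ξ => by simp [size]
    have h1 := lintegral_majorant (d := d) (V := V τ) (W := 0) h.measurable.of_uncurry_left
      measurable_const
    simp only [forcing]
    rw [h1]
    simp only [h0, sub_zero, lintegral_zero, add_zero, sq]
  simp_rw [e]
  rw [← zNorm_sq]
  exact ENNReal.pow_ne_top h.zNorm_ne_top

theorem lintegral_lintegral_forcing_ne_top (h : IsPicardSolution P d M I V₀ V) :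
    ∫⁻ ξ, ∫⁻ τ in I, forcing d V τ ξ ≠ ∞ := by
  rw [← lintegral_lintegral_swap (measurable_forcing h.measurable).aemeasurable]
  exact h.lintegral_forcing_ne_top

theorem ae_lintegral_forcing_ne_top (h : IsPicardSolution P d M I V₀ V) :
    ∀ᵐ ξ : E, ∫⁻ τ in I, forcing d V τ ξ ≠ ∞ := by
  filter_upwards [ae_lt_top (measurable_lintegral_forcing I h.measurable)
    h.lintegral_lintegral_forcing_ne_top] with ξ hξ using hξ.ne

theorem enorm_scale_duhamelIntegrand_le (h : IsPicardSolution P d M I V₀ V) {t τ : ℝ} (ht : t ∈ I)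
    (hτ : τ ∈ Ioc 0 t) (ξ : E) : ‖scale d (duhamelIntegrand P V t ξ τ)‖ₑ ≤
      duhamelConst M * (heatKer P (t - τ) ξ * (‖ξ‖ₑ * forcing d V τ ξ)) := by
  have h1 := enorm_scale_duhamelIntegrand_sub_le h.bound h.M_nonneg h.measurable
    (W := fun _ => 0) measurable_const (t := t) (τ := τ)
    (h.Icc_subset t ht ⟨by linarith [hτ.2], by linarith [hτ.1]⟩) ξ
  have h2 : duhamelIntegrand P (fun _ => 0) t ξ τ = 0 := by
    have : advection (0 : E → Fin 4 → ℂ) = 0 := by ext ξ k; simp [advection]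
    simp [duhamelIntegrand, this]
  rwa [h2, sub_zero] at h1

theorem enorm_scale_duhamelIntegrand_le_forcing (h : IsPicardSolution P d M I V₀ V) {t τ : ℝ}
    (ht : t ∈ I) (hτ : τ ∈ Ioc 0 t) (ξ : E) : ‖scale d (duhamelIntegrand P V t ξ τ)‖ₑ ≤
      duhamelConst M * ‖ξ‖ₑ * forcing d V τ ξ := by
  refine (h.enorm_scale_duhamelIntegrand_le ht hτ ξ).trans ?_
  rw [mul_assoc]
  gcongr _ * ?_
  calc _ ≤ 1 * (‖ξ‖ₑ * forcing d V τ ξ) := by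
        gcongr
        exact heatKer_le_one P (by linarith [hτ.2]) ξ
    _ = _ := one_mul _

theorem size_le (h : IsPicardSolution P d M I V₀ V) {t : ℝ} (ht : t ∈ I) (ξ : E) :
    size d (V t) ξ ≤ ENNReal.ofReal M * (heatKer P t ξ * size d V₀ ξ) + duhamelConst M *
      ∫⁻ τ in Ioc 0 t, heatKer P (t - τ) ξ * (‖ξ‖ₑ * forcing d V τ ξ) := by
  rw [h.eq_picard t ht, size, picard, map_sub]
  refine enorm_sub_le.trans (add_le_add ?_ ?_)
  · rw [← mul_assoc]
    exact h.bound.enorm_le h.M_nonneg ht ξ _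
  · have h1 := size_duhamel_sub_le h.bound h.M_nonneg h.measurable (W := fun _ => 0)
      measurable_const (h.subset_Ici ht) (h.Icc_subset t ht) ξ
    have h2 : duhamel P (fun _ => 0) t = 0 := duhamel_zero P t
    rw [h2, sub_zero] at h1
    exact h1

theorem size_le_envelope (h : IsPicardSolution P d M I V₀ V) {t : ℝ} (ht : t ∈ I) (ξ : E) :
    size d (V t) ξ ≤ envelope d M I V₀ V ξ := by
  refine (h.size_le ht ξ).trans ?_
  rw [envelope]
  gcongr ENNReal.ofReal M * ?_ + _ * ?_
  · calc _ ≤ 1 * size d V₀ ξ := by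
          gcongr
          exact heatKer_le_one P (h.subset_Ici ht) ξ
      _ = _ := one_mul _
  · rw [← lintegral_const_mul' _ _ enorm_ne_top]
    refine (setLIntegral_mono' measurableSet_Ioc fun τ hτ => ?_).trans
      (lintegral_mono_set (Ioc_subset_Icc_self.trans (h.Icc_subset t ht)))
    calc _ ≤ 1 * (‖ξ‖ₑ * forcing d V τ ξ) := by
          gcongr
          exact heatKer_le_one P (by linarith [hτ.2]) ξ
      _ = _ := one_mul _

/-- Regularity `-1` absorbs the factor `|ξ|` of the Duhamel part, which then needs only the L¹ bound
of the forcing. -/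
theorem freqNorm_envelope_ne_top (h : IsPicardSolution P d M I V₀ V) {L : LittlewoodPaley}
    {r : ℝ≥0∞} (hr : 1 ≤ r) (hr' : r ≠ ∞) (hV₀ : freqNorm L (-1) r (size d V₀) ≠ ∞) :
    freqNorm L (-1) r (envelope d M I V₀ V) ≠ ∞ := by
  have hr0 : r ≠ 0 := (zero_lt_one.trans_le hr).ne'
  refine ne_top_of_le_ne_top ?_ (freqNorm_add_le hr ((measurable_size h.measurable_data).const_mul _))
  rw [freqNorm_const_mul hr0 hr' ENNReal.ofReal_ne_top,
    freqNorm_const_mul hr0 hr' (duhamelConst_ne_top M)]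
  refine ENNReal.add_ne_top.2 ⟨ENNReal.mul_ne_top ENNReal.ofReal_ne_top hV₀,
    ENNReal.mul_ne_top (duhamelConst_ne_top M) ?_⟩
  obtain ⟨C, hC, hCb⟩ := exists_freqNorm_le_lintegral L (-1)
  have hm := measurable_lintegral_forcing (d := d) I h.measurable
  refine ne_top_of_le_ne_top (ENNReal.mul_ne_top hC h.lintegral_lintegral_forcing_ne_top)
    ((hCb hr hr' _ (measurable_enorm.mul hm)).trans ?_)
  gcongr _ * ?_
  refine lintegral_mono fun ξ => ?_
  simp only [Pi.mul_apply]
  rw [← mul_assoc]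
  refine (mul_le_of_le_one_left zero_le ?_)
  rw [ENNReal.rpow_neg_one]
  exact ENNReal.inv_mul_le_one _

theorem freqTimeNorm_ne_top (h : IsPicardSolution P d M I V₀ V) {L : LittlewoodPaley}
    {r : ℝ≥0∞} (hr : 1 ≤ r) (hr' : r ≠ ∞) {s : ℝ} (hs : -1 < s) (hs1 : s ≤ 1)
    (hV₀ : freqNorm L (-1) r (size d V₀) ≠ ∞) :
    freqTimeNorm L (2 / (1 + s)) s r I (fun t => size d (V t)) ≠ ∞ := by
  have hr0 : r ≠ 0 := (zero_lt_one.trans_le hr).ne'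
  have hs' : 0 < 1 + s := by linarith
  have hp : 1 ≤ 2 / (1 + s) := by rw [le_div_iff₀ hs']; linarith
  have hp0 : 0 < 2 / (1 + s) := by positivity
  have hm₀ := measurable_size (d := d) h.measurable_data
  have hf := measurable_forcing (d := d) h.measurable
  let lin : ℝ → E → ℝ≥0∞ := fun t ξ => ENNReal.ofReal M * (heatKer P t ξ * size d V₀ ξ)
  have hlin : Measurable (Function.uncurry lin) :=
    ((measurable_heatKer P).mul (hm₀.comp measurable_snd)).const_mul _
  let duh : ℝ → E → ℝ≥0∞ := fun t ξ => duhamelConst M *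
    ∫⁻ τ in Ioc 0 t, heatKer P (t - τ) ξ * (‖ξ‖ₑ * forcing d V τ ξ)
  have hduh : Measurable (Function.uncurry duh) :=
    (measurable_lintegral_heatKer P hf).const_mul _
  have h1 : freqTimeNorm L (2 / (1 + s)) s r I (fun t => size d (V t)) ≤
      freqTimeNorm L (2 / (1 + s)) s r I (fun t ξ => lin t ξ + duh t ξ) := by
    refine freqTimeNorm_mono ?_
    filter_upwards [ae_restrict_mem h.measurableSet] with t ht
    exact Eventually.of_forall (h.size_le ht)
  refine ne_top_of_le_ne_top ?_ (h1.trans (freqTimeNorm_add_le hp hr hlin hduh))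
  simp only [lin, duh]
  rw [freqTimeNorm_const_mul hp0 hr0 hr' ENNReal.ofReal_ne_top,
    freqTimeNorm_const_mul hp0 hr0 hr' (duhamelConst_ne_top M)]
  refine ENNReal.add_ne_top.2 ⟨ENNReal.mul_ne_top ENNReal.ofReal_ne_top ?_,
    ENNReal.mul_ne_top (duhamelConst_ne_top M) ?_⟩
  · refine ne_top_of_le_ne_top ?_ (freqTimeNorm_heatKer_le P hs hs1 hr0 hr' h.measurableSet
      h.subset_Ici hm₀)
    exact ENNReal.mul_ne_top (ENNReal.mul_ne_top (heatConst_ne_top P hp0)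
      (ENNReal.rpow_ne_top_of_nonneg (abs_nonneg _) (by simp))) hV₀
  · exact freqTimeNorm_duhamel_ne_top P hs hs1 hr hr' h.measurableSet h.Icc_subset hf
      h.lintegral_forcing_ne_top

/-- Supplies the weighted L¹ bounds at almost every time on which strong measurability rests. The
free part is handled at each fixed `t > 0` by the decay of the heat kernel; the Duhamel part has a
finite L^(2/(1+s)) norm in time, hence is finite almost everywhere. -/
theorem ae_lintegral_rpow_mul_size_ne_top (h : IsPicardSolution P d M I V₀ V) {L : LittlewoodPaley}
    {r : ℝ≥0∞} (hr0 : r ≠ 0) {s : ℝ} (hs : -1 < s) (hs1 : s < 1)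
    (hV₀ : freqNorm L (-1) r (size d V₀) ≠ ∞) :
    ∀ᵐ t ∂volume.restrict I, ∫⁻ ξ, ‖ξ‖ₑ ^ s * size d (V t) ξ ≠ ∞ := by
  have hs' : 0 < 1 + s := by linarith
  have hp : 1 ≤ 2 / (1 + s) := by rw [le_div_iff₀ hs']; linarith
  have hp0 : 0 < 2 / (1 + s) := by positivity
  have e1 : 1 - (2 / (2 / (1 + s))) = -s := by field_simp; ring
  have hm₀ := measurable_size (d := d) h.measurable_data
  have hf := measurable_forcing (d := d) h.measurable
  have hw : Measurable fun ξ : E => ‖ξ‖ₑ ^ s := measurable_enorm.pow_const s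
  have hlin : ∀ t, 0 < t → ∫⁻ ξ, ‖ξ‖ₑ ^ s * heatKer P t ξ * size d V₀ ξ ≠ ∞ := by
    intro t ht
    have hc : 0 < 4 * Real.pi ^ 2 * P.ν * t := by have := P.ν_pos; positivity
    -- The heat kernel is bounded by 1 and, as `exp(-x) ≤ 1/x`, by a multiple of `|ξ|⁻²`. This gives
    -- the exponents `s > -1` and `s - 2 < -1` on the two sides of the regularity of the data; `A`
    -- dominates both constants.
    refine lintegral_mul_ne_top_of_freqNorm (L := L) (r := r) (s := -1)
      (A := 1 + ENNReal.ofReal (1 / (4 * Real.pi ^ 2 * P.ν * t))) (σ₁ := s - 2) (σ₂ := s)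
      (hw.mul ((measurable_heatKer P).of_uncurry_left (x := t))) hm₀ (by finiteness)
      (by linarith) hs (fun ξ hξ => ?_) (fun ξ hξ => ?_) hr0 hV₀
    · have hξ' : 0 < ‖ξ‖ := norm_pos_iff.2 hξ
      have h1 : heatKer P t ξ ≤ ENNReal.ofReal (1 / (4 * Real.pi ^ 2 * P.ν * t)) * ‖ξ‖ₑ ^ (-2 : ℝ) := by
        rw [← ofReal_norm, ENNReal.ofReal_rpow_of_pos hξ', ← ENNReal.ofReal_mul (by positivity),
          heatKer]
        refine ENNReal.ofReal_le_ofReal ?_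
        have h2 : 0 < 4 * Real.pi ^ 2 * P.ν * ‖ξ‖ ^ 2 * t := by have := P.ν_pos; positivity
        rw [neg_mul, Real.exp_neg]
        have h3 : 1 / (4 * Real.pi ^ 2 * P.ν * t) * ‖ξ‖ ^ (-2 : ℝ) =
            (4 * Real.pi ^ 2 * P.ν * ‖ξ‖ ^ 2 * t)⁻¹ := by
          rw [Real.rpow_neg hξ'.le]
          norm_cast
          field_simp
        rw [h3]
        gcongr
        linarith [Real.add_one_le_exp (4 * Real.pi ^ 2 * P.ν * ‖ξ‖ ^ 2 * t)]
      calc _ ≤ ‖ξ‖ₑ ^ s * (ENNReal.ofReal (1 / (4 * Real.pi ^ 2 * P.ν * t)) * ‖ξ‖ₑ ^ (-2 : ℝ)) := by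
            gcongr
        _ = ENNReal.ofReal (1 / (4 * Real.pi ^ 2 * P.ν * t)) * ‖ξ‖ₑ ^ (s - 2) := by
            rw [sub_eq_add_neg, ENNReal.rpow_add _ _ (by simpa using hξ) enorm_ne_top]; ring
        _ ≤ _ := by gcongr; exact le_add_self
    · calc _ ≤ ‖ξ‖ₑ ^ s * 1 := by gcongr; exact heatKer_le_one P ht.le ξ
        _ = 1 * ‖ξ‖ₑ ^ s := by ring
        _ ≤ _ := by gcongr; exact le_self_add
  have hduh : ∀ᵐ t ∂volume.restrict I, ∫⁻ ξ, ‖ξ‖ₑ ^ s *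
      ∫⁻ τ in Ioc 0 t, heatKer P (t - τ) ξ * (‖ξ‖ₑ * forcing d V τ ξ) ≠ ∞ := by
    have h1 := eLpNorm_lintegral_duhamel_le P hp h.measurableSet h.Icc_subset hw hf
    rw [e1] at h1
    have h2 : ∫⁻ τ in I, ∫⁻ ξ, ‖ξ‖ₑ ^ s * (‖ξ‖ₑ ^ (-s) * forcing d V τ ξ) ≠ ∞ := by
      refine ne_top_of_le_ne_top h.lintegral_forcing_ne_top
        (lintegral_mono fun τ => lintegral_mono fun ξ => ?_)
      rw [← mul_assoc, ENNReal.rpow_neg]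
      exact mul_le_of_le_one_left zero_le (ENNReal.mul_inv_le_one _)
    have h3 := ne_top_of_le_ne_top (ENNReal.mul_ne_top (heatConst_ne_top P hp0) h2) h1
    rw [eLpNorm_ofReal_eq _ hp0] at h3
    have h4 := (ENNReal.rpow_lt_top_iff_of_pos (by positivity)).1 h3.lt_top
    have h5 : Measurable fun q : ℝ × E => ‖q.2‖ₑ ^ s *
        ∫⁻ τ in Ioc 0 q.1, heatKer P (q.1 - τ) q.2 * (‖q.2‖ₑ * forcing d V τ q.2) :=
      (measurable_snd.enorm.pow_const s).mul (measurable_lintegral_heatKer P hf)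
    have h6 := h5.lintegral_prod_right' (ν := (volume : Measure E))
    filter_upwards [ae_lt_top (h6.pow_const _) h4.ne] with t ht
    exact ((ENNReal.rpow_lt_top_iff_of_pos hp0).1 ht).ne
  have hpos : ∀ᵐ t ∂volume.restrict I, t ≠ 0 := by
    refine ae_restrict_of_ae ?_
    simp [ae_iff]
  filter_upwards [hduh, hpos, ae_restrict_mem h.measurableSet] with t h1 h2 ht
  have ht0 : 0 < t := lt_of_le_of_ne (h.subset_Ici ht) h2.symm
  refine ne_top_of_le_ne_top (ENNReal.add_ne_top.2
    ⟨ENNReal.mul_ne_top (ENNReal.ofReal_ne_top (r := M)) (hlin t ht0),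
      ENNReal.mul_ne_top (duhamelConst_ne_top M) h1⟩) ?_
  rw [← lintegral_const_mul' _ _ ENNReal.ofReal_ne_top, ← lintegral_const_mul' _ _
    (duhamelConst_ne_top M), ← lintegral_add_left]
  · refine lintegral_mono fun ξ => ?_
    calc _ ≤ ‖ξ‖ₑ ^ s * _ := mul_le_mul_right (h.size_le ht ξ) _
      _ = _ := by ring
  · exact ((hw.mul ((measurable_heatKer P).of_uncurry_left (x := t))).mul hm₀).const_mul _

end IsPicardSolution

/-! ### Continuity in time -/

theorem continuous_semigroup (P : Parameters) (ξ : E) : Continuous fun t => semigroup P t ξ := by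
  open scoped Matrix.Norms.L2Operator in
  have hexp : Continuous (NormedSpace.exp : Matrix (Fin 4) (Fin 4) ℂ → Matrix (Fin 4) (Fin 4) ℂ) := by
    let _ : NormedAlgebra ℚ (Matrix (Fin 4) (Fin 4) ℂ) := NormedAlgebra.restrictScalars ℚ ℂ _
    exact NormedSpace.exp_continuous
  refine hexp.comp ?_
  have h1 : Continuous fun t : ℝ => -(t : ℂ) := by fun_prop
  exact h1.smul continuous_const

theorem continuous_duhamelIntegrand (P : Parameters) (V : ℝ → E → Fin 4 → ℂ) (ξ : E) (τ : ℝ) :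
    Continuous fun t => duhamelIntegrand P V t ξ τ :=
  Continuous.matrix_mulVec ((continuous_semigroup P ξ).comp (continuous_sub_right τ))
    continuous_const

theorem measurable_duhamelIntegrand_right (P : Parameters) {V : ℝ → E → Fin 4 → ℂ}
    (hV : Measurable (Function.uncurry V)) (t : ℝ) (ξ : E) :
    Measurable fun τ => duhamelIntegrand P V t ξ τ := by
  have h0 : Measurable fun τ : ℝ => ((t, ξ), τ) := measurable_prodMk_left
  have h1 := (measurable_duhamelIntegrand P hV).comp h0
  simp only [Function.comp_def] at h1
  exact h1

namespace IsPicardSolution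

variable {P : Parameters} {d : ℝˣ} {M : ℝ} {I : Set ℝ} {V₀ : E → Fin 4 → ℂ}
  {V : ℝ → E → Fin 4 → ℂ}

theorem lintegral_bound_ne_top {ξ : E}
    (hξ : ∫⁻ τ in I, forcing d V τ ξ ≠ ∞) :
    ∫⁻ τ in I, duhamelConst M * ‖ξ‖ₑ * forcing d V τ ξ ≠ ∞ := by
  have hc : duhamelConst M * ‖ξ‖ₑ ≠ ∞ := ENNReal.mul_ne_top (duhamelConst_ne_top M) enorm_ne_top
  rw [lintegral_const_mul' _ _ hc]
  exact ENNReal.mul_ne_top hc hξ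

theorem integrableOn_scale (h : IsPicardSolution P d M I V₀ V) {ξ : E}
    (hξ : ∫⁻ τ in I, forcing d V τ ξ ≠ ∞) {t : ℝ} (ht : t ∈ I) :
    IntegrableOn (fun τ => scale d (duhamelIntegrand P V t ξ τ)) (Ioc 0 t) := by
  refine ⟨((scale d).continuous.measurable.comp
    (measurable_duhamelIntegrand_right P h.measurable t ξ)).aestronglyMeasurable, ?_⟩
  refine lt_of_le_of_lt ?_ (lintegral_bound_ne_top (M := M) hξ).lt_top
  exact (setLIntegral_mono' measurableSet_Ioc fun τ hτ =>
    h.enorm_scale_duhamelIntegrand_le_forcing ht hτ ξ).trans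
      (lintegral_mono_set (Ioc_subset_Icc_self.trans (h.Icc_subset t ht)))

theorem intervalIntegrable (h : IsPicardSolution P d M I V₀ V) {ξ : E}
    (hξ : ∫⁻ τ in I, forcing d V τ ξ ≠ ∞) {t : ℝ} (ht : t ∈ I) :
    IntervalIntegrable (fun τ => duhamelIntegrand P V t ξ τ) volume 0 t := by
  rw [intervalIntegrable_iff_integrableOn_Ioc_of_le (h.subset_Ici ht)]
  exact (ContinuousLinearEquiv.integrable_comp_iff (scale d)).1 (h.integrableOn_scale hξ ht)

/-- Integrating over the fixed set `I`, with the variable endpoint put into an indicator, makes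
dominated convergence applicable. For fixed `τ` the integrand can jump only at `t = τ`, so it is
continuous at `t₀` for all `τ ≠ t₀`. -/
theorem continuousOn_duhamel (h : IsPicardSolution P d M I V₀ V) {ξ : E}
    (hξ : ∫⁻ τ in I, forcing d V τ ξ ≠ ∞) : ContinuousOn (fun t => duhamel P V t ξ) I := by
  let F : ℝ → ℝ → EuclideanSpace ℂ (Fin 4) := fun t =>
    (Ioc 0 t).indicator fun τ => scale d (duhamelIntegrand P V t ξ τ)
  have hF : ∀ t ∈ I, duhamel P V t ξ = (scale d).symm (∫ τ in I, F t τ) := by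
    intro t ht
    rw [setIntegral_indicator measurableSet_Ioc, inter_eq_self_of_subset_right
      (Ioc_subset_Icc_self.trans (h.Icc_subset t ht)),
      ContinuousLinearEquiv.integral_comp_comm (scale d), ContinuousLinearEquiv.symm_apply_apply,
      duhamel, intervalIntegral.integral_of_le (h.subset_Ici ht)]
  refine ContinuousOn.congr ?_ hF
  refine (scale d).symm.continuous.comp_continuousOn fun t₀ ht₀ => ?_
  refine continuousWithinAt_of_dominated
    (bound := fun τ => (duhamelConst M * ‖ξ‖ₑ * forcing d V τ ξ).toReal)
    (Eventually.of_forall fun t => ?_) ?_ ?_ ?_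
  · exact (((scale d).continuous.measurable.comp
      (measurable_duhamelIntegrand_right P h.measurable t ξ)).indicator
        measurableSet_Ioc).aestronglyMeasurable
  · filter_upwards [self_mem_nhdsWithin] with t ht
    have hm : Measurable fun τ => duhamelConst M * ‖ξ‖ₑ * forcing d V τ ξ :=
      (measurable_forcing h.measurable).of_uncurry_right.const_mul _
    filter_upwards [ae_lt_top hm (lintegral_bound_ne_top hξ)] with τ hτ
    by_cases hτ' : τ ∈ Ioc 0 t
    · simp only [F, indicator_of_mem hτ']
      have := h.enorm_scale_duhamelIntegrand_le_forcing ht hτ' ξ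
      rw [← toReal_enorm]
      exact ENNReal.toReal_mono hτ.ne this
    · simp only [F, indicator_of_notMem hτ', norm_zero]
      exact ENNReal.toReal_nonneg
  · exact integrable_toReal_of_lintegral_ne_top
      ((measurable_forcing h.measurable).of_uncurry_right.const_mul _).aemeasurable
      (lintegral_bound_ne_top hξ)
  · have hne : ∀ᵐ τ ∂volume.restrict I, τ ≠ t₀ := ae_restrict_of_ae (by simp [ae_iff])
    filter_upwards [hne] with τ hτ
    rcases le_or_gt τ 0 with h0 | h0
    · have : (fun t => F t τ) = fun _ => 0 := by
        ext1 t
        exact indicator_of_notMem (fun hm => absurd hm.1 (not_lt.2 h0)) _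
      rw [this]
      exact continuousWithinAt_const
    · refine ContinuousAt.continuousWithinAt ?_
      rcases lt_or_gt_of_ne hτ with h1 | h1
      · refine ContinuousAt.congr (f := fun t => scale d (duhamelIntegrand P V t ξ τ)) ?_ ?_
        · exact ((scale d).continuous.comp (continuous_duhamelIntegrand P V ξ τ)).continuousAt
        · filter_upwards [Ioi_mem_nhds h1] with t ht
          have hm : τ ∈ Ioc 0 t := ⟨h0, le_of_lt ht⟩
          exact (indicator_of_mem hm fun τ => scale d (duhamelIntegrand P V t ξ τ)).symm
      · refine ContinuousAt.congr (f := fun _ => (0 : EuclideanSpace ℂ (Fin 4))) continuousAt_const ?_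
        filter_upwards [Iio_mem_nhds h1] with t ht
        have hm : τ ∉ Ioc 0 t := fun hm => absurd hm.2 (not_le.2 ht)
        exact (indicator_of_notMem hm fun τ => scale d (duhamelIntegrand P V t ξ τ)).symm

theorem continuousOn (h : IsPicardSolution P d M I V₀ V) {ξ : E}
    (hξ : ∫⁻ τ in I, forcing d V τ ξ ≠ ∞) : ContinuousOn (fun t => V t ξ) I := by
  have h1 : ContinuousOn (fun t => picard P V₀ V t ξ) I :=
    (Continuous.matrix_mulVec (continuous_semigroup P ξ) continuous_const).continuousOn.sub
      (h.continuousOn_duhamel hξ)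
  exact h1.congr fun t ht => congrFun (h.eq_picard t ht) ξ

/-- Continuity in time at almost every frequency becomes continuity in norm, as twice the envelope
dominates all differences. -/
theorem tendsto_freqNorm_sub (h : IsPicardSolution P d M I V₀ V) {L : LittlewoodPaley}
    {r : ℝ≥0∞} (hr : 1 ≤ r) (hr' : r ≠ ∞) (hV₀ : freqNorm L (-1) r (size d V₀) ≠ ∞) {t : ℝ}
    (ht : t ∈ I) :
    Tendsto (fun t' => freqNorm L (-1) r (size d (V t' - V t))) (𝓝[I] t) (𝓝 0) := by
  have hr0 : r ≠ 0 := (zero_lt_one.trans_le hr).ne'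
  refine tendsto_freqNorm_zero hr hr' (b := fun ξ => 2 * envelope d M I V₀ V ξ)
    (fun t' => measurable_size (h.measurable.of_uncurry_left.sub h.measurable.of_uncurry_left)) ?_ ?_ ?_
  · filter_upwards [self_mem_nhdsWithin] with t' ht'
    refine Eventually.of_forall fun ξ => ?_
    rw [two_mul]
    refine le_trans ?_ (add_le_add (h.size_le_envelope ht' ξ) (h.size_le_envelope ht ξ))
    simp only [size, Pi.sub_apply, map_sub]
    exact enorm_sub_le
  · rw [freqNorm_const_mul hr0 hr' (by simp)]
    exact ENNReal.mul_ne_top (by simp) (h.freqNorm_envelope_ne_top hr hr' hV₀)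
  · filter_upwards [h.ae_lintegral_forcing_ne_top] with ξ hξ
    have h1 := ((scale d).continuous.tendsto _).comp
      (((h.continuousOn hξ t ht).tendsto).sub_const (V t ξ))
    rw [sub_self, map_zero] at h1
    have h2 := h1.enorm
    rw [enorm_zero] at h2
    exact h2

end IsPicardSolution

/-! ### Strong measurability -/

/-- The distance to a closed set is an infimum over a countable dense subset, hence measurable, and
the preimage of the set is its zero set. In an L¹ space these distances are integrals depending on a
parameter. -/
theorem measurable_of_measurable_edist {α X : Type*} [MeasurableSpace α] [PseudoEMetricSpace X]
    [SecondCountableTopology X] [MeasurableSpace X] [BorelSpace X] {g : α → X}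
    (hg : ∀ x, Measurable fun a => edist (g a) x) : Measurable g := by
  refine measurable_of_isClosed fun C hC => ?_
  obtain ⟨D, hDC, hD, hCD⟩ := (TopologicalSpace.IsSeparable.of_separableSpace
    (C : Set X)).exists_countable_dense_subset
  have h1 : closure D = C := (closure_minimal hDC hC).antisymm hCD
  have h2 : g ⁻¹' C = {a | ⨅ x ∈ D, edist (g a) x = 0} := by
    ext a
    rw [mem_preimage, Metric.mem_iff_infEDist_zero_of_closed hC, ← h1, Metric.infEDist_closure]
    rfl
  rw [h2]
  exact (Measurable.biInf D hD fun x _ => hg x) (measurableSet_singleton 0)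

/-- The measure `(|ξ|^s + |ξ|^{-s}) dξ`. -/
def weightMeasure (s : ℝ) : Measure E :=
  volume.withDensity fun ξ => ‖ξ‖ₑ ^ s + ‖ξ‖ₑ ^ (-s)

theorem measurable_weight (s : ℝ) : Measurable fun ξ : E => ‖ξ‖ₑ ^ s + ‖ξ‖ₑ ^ (-s) := by
  fun_prop

instance sigmaFinite_weightMeasure (s : ℝ) : SigmaFinite (weightMeasure s) := by
  refine SigmaFinite.withDensity_of_ne_top ?_
  filter_upwards [ae_ne_zero] with ξ hξ
  have h : ∀ σ : ℝ, ‖ξ‖ₑ ^ σ ≠ ∞ := fun σ =>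
    ENNReal.rpow_ne_top_of_ne_zero (by simpa using hξ) enorm_ne_top
  exact ENNReal.add_ne_top.2 ⟨h _, h _⟩

theorem lintegral_weightMeasure (s : ℝ) {a : E → ℝ≥0∞} (ha : Measurable a) :
    ∫⁻ ξ, a ξ ∂weightMeasure s = (∫⁻ ξ, ‖ξ‖ₑ ^ s * a ξ) + ∫⁻ ξ, ‖ξ‖ₑ ^ (-s) * a ξ := by
  rw [weightMeasure, lintegral_withDensity_eq_lintegral_mul _ (measurable_weight s) ha,
    ← lintegral_add_left (by fun_prop)]
  simp_rw [Pi.mul_apply, add_mul]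

theorem one_le_weight (s : ℝ) {ξ : E} (hξ : ξ ≠ 0) : 1 ≤ ‖ξ‖ₑ ^ s + ‖ξ‖ₑ ^ (-s) := by
  have h0 : ‖ξ‖ₑ ^ s ≠ 0 := (ENNReal.rpow_pos (by simpa using hξ) enorm_ne_top).ne'
  rcases le_total 1 (‖ξ‖ₑ ^ s) with h | h
  · exact h.trans le_self_add
  · rw [ENNReal.rpow_neg]
    exact (ENNReal.one_le_inv.2 h).trans le_add_self

theorem lintegral_le_lintegral_weightMeasure (s : ℝ) {a : E → ℝ≥0∞} (ha : Measurable a) :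
    ∫⁻ ξ, a ξ ≤ ∫⁻ ξ, a ξ ∂weightMeasure s := by
  rw [weightMeasure, lintegral_withDensity_eq_lintegral_mul _ (measurable_weight s) ha]
  refine lintegral_mono_ae ?_
  filter_upwards [ae_ne_zero] with ξ hξ
  exact le_mul_of_one_le_left zero_le (one_le_weight s hξ)

theorem exists_hasFourier_of_integrable {f : E → ℂ} (hf : Integrable f) : ∃ u, HasFourier u f := by
  refine exists_hasFourier ?_
  refine hf.mono ?_ (Eventually.of_forall fun ξ => ?_)
  · have : Measurable fun ξ : E => ((1 + ‖ξ‖ ^ 2 : ℝ) : ℂ)⁻¹ := by fun_prop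
    exact this.aestronglyMeasurable.mul hf.aestronglyMeasurable
  · rw [norm_mul, norm_inv, Complex.norm_real, Real.norm_of_nonneg (by positivity)]
    refine mul_le_of_le_one_left (norm_nonneg _) (inv_le_one_of_one_le₀ ?_)
    nlinarith [sq_nonneg ‖ξ‖]

instance secondCountableTopology_weightMeasure (s : ℝ) :
    SecondCountableTopology (Lp ℂ 1 (weightMeasure s)) := by
  have : Fact ((1 : ℝ≥0∞) ≠ ∞) := ⟨ENNReal.one_ne_top⟩
  have := isSeparable_of_sigmaFinite (weightMeasure s)
  exact Lp.SecondCountableTopology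

/-- Functions with values in a weighted `L¹` space are strongly measurable, as functions with values
in Fourier-Besov spaces. -/
theorem stronglyMeasurableBesov_of_lintegral_ne_top (L : LittlewoodPaley) {r : ℝ≥0∞} (hr : 1 ≤ r)
    (hr' : r ≠ ∞) {I : Set ℝ} (hI : MeasurableSet I) {α s : ℝ} (hs : s = α ∨ s = -α)
    {u : ℝ → HomDist} {f : ℝ → E → ℂ} (hf : Measurable (Function.uncurry f))
    (hu : ∀ t ∈ I, HasFourier (u t) (f t))
    (hfin : ∀ᵐ t ∂volume.restrict I, ∫⁻ ξ, ‖f t ξ‖ₑ ∂weightMeasure α ≠ ∞) :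
    StronglyMeasurableBesov L s 1 r I u := by
  obtain ⟨C, hC, hCb⟩ := exists_freqNorm_le_lintegral L s
  have hb : ∀ a : E → ℝ≥0∞, Measurable a → freqNorm L s r a ≤ C * ∫⁻ ξ, a ξ ∂weightMeasure α := by
    intro a ha
    refine (hCb hr hr' a ha).trans ?_
    rw [lintegral_weightMeasure α ha]
    gcongr
    rcases hs with rfl | rfl
    · exact le_self_add
    · exact le_add_self
  let N : ℝ → ℝ≥0∞ := fun t => ∫⁻ ξ, ‖f t ξ‖ₑ ∂weightMeasure α
  have hN : Measurable N := by
    have h1 : Measurable fun q : ℝ × E => ‖f q.1 q.2‖ₑ := hf.enorm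
    exact h1.lintegral_prod_right'
  -- At the exceptional times, which form a null set of `I`, the function is replaced by 0 so that
  -- it takes values in the weighted L¹ space at all times.
  let S : Set ℝ := {t | N t < ∞}
  have hS : MeasurableSet S := measurableSet_lt hN measurable_const
  let F : ℝ → E → ℂ := fun t => S.indicator f t
  have hFm : Measurable (Function.uncurry F) := by
    have h1 : Function.uncurry F = (S ×ˢ (univ : Set E)).indicator (Function.uncurry f) := by
      ext q
      by_cases hq : q.1 ∈ S <;> simp [F, Function.uncurry, hq, indicator]
    rw [h1]
    exact hf.indicator (hS.prod MeasurableSet.univ)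
  have hFi : ∀ t, MemLp (F t) 1 (weightMeasure α) := by
    intro t
    rw [memLp_one_iff_integrable]
    refine ⟨hFm.of_uncurry_left.aestronglyMeasurable, ?_⟩
    by_cases ht : t ∈ S
    · have h1 : F t = f t := by simp only [F, indicator_of_mem ht]
      rw [h1]
      exact ht
    · simp [F, indicator_of_notMem ht, HasFiniteIntegral]
  -- A detour through a separable space: measurable maps into this L¹ space are limits of simple
  -- functions. The map `Φ` below carries them to Fourier-Besov spaces, where distances are at most
  -- `C` times the L¹ distance; the weight covers regularities `α` and `-α` at once.
  let g : ℝ → Lp ℂ 1 (weightMeasure α) := fun t => (hFi t).toLp (F t)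
  borelize ↥(Lp ℂ 1 (weightMeasure α))
  have hg : Measurable g := by
    refine measurable_of_measurable_edist fun x => ?_
    have hx := Lp.stronglyMeasurable x
    have h1 : ∀ t, edist (g t) x = ∫⁻ ξ, ‖F t ξ - x ξ‖ₑ ∂weightMeasure α := by
      intro t
      have h2 := Lp.edist_toLp_toLp (F t) x (hFi t) (Lp.memLp x)
      rw [Lp.toLp_coeFn] at h2
      rw [h2, eLpNorm_one_eq_lintegral_enorm]
      rfl
    simp_rw [h1]
    have h3 : Measurable fun q : ℝ × E => ‖F q.1 q.2 - x q.2‖ₑ :=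
      (hFm.sub (hx.measurable.comp measurable_snd)).enorm
    exact h3.lintegral_prod_right'
  have hint : ∀ x : Lp ℂ 1 (weightMeasure α), Integrable x (volume : Measure E) := by
    intro x
    have hx := Lp.stronglyMeasurable x
    refine ⟨hx.aestronglyMeasurable, ?_⟩
    refine (lintegral_le_lintegral_weightMeasure α hx.measurable.enorm).trans_lt ?_
    exact (L1.integrable_coeFn x).2
  choose Φ hΦ using fun x : Lp ℂ 1 (weightMeasure α) => exists_hasFourier_of_integrable (hint x)
  have hΦb : ∀ x : Lp ℂ 1 (weightMeasure α), MemBesov L s 1 r (Φ x) := by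
    intro x
    rw [MemBesov, (hΦ x).besovNorm_eq_freqNorm]
    refine (hb _ (Lp.stronglyMeasurable x).measurable.enorm).trans_lt ?_
    exact ENNReal.mul_lt_top hC.lt_top (L1.integrable_coeFn x).2
  have hsub : ∀ t ∈ I, t ∈ S → ∀ x, besovNorm L s 1 r (Φ x - u t) ≤ C * edist x (g t) := by
    intro t ht htS x
    have hx := Lp.stronglyMeasurable x
    have hft : F t = f t := by simp only [F, indicator_of_mem htS]
    rw [((hΦ x).sub (hu t ht)).besovNorm_eq_freqNorm]
    refine (hb _ (hx.measurable.sub hf.of_uncurry_left).enorm).trans ?_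
    gcongr
    have h2 := Lp.edist_toLp_toLp x (F t) (Lp.memLp x) (hFi t)
    rw [Lp.toLp_coeFn] at h2
    rw [h2, eLpNorm_one_eq_lintegral_enorm, hft]
  refine ⟨?_, fun n => (hg.stronglyMeasurable.approx n).map Φ, fun n t => hΦb _, ?_⟩
  · filter_upwards [hfin, ae_restrict_mem hI] with t h1 h2
    rw [MemBesov, (hu t h2).besovNorm_eq_freqNorm]
    exact (hb _ hf.of_uncurry_left.enorm).trans_lt (ENNReal.mul_lt_top hC.lt_top h1.lt_top)
  · filter_upwards [hfin, ae_restrict_mem hI] with t h1 h2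
    have h3 := (hg.stronglyMeasurable.tendsto_approx t)
    rw [tendsto_iff_edist_tendsto_0] at h3
    have h4 := ENNReal.Tendsto.const_mul h3 (Or.inr hC)
    rw [mul_zero] at h4
    exact tendsto_of_tendsto_of_tendsto_of_le_of_le tendsto_const_nhds h4 (fun n => zero_le)
      fun n => hsub t h2 h1.lt_top _

/-! ### From the Fourier side to distributions -/

/-- The weight `(1 + |ξ|²)⁻¹` is bounded by `|ξ|⁻²` and by 1, whose exponents lie on the two sides
of `-1`; the weighted function is therefore integrable and `f` defines a tempered distribution. -/
theorem exists_hasFourier_of_freqNorm {L : LittlewoodPaley} {r : ℝ≥0∞} (hr0 : r ≠ 0) {f : E → ℂ}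
    (hf : Measurable f) (h : freqNorm L (-1) r (fun ξ => ‖f ξ‖ₑ) ≠ ∞) : ∃ u, HasFourier u f := by
  have hk : Measurable fun ξ : E => ((1 + ‖ξ‖ ^ 2 : ℝ) : ℂ)⁻¹ := by fun_prop
  refine exists_hasFourier ⟨hk.aestronglyMeasurable.mul hf.aestronglyMeasurable, ?_⟩
  have hle : ∀ ξ : E, ∀ x : ℝ, 0 ≤ x → x * (1 + ‖ξ‖ ^ 2)⁻¹ ≤ 1 →
      ‖((1 + ‖ξ‖ ^ 2 : ℝ) : ℂ)⁻¹‖ₑ * ENNReal.ofReal x ≤ 1 := by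
    intro ξ x hx h1
    rw [← ofReal_norm, ← ENNReal.ofReal_mul (norm_nonneg _), norm_inv, Complex.norm_real,
      Real.norm_of_nonneg (by positivity), ENNReal.ofReal_le_one, mul_comm]
    exact h1
  have hfin := lintegral_mul_ne_top_of_freqNorm (L := L) (s := -1) (r := r) hk.enorm hf.enorm
    (A := 1) ENNReal.one_ne_top (σ₁ := -2) (σ₂ := 0) (by norm_num) (by norm_num)
    (fun ξ hξ => by
      have hξ' : 0 < ‖ξ‖ := norm_pos_iff.2 hξ
      have h1 := hle ξ (‖ξ‖ ^ 2) (by positivity) (by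
        rw [← div_eq_mul_inv, div_le_one (by positivity)]; linarith)
      rw [one_mul, ENNReal.rpow_neg, ENNReal.le_inv_iff_mul_le]
      refine le_trans (le_of_eq ?_) h1
      rw [ENNReal.ofReal_pow (norm_nonneg _), ofReal_norm]
      norm_cast)
    (fun ξ hξ => by
      have h1 := hle ξ 1 zero_le_one (by
        rw [one_mul]; exact inv_le_one_of_one_le₀ (by nlinarith [sq_nonneg ‖ξ‖]))
      simpa using h1) hr0 h
  refine lt_of_le_of_lt (lintegral_mono fun ξ => ?_) hfin.lt_top
  rw [enorm_mul]

theorem MemBesov.const_smul {L : LittlewoodPaley} {s : ℝ} {r : ℝ≥0∞} (hr0 : r ≠ 0) (hr : r ≠ ∞)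
    {u : HomDist} (h : MemBesov L s 1 r u) (c : ℂ) : MemBesov L s 1 r (c • u) := by
  obtain ⟨f, hf⟩ := h.exists_hasFourier hr0
  rw [MemBesov, hf.besovNorm_eq_freqNorm] at h
  rw [MemBesov, (hf.const_smul c).besovNorm_eq_freqNorm]
  simp_rw [enorm_mul]
  rw [freqNorm_const_mul hr0 hr enorm_ne_top]
  exact ENNReal.mul_lt_top enorm_lt_top h

theorem freqNorm_size_le {L : LittlewoodPaley} {s : ℝ} {r : ℝ≥0∞} (hr : 1 ≤ r) {d : ℝˣ}
    {v₀ : Fin 4 → HomDist} {V₀ : E → Fin 4 → ℂ} (hV₀ : Measurable V₀)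
    (hv₀ : ∀ i, HasFourier (v₀ i) fun ξ => V₀ ξ i) :
    freqNorm L s r (size d V₀) ≤ ∑ i, besovNorm L s 1 r (scaleWeight d i • v₀ i) := by
  have h1 : ∀ i, besovNorm L s 1 r (scaleWeight d i • v₀ i) =
      freqNorm L s r fun ξ => ‖scaleWeight d i * V₀ ξ i‖ₑ := fun i =>
    ((hv₀ i).const_smul _).besovNorm_eq_freqNorm L s r
  simp_rw [h1]
  refine le_trans (freqNorm_mono fun ξ => ?_) (freqNorm_sum_le hr Finset.univ fun i =>
    (((measurable_pi_apply i).comp hV₀).const_mul (scaleWeight d i)).enorm)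
  simp_rw [enorm_mul]
  exact enorm_scale_le_sum d (V₀ ξ)

theorem exists_measurable_hasFourier {L : LittlewoodPaley} {s : ℝ} {r : ℝ≥0∞} (hr0 : r ≠ 0)
    {v₀ : Fin 4 → HomDist} (h : ∀ i, MemBesov L s 1 r (v₀ i)) :
    ∃ V₀ : E → Fin 4 → ℂ, Measurable V₀ ∧ ∀ i, HasFourier (v₀ i) fun ξ => V₀ ξ i := by
  choose f hf using fun i => (h i).exists_hasFourier hr0
  refine ⟨fun ξ i => (hf i).aestronglyMeasurable.mk (f i) ξ,
    measurable_pi_lambda _ fun i => (hf i).aestronglyMeasurable.stronglyMeasurable_mk.measurable,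
    fun i => (hf i).congr (hf i).aestronglyMeasurable.ae_eq_mk⟩

theorem enorm_apply_le_size (d : ℝˣ) (V : E → Fin 4 → ℂ) (ξ : E) (i : Fin 4) :
    ‖V ξ i‖ₑ ≤ ‖scaleWeight d i‖ₑ⁻¹ * size d V ξ := by
  have h0 : ‖scaleWeight d i‖ₑ ≠ 0 := by simpa using scaleWeight_ne_zero d i
  rw [← ENNReal.div_eq_inv_mul, ENNReal.le_div_iff_mul_le (Or.inl h0) (Or.inl enorm_ne_top), mul_comm]
  exact enorm_scaleWeight_mul_le d (V ξ) i

theorem inv_enorm_scaleWeight_ne_top (d : ℝˣ) (i : Fin 4) : ‖scaleWeight d i‖ₑ⁻¹ ≠ ∞ := by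
  simpa using scaleWeight_ne_zero d i

namespace IsPicardSolution

variable {P : Parameters} {d : ℝˣ} {M : ℝ} {I : Set ℝ} {V₀ : E → Fin 4 → ℂ}
  {V : ℝ → E → Fin 4 → ℂ} {L : LittlewoodPaley} {r : ℝ≥0∞} {v : ℝ → Fin 4 → HomDist}

theorem freqNorm_apply_ne_top (h : IsPicardSolution P d M I V₀ V) (hr : 1 ≤ r) (hr' : r ≠ ∞)
    (hV₀ : freqNorm L (-1) r (size d V₀) ≠ ∞) {t : ℝ} (ht : t ∈ I) (i : Fin 4) :
    freqNorm L (-1) r (fun ξ => ‖V t ξ i‖ₑ) ≠ ∞ := by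
  have hr0 : r ≠ 0 := (zero_lt_one.trans_le hr).ne'
  refine ne_top_of_le_ne_top ?_ (freqNorm_mono fun ξ => (enorm_apply_le_size d (V t) ξ i).trans
    (mul_le_mul_right (h.size_le_envelope ht ξ) _))
  rw [freqNorm_const_mul hr0 hr' (inv_enorm_scaleWeight_ne_top d i)]
  exact ENNReal.mul_ne_top (inv_enorm_scaleWeight_ne_top d i) (h.freqNorm_envelope_ne_top hr hr' hV₀)

theorem exists_hasFourier (h : IsPicardSolution P d M I V₀ V) (hr : 1 ≤ r) (hr' : r ≠ ∞)
    (hV₀ : freqNorm L (-1) r (size d V₀) ≠ ∞) :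
    ∃ v : ℝ → Fin 4 → HomDist, ∀ t ∈ I, ∀ i, HasFourier (v t i) fun ξ => V t ξ i := by
  have hr0 : r ≠ 0 := (zero_lt_one.trans_le hr).ne'
  have h1 : ∀ t i, ∃ u, t ∈ I → HasFourier u fun ξ => V t ξ i := by
    intro t i
    by_cases ht : t ∈ I
    · obtain ⟨u, hu⟩ := exists_hasFourier_of_freqNorm (L := L) hr0
        ((measurable_pi_apply i).comp h.measurable.of_uncurry_left)
        (h.freqNorm_apply_ne_top hr hr' hV₀ ht i)
      exact ⟨u, fun _ => hu⟩
    · exact ⟨0, fun ht' => absurd ht' ht⟩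
  choose v hv using h1
  exact ⟨v, fun t ht i => hv t i ht⟩

theorem continuousBesov (h : IsPicardSolution P d M I V₀ V) (hr : 1 ≤ r) (hr' : r ≠ ∞)
    (hV₀ : freqNorm L (-1) r (size d V₀) ≠ ∞)
    (hv : ∀ t ∈ I, ∀ i, HasFourier (v t i) fun ξ => V t ξ i) (i : Fin 4) :
    ContinuousBesov L (-1) 1 r I fun t => v t i := by
  have hr0 : r ≠ 0 := (zero_lt_one.trans_le hr).ne'
  refine fun t ht => ⟨?_, ?_⟩
  · rw [MemBesov, (hv t ht i).besovNorm_eq_freqNorm]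
    exact (h.freqNorm_apply_ne_top hr hr' hV₀ ht i).lt_top
  · have h1 := ENNReal.Tendsto.const_mul (h.tendsto_freqNorm_sub hr hr' hV₀ ht)
      (Or.inr (inv_enorm_scaleWeight_ne_top d i))
    rw [mul_zero] at h1
    refine tendsto_of_tendsto_of_tendsto_of_le_of_le' tendsto_const_nhds h1
      (Eventually.of_forall fun _ => zero_le) ?_
    filter_upwards [self_mem_nhdsWithin] with t' ht'
    rw [((hv t' ht' i).sub (hv t ht i)).besovNorm_eq_freqNorm,
      ← freqNorm_const_mul hr0 hr' (inv_enorm_scaleWeight_ne_top d i)]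
    exact freqNorm_mono fun ξ => enorm_apply_le_size d (V t' - V t) ξ i

theorem memCheminLerner (h : IsPicardSolution P d M I V₀ V) (hr : 1 ≤ r) (hr' : r ≠ ∞)
    (hV₀ : freqNorm L (-1) r (size d V₀) ≠ ∞)
    (hv : ∀ t ∈ I, ∀ i, HasFourier (v t i) fun ξ => V t ξ i) (i : Fin 4) {α s : ℝ} (hα₀ : 0 < α)
    (hα₁ : α < 1) (hs : s = α ∨ s = -α) :
    MemCheminLerner L (ENNReal.ofReal (2 / (1 + s))) s 1 r I fun t => v t i := by
  have hr0 : r ≠ 0 := (zero_lt_one.trans_le hr).ne'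
  have hs1 : -1 < s := by rcases hs with rfl | rfl <;> linarith
  have hs2 : s < 1 := by rcases hs with rfl | rfl <;> linarith
  have hc := inv_enorm_scaleWeight_ne_top d i
  refine ⟨stronglyMeasurableBesov_of_lintegral_ne_top L hr hr' h.measurableSet hs
    (f := fun t ξ => V t ξ i) ((measurable_pi_apply i).comp h.measurable) (fun t ht => hv t ht i) ?_, ?_⟩
  · filter_upwards [h.ae_lintegral_rpow_mul_size_ne_top hr0 (s := α) (by linarith) hα₁ hV₀,
      h.ae_lintegral_rpow_mul_size_ne_top hr0 (s := -α) (by linarith) (by linarith) hV₀] with t h1 h2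
    have hm := measurable_size (d := d) (h.measurable.of_uncurry_left (x := t))
    refine ne_top_of_le_ne_top ?_ (lintegral_mono fun ξ => enorm_apply_le_size d (V t) ξ i)
    rw [lintegral_const_mul' _ _ hc, lintegral_weightMeasure α hm]
    exact ENNReal.mul_ne_top hc (ENNReal.add_ne_top.2 ⟨h1, h2⟩)
  · rw [cheminLernerNorm_eq_freqTimeNorm h.measurableSet fun t ht => hv t ht i]
    refine lt_top_iff_ne_top.2 (ne_top_of_le_ne_top ?_ (freqTimeNorm_mono (Eventually.of_forall
      fun t => Eventually.of_forall fun ξ => enorm_apply_le_size d (V t) ξ i)))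
    have hp0 : 0 < 2 / (1 + s) := by
      have : 0 < 1 + s := by linarith
      positivity
    rw [freqTimeNorm_const_mul hp0 hr0 hr' hc]
    exact ENNReal.mul_ne_top hc (h.freqTimeNorm_ne_top hr hr' hs1 hs2.le hV₀)

theorem solutionClass (h : IsPicardSolution P d M I V₀ V) (hr : 1 ≤ r) (hr' : r ≠ ∞)
    (hV₀ : freqNorm L (-1) r (size d V₀) ≠ ∞)
    (hv : ∀ t ∈ I, ∀ i, HasFourier (v t i) fun ξ => V t ξ i) {α : ℝ} (hα₀ : 0 < α) (hα₁ : α < 1) :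
    SolutionClass L α r I v := fun i =>
  ⟨h.continuousBesov hr hr' hV₀ hv i, h.memCheminLerner hr hr' hV₀ hv i hα₀ hα₁ (Or.inl rfl), by
    have := h.memCheminLerner hr hr' hV₀ hv i hα₀ hα₁ (Or.inr rfl)
    rwa [← sub_eq_add_neg] at this⟩

theorem isMildSolution (h : IsPicardSolution P d M I V₀ V) {v₀ : Fin 4 → HomDist}
    (hv₀ : ∀ i, HasFourier (v₀ i) fun ξ => V₀ ξ i)
    (hv : ∀ t ∈ I, ∀ i, HasFourier (v t i) fun ξ => V t ξ i) : IsMildSolution P I v₀ v := by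
  refine ⟨V₀, V, hv₀, hv, h.measurable.aestronglyMeasurable, fun t ht => ?_⟩
  filter_upwards [h.ae_lintegral_forcing_ne_top] with ξ hξ
  exact ⟨h.intervalIntegrable hξ ht, congrFun (h.eq_picard t ht) ξ⟩

end IsPicardSolution

/-! ### Uniqueness in the solution class, and solvability for small free evolution. -/

/-- The solution class is contained in `L²(I; L¹)`, on the Fourier side. -/
theorem SolutionClass.zNorm_ne_top {L : LittlewoodPaley} {α : ℝ} (hα₀ : 0 < α) (hα₁ : α < 1)
    {r : ℝ≥0∞} (hr1 : 1 ≤ r) (hr2 : r ≤ 2) {I : Set ℝ} (hI : MeasurableSet I)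
    {v : ℝ → Fin 4 → HomDist} (hc : SolutionClass L α r I v) {V W : ℝ → E → Fin 4 → ℂ}
    (hv : ∀ t ∈ I, ∀ i, HasFourier (v t i) fun ξ => V t ξ i) (hW : Measurable (Function.uncurry W))
    (hVW : ∀ᵐ t ∂volume.restrict I, V t =ᵐ[volume] W t) (d : ℝˣ) : zNorm d I W ≠ ∞ := by
  have hr0 : r ≠ 0 := (zero_lt_one.trans_le hr1).ne'
  have hr' : r ≠ ∞ := ne_top_of_le_ne_top (by simp) hr2
  have key : ∀ p s : ℝ, 1 ≤ p →
      (∀ i, cheminLernerNorm L (ENNReal.ofReal p) s 1 r I (fun t => v t i) < ⊤) →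
      freqTimeNorm L p s r I (fun t => size d (W t)) ≠ ∞ := by
    intro p s hp h
    refine ne_top_of_le_ne_top (b := ∑ i, freqTimeNorm L p s r I
      (fun t ξ => ‖scaleWeight d i‖ₑ * ‖W t ξ i‖ₑ)) ?_ ?_
    · refine ENNReal.sum_ne_top.2 fun i _ => ?_
      rw [freqTimeNorm_const_mul (by linarith) hr0 hr' enorm_ne_top]
      refine ENNReal.mul_ne_top enorm_ne_top (ne_top_of_le_ne_top (h i).ne ?_)
      rw [cheminLernerNorm_eq_freqTimeNorm hI fun t ht => hv t ht i]
      refine freqTimeNorm_mono ?_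
      filter_upwards [hVW] with t ht
      filter_upwards [ht] with ξ hξ
      rw [hξ]
    · refine (freqTimeNorm_mono (Eventually.of_forall fun t => Eventually.of_forall fun ξ =>
        enorm_scale_le_sum d (W t ξ))).trans (freqTimeNorm_sum_le hp hr1 Finset.univ fun i => ?_)
      have h1 : Measurable fun q : ℝ × E => W q.1 q.2 i := (measurable_pi_apply i).comp hW
      exact h1.enorm.const_mul _
  have hz := zNorm_sq_le_freqTimeNorm L (d := d) (I := I) hα₀ hα₁ hr1 hr2 hW
  have h1 := key (2 / (1 - α)) (-α) (by rw [le_div_iff₀ (by linarith)]; linarith)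
    fun i => (hc i).2.2.2
  have h2 := key (2 / (1 + α)) α (by rw [le_div_iff₀ (by linarith)]; linarith)
    fun i => (hc i).2.1.2
  have h3 := ne_top_of_le_ne_top (ENNReal.mul_ne_top (ENNReal.mul_ne_top (by simp)
    (geomConst_ne_top hα₀)) (ENNReal.mul_ne_top h1 h2)) hz
  exact fun htop => h3 (by rw [htop]; rfl)

/-- The Fourier transform `V'` of a competing solution is replaced by a measurable version `W`,
equal to it at almost every time. The Duhamel term does not see the change, so `V' t` is the Picard
image of `W` at every `t ∈ I`, and it is the Picard images that uniqueness in L²(I; L¹) identifies.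
-/
theorem eqOn_of_isMildSolution {P : Parameters} {d : ℝˣ} {M : ℝ} {I : Set ℝ} {V₀ : E → Fin 4 → ℂ}
    {V : ℝ → E → Fin 4 → ℂ} (h : IsPicardSolution P d M I V₀ V) {L : LittlewoodPaley} {α : ℝ}
    (hα₀ : 0 < α) (hα₁ : α < 1) {r : ℝ≥0∞} (hr1 : 1 ≤ r) (hr2 : r ≤ 2) {v₀ : Fin 4 → HomDist}
    (hv₀ : ∀ i, HasFourier (v₀ i) fun ξ => V₀ ξ i) {v v' : ℝ → Fin 4 → HomDist}
    (hv : ∀ t ∈ I, ∀ i, HasFourier (v t i) fun ξ => V t ξ i)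
    (hc : SolutionClass L α r I v') (hm : IsMildSolution P I v₀ v') : EqOn v' v I := by
  obtain ⟨V₀', V', hv₀', hv', hmeas, hmild⟩ := hm
  let W : ℝ → E → Fin 4 → ℂ := Function.curry (hmeas.mk _)
  have hW : Measurable (Function.uncurry W) := hmeas.stronglyMeasurable_mk.measurable
  have hVW : ∀ᵐ t ∂volume.restrict I, V' t =ᵐ[volume] W t :=
    Measure.ae_ae_of_ae_prod hmeas.ae_eq_mk
  have hV₀ : V₀' =ᵐ[volume] V₀ := by
    have h1 : ∀ᵐ ξ : E, ∀ i, V₀' ξ i = V₀ ξ i := ae_all_iff.2 fun i => (hv₀' i).ae_eq (hv₀ i)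
    filter_upwards [h1] with ξ hξ
    exact funext hξ
  have hp : ∀ t ∈ I, V' t =ᵐ[volume] picard P V₀ W t := by
    intro t ht
    have hd : duhamel P V' t = duhamel P W t := duhamel_congr P (h.subset_Ici ht)
      (ae_restrict_of_ae_restrict_of_subset (h.Icc_subset t ht) hVW)
    filter_upwards [hmild t ht, hV₀] with ξ h1 h2
    rw [picard, ← hd, ← h2]
    exact h1.2
  have hz := hc.zNorm_ne_top hα₀ hα₁ hr1 hr2 h.measurableSet hv' hW hVW d
  intro T hT
  have heq := picard_eq_of_ae_eq (V₀ := V₀) h.bound h.M_nonneg h.subset_Ici h.Icc_subset h.measurable hW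
    h.zNorm_ne_top hz (by
      filter_upwards [ae_restrict_mem h.measurableSet] with t ht
      rw [← h.eq_picard t ht]) (by
      filter_upwards [ae_restrict_mem h.measurableSet, hVW] with t ht h1
      exact h1.symm.trans (hp t ht)) hT
  funext i
  refine (hv' T hT i).unique (hv T hT i) ?_
  filter_upwards [hp T hT] with ξ hξ
  rw [hξ, ← heq, ← h.eq_picard T hT]

/-- Well-posedness for data which are small in the norm of `L²(I; L¹)`. -/
theorem uniquelySolvable_of_small {P : Parameters} {d : ℝˣ} {M : ℝ} {I : Set ℝ}
    (hB : SemigroupBound P d M I) (hM : 0 ≤ M) (hI : MeasurableSet I) (hI0 : I ⊆ Ici 0)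
    (hIc : ∀ t ∈ I, Icc 0 t ⊆ I) {L : LittlewoodPaley} {α : ℝ} (hα₀ : 0 < α) (hα₁ : α < 1)
    {r : ℝ≥0∞} (hr1 : 1 ≤ r) (hr2 : r ≤ 2) {v₀ : Fin 4 → HomDist} {V₀ : E → Fin 4 → ℂ}
    (hV₀m : Measurable V₀) (hv₀ : ∀ i, HasFourier (v₀ i) fun ξ => V₀ ξ i)
    (hV₀ : freqNorm L (-1) r (size d V₀) ≠ ∞)
    (hfin : zNorm d I (fun t ξ => (semigroup P t ξ).mulVec (V₀ ξ)) ≠ ∞)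
    (hsmall : 8 * (lipConst P M * zNorm d I (fun t ξ => (semigroup P t ξ).mulVec (V₀ ξ))) ≤ 1) :
    UniquelySolvable L α r P I v₀ := by
  have hr' : r ≠ ∞ := ne_top_of_le_ne_top (by simp) hr2
  obtain ⟨V, hVm, hVz, hVp⟩ := exists_picard_fixedPoint hB hM hI hI0 hIc hV₀m hfin hsmall
  have h : IsPicardSolution P d M I V₀ V := ⟨hB, hM, hI, hI0, hIc, hV₀m, hVm, hVz, hVp⟩
  obtain ⟨v, hv⟩ := h.exists_hasFourier hr1 hr' hV₀
  exact ⟨v, ⟨h.solutionClass hr1 hr' hV₀ hv hα₀ hα₁, h.isMildSolution hv₀ hv⟩,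
    fun v' hv' => eqOn_of_isMildSolution h hα₀ hα₁ hr1 hr2 hv₀ hv hv'.1 hv'.2⟩

/-! ### Smallness of the free evolution -/

/-- The embedding into L²(I; L¹) is applied to the free evolution, whose two Chemin-Lerner norms are
bounded by the norm of the data. The constants `4^(1-α)` and `4^(1+α)` multiply to `4²`. -/
theorem zNorm_semigroup_sq_le {P : Parameters} {d : ℝˣ} {M : ℝ} {I : Set ℝ}
    (hB : SemigroupBound P d M I) (hM : 0 ≤ M) (hI : MeasurableSet I) (hI0 : I ⊆ Ici 0)
    (L : LittlewoodPaley) {α : ℝ} (hα₀ : 0 < α) (hα₁ : α < 1) {r : ℝ≥0∞} (hr1 : 1 ≤ r) (hr2 : r ≤ 2)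
    {V₀ : E → Fin 4 → ℂ} (hV₀ : Measurable V₀) :
    zNorm d I (fun t ξ => (semigroup P t ξ).mulVec (V₀ ξ)) ^ 2 ≤
      2 * geomConst α * (ENNReal.ofReal M * 4) ^ 2 *
        (heatConst P (2 / (1 - α)) * heatConst P (2 / (1 + α))) *
          freqNorm L (-1) r (size d V₀) ^ 2 := by
  have hr0 : r ≠ 0 := (zero_lt_one.trans_le hr1).ne'
  have hr' : r ≠ ∞ := ne_top_of_le_ne_top (by simp) hr2
  have hm : Measurable (Function.uncurry fun t ξ => (semigroup P t ξ).mulVec (V₀ ξ)) :=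
    measurable_mulVec (stronglyMeasurable_semigroup P) (hV₀.comp measurable_snd)
  have key : ∀ s : ℝ, -1 < s → s < 1 → freqTimeNorm L (2 / (1 + s)) s r I
      (fun t => size d fun ξ => (semigroup P t ξ).mulVec (V₀ ξ)) ≤
        ENNReal.ofReal M * (heatConst P (2 / (1 + s)) * 4 ^ (1 + s) * freqNorm L (-1) r (size d V₀)) := by
    intro s hs hs1
    have hs' : 0 < 1 + s := by linarith
    have hp0 : 0 < 2 / (1 + s) := by positivity
    refine (freqTimeNorm_mono (b := fun t ξ => ENNReal.ofReal M * (heatKer P t ξ * size d V₀ ξ))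
      ?_).trans ?_
    · filter_upwards [ae_restrict_mem hI] with t ht
      refine Eventually.of_forall fun ξ => ?_
      rw [← mul_assoc]
      exact hB.enorm_le hM ht ξ _
    · rw [freqTimeNorm_const_mul hp0 hr0 hr' ENNReal.ofReal_ne_top]
      gcongr
      refine (freqTimeNorm_heatKer_le P hs hs1.le hr0 hr' hI hI0 (measurable_size hV₀)).trans_eq ?_
      rw [abs_neg, abs_of_pos hs']
  have h1 := key (-α) (by linarith) (by linarith)
  have h2 := key α (by linarith) hα₁
  rw [← sub_eq_add_neg] at h1
  refine (zNorm_sq_le_freqTimeNorm L hα₀ hα₁ hr1 hr2 hm).trans ?_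
  have h4 : (4 : ℝ≥0∞) ^ (1 - α) * 4 ^ (1 + α) = 4 ^ 2 := by
    rw [← ENNReal.rpow_add _ _ (by simp) (by simp)]
    ring_nf
    norm_cast
  calc _ ≤ 2 * geomConst α * _ := mul_le_mul_right (mul_le_mul' h1 h2) _
    _ = 2 * geomConst α * ENNReal.ofReal M ^ 2 * (4 ^ (1 - α) * 4 ^ (1 + α)) *
        (heatConst P (2 / (1 - α)) * heatConst P (2 / (1 + α))) *
          freqNorm L (-1) r (size d V₀) ^ 2 := by ring
    _ = _ := by rw [h4]; ring

theorem heatConst_eq (P : Parameters) {p : ℝ} (hp : 0 < p) : heatConst P p =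
    ENNReal.ofReal (1 / (4 * Real.pi ^ 2 * p)) ^ (1 / p) * ENNReal.ofReal (1 / P.ν) ^ (1 / p) := by
  have hν := P.ν_pos
  rw [heatConst, ← ENNReal.mul_rpow_of_nonneg _ _ (by positivity), ← ENNReal.ofReal_mul (by positivity)]
  congr 2
  field_simp

/-- The smallness condition scales like the viscosity. -/
theorem exists_lipConst_mul_zNorm_sq_le (L : LittlewoodPaley) {α : ℝ} (hα₀ : 0 < α) (hα₁ : α < 1)
    {r : ℝ≥0∞} (hr1 : 1 ≤ r) (hr2 : r ≤ 2) : ∃ K : ℝ≥0∞, K ≠ ∞ ∧ ∀ (P : Parameters) (d : ℝˣ)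
      (I : Set ℝ), SemigroupBound P d 1 I → MeasurableSet I → I ⊆ Ici 0 →
        ∀ V₀ : E → Fin 4 → ℂ, Measurable V₀ →
          (lipConst P 1 * zNorm d I (fun t ξ => (semigroup P t ξ).mulVec (V₀ ξ))) ^ 2 ≤
            K * (ENNReal.ofReal (1 / P.ν) * freqNorm L (-1) r (size d V₀)) ^ 2 := by
  let k : ℝ → ℝ≥0∞ := fun p => ENNReal.ofReal (1 / (4 * Real.pi ^ 2 * p)) ^ (1 / p)
  have hk : ∀ p, 0 < p → k p ≠ ∞ := fun p hp =>
    ENNReal.rpow_ne_top_of_nonneg (by positivity) ENNReal.ofReal_ne_top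
  have hα₂ : 0 < 1 - α := by linarith
  have hα₃ : 0 < 1 + α := by linarith
  refine ⟨duhamelConst 1 ^ 2 * k 2 ^ 2 * (2 * geomConst α * 4 ^ 2 * (k (2 / (1 - α)) * k (2 / (1 + α)))),
    ?_, fun P d I hB hI hI0 V₀ hV₀ => ?_⟩
  · have h1 := hk 2 two_pos
    have h2 := hk (2 / (1 - α)) (by positivity)
    have h3 := hk (2 / (1 + α)) (by positivity)
    have h4 := geomConst_ne_top hα₀
    have h5 := duhamelConst_ne_top 1
    finiteness
  · have hz := zNorm_semigroup_sq_le hB zero_le_one hI hI0 L hα₀ hα₁ hr1 hr2 hV₀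
    set n := ENNReal.ofReal (1 / P.ν) with hn
    have hn0 : n ≠ 0 := by
      have := P.ν_pos
      simpa [hn] using this
    have hn1 : n ≠ ∞ := ENNReal.ofReal_ne_top
    -- Each of the two squares contributes one power of `1/ν`: here with exponent `2 · 1/2`, and
    -- below with `(1-α)/2 + (1+α)/2 = 1`. Together they form the square of `1/ν`.
    have e1 : heatConst P 2 ^ 2 = k 2 ^ 2 * n := by
      rw [heatConst_eq P two_pos, mul_pow, ← ENNReal.rpow_natCast (n ^ _), ← ENNReal.rpow_mul]
      norm_num [k]
    have e2 : heatConst P (2 / (1 - α)) * heatConst P (2 / (1 + α)) =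
        k (2 / (1 - α)) * k (2 / (1 + α)) * n := by
      rw [heatConst_eq P (by positivity), heatConst_eq P (by positivity), mul_mul_mul_comm,
        ← ENNReal.rpow_add _ _ hn0 hn1]
      congr 1
      have : 1 / (2 / (1 - α)) + 1 / (2 / (1 + α)) = 1 := by field_simp; ring
      rw [this, ENNReal.rpow_one]
    calc _ = duhamelConst 1 ^ 2 * heatConst P 2 ^ 2 *
          zNorm d I (fun t ξ => (semigroup P t ξ).mulVec (V₀ ξ)) ^ 2 := by rw [lipConst]; ring
      _ ≤ duhamelConst 1 ^ 2 * heatConst P 2 ^ 2 * _ := mul_le_mul_right hz _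
      _ = _ := by rw [e1, e2, ENNReal.ofReal_one]; ring

/-- The free evolution is small in `L²(I; L¹)` on short time intervals. -/
theorem exists_small_time {d : ℝˣ} {Λ : ℝ≥0∞} (hΛ : Λ ≠ ∞)
    {U : ℝ → E → Fin 4 → ℂ} (hfin : zNorm d (Icc 0 1) U ≠ ∞) :
    ∃ T : ℝ, 0 < T ∧ T ≤ 1 ∧ Λ * zNorm d (Icc 0 T) U ≤ 1 := by
  have h1 : ∫⁻ t in Icc 0 1, (∫⁻ ξ, size d (U t) ξ) ^ 2 ≠ ∞ := by
    rw [← zNorm_sq]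
    exact ENNReal.pow_ne_top hfin
  have hε : ((Λ ^ 2)⁻¹ : ℝ≥0∞) ≠ 0 := ENNReal.inv_ne_zero.2 (ENNReal.pow_ne_top hΛ)
  obtain ⟨δ, hδ, hs⟩ := exists_pos_setLIntegral_lt_of_measure_lt h1 hε
  obtain ⟨T, hT0, hTδ⟩ : ∃ T : ℝ, 0 < T ∧ ENNReal.ofReal T < δ := by
    obtain ⟨x, hx0, hxδ⟩ := ENNReal.lt_iff_exists_nnreal_btwn.1 hδ
    exact ⟨x, by exact_mod_cast hx0, by simpa using hxδ⟩
  refine ⟨min T 1, lt_min hT0 one_pos, min_le_right _ _, ?_⟩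
  have h2 : (volume.restrict (Icc (0 : ℝ) 1)) (Icc 0 (min T 1)) < δ := by
    refine (Measure.restrict_apply_le _ _).trans_lt ?_
    rw [Real.volume_Icc, sub_zero]
    exact (ENNReal.ofReal_le_ofReal (min_le_left _ _)).trans_lt hTδ
  have h3 := hs _ h2
  rw [Measure.restrict_restrict measurableSet_Icc,
    inter_eq_self_of_subset_left (Icc_subset_Icc_right (min_le_right _ _)), ← zNorm_sq] at h3
  rw [← pow_le_one_iff two_ne_zero, mul_pow]
  calc _ ≤ Λ ^ 2 * (Λ ^ 2)⁻¹ := by gcongr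
    _ ≤ 1 := ENNReal.mul_inv_le_one _

end

end PrimitiveEquations

/-! ### Proof of the theorem. -/

theorem theorem1p5 (L : LittlewoodPaley) (α : ℝ) (hα₀ : 0 < α) (hα₁ : α < 1)
    (r : ℝ≥0∞) (hr₁ : 1 ≤ r) (hr₂ : r ≤ 2) :
    (∀ P : Parameters, P.ν / P.μ = 1 →
      ∀ (u₀ : Fin 3 → HomDist) (θ₀ : HomDist),
        (∀ i, MemBesov L (-1) 1 r (u₀ i)) → MemBesov L (-1) 1 r θ₀ → divergence u₀ = 0 →
        ∃ T : ℝ, 0 < T ∧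
          UniquelySolvable L α r P (Icc 0 T) ![u₀ 0, u₀ 1, u₀ 2, θ₀]) ∧
    ∃ C : ℝ, 0 < C ∧ ∀ P : Parameters, P.ν / P.μ = 1 → 0 < P.𝒩 →
      ∀ (u₀ : Fin 3 → HomDist) (θ₀ : HomDist),
        (∀ i, MemBesov L (-1) 1 r (u₀ i)) → MemBesov L (-1) 1 r θ₀ → divergence u₀ = 0 →
        (∑ i, besovNorm L (-1) 1 r (u₀ i)) +
            besovNorm L (-1) 1 r (((√P.g / P.𝒩 : ℝ) : ℂ) • θ₀) ≤ ENNReal.ofReal (C * P.ν) →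
        UniquelySolvable L α r P (Ici 0) ![u₀ 0, u₀ 1, u₀ 2, θ₀] := by
  have hr0 : r ≠ 0 := (zero_lt_one.trans_le hr₁).ne'
  have hr' : r ≠ ∞ := ne_top_of_le_ne_top (by simp) hr₂
  have hdata : ∀ (u₀ : Fin 3 → HomDist) (θ₀ : HomDist), (∀ i, MemBesov L (-1) 1 r (u₀ i)) →
      MemBesov L (-1) 1 r θ₀ → ∀ i, MemBesov L (-1) 1 r (![u₀ 0, u₀ 1, u₀ 2, θ₀] i) := by
    intro u₀ θ₀ hu hθ i
    fin_cases i
    · exact hu 0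
    · exact hu 1
    · exact hu 2
    · exact hθ
  have hnorm : ∀ (d : ℝˣ) (v₀ : Fin 4 → HomDist) (V₀ : E → Fin 4 → ℂ), Measurable V₀ →
      (∀ i, MemBesov L (-1) 1 r (v₀ i)) → (∀ i, HasFourier (v₀ i) fun ξ => V₀ ξ i) →
      freqNorm L (-1) r (size d V₀) ≠ ∞ := fun d v₀ V₀ hm hv hV =>
    ne_top_of_le_ne_top (ENNReal.sum_ne_top.2 fun i _ => ((hv i).const_smul hr0 hr' _).ne)
      (freqNorm_size_le hr₁ hm hV)
  have hz : ∀ {P : Parameters} {d : ℝˣ} {M : ℝ} {I : Set ℝ}, SemigroupBound P d M I → 0 ≤ M →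
      MeasurableSet I → I ⊆ Ici 0 → ∀ V₀ : E → Fin 4 → ℂ, Measurable V₀ →
      freqNorm L (-1) r (size d V₀) ≠ ∞ →
      zNorm d I (fun t ξ => (semigroup P t ξ).mulVec (V₀ ξ)) ≠ ∞ := by
    intro P d M I hB hM hI hI0 V₀ hV₀ hfin htop
    have h1 := zNorm_semigroup_sq_le hB hM hI hI0 L hα₀ hα₁ hr₁ hr₂ hV₀
    rw [htop] at h1
    have h2 := heatConst_ne_top P (p := 2 / (1 - α)) (by have : 0 < 1 - α := by linarith
                                                         positivity)
    have h3 := heatConst_ne_top P (p := 2 / (1 + α)) (by positivity)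
    have h4 := geomConst_ne_top hα₀
    have h5 : 2 * geomConst α * (ENNReal.ofReal M * 4) ^ 2 *
        (heatConst P (2 / (1 - α)) * heatConst P (2 / (1 + α))) *
          freqNorm L (-1) r (size d V₀) ^ 2 ≠ ∞ := by finiteness
    exact h5 (top_le_iff.1 ((by simp : (∞ : ℝ≥0∞) ≤ ∞ ^ 2).trans h1))
  constructor
  · intro P hP u₀ θ₀ hu hθ _
    obtain ⟨V₀, hV₀m, hV₀⟩ := exists_measurable_hasFourier hr0 (hdata u₀ θ₀ hu hθ)
    have hfin := hnorm 1 _ V₀ hV₀m (hdata u₀ θ₀ hu hθ) hV₀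
    obtain ⟨M, hM, hB⟩ := exists_semigroupBound P hP
    -- The semigroup bound holds on `[0, 1]`; shrinking the interval keeps `M`, hence the Lipschitz
    -- constant, fixed while the free evolution becomes small.
    obtain ⟨T, hT0, hT1, hT⟩ := exists_small_time (Λ := 8 * lipConst P M)
      (ENNReal.mul_ne_top (by simp) (lipConst_ne_top P M))
      (hz hB hM.le measurableSet_Icc Icc_subset_Ici_self V₀ hV₀m hfin)
    have hBT : SemigroupBound P 1 M (Icc 0 T) := fun t ht => hB t ⟨ht.1, ht.2.trans hT1⟩
    refine ⟨T, hT0, uniquelySolvable_of_small hBT hM.le measurableSet_Icc Icc_subset_Ici_self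
      (fun t ht => Icc_subset_Icc_right ht.2) hα₀ hα₁ hr₁ hr₂ hV₀m hV₀ hfin
      (hz hBT hM.le measurableSet_Icc Icc_subset_Ici_self V₀ hV₀m hfin) ?_⟩
    rwa [← mul_assoc]
  · obtain ⟨K, hK, hKb⟩ := exists_lipConst_mul_zNorm_sq_le L hα₀ hα₁ hr₁ hr₂
    -- With this constant the square of the smallness quantity is at most `8² K / (8(1+K))² =
    -- K/(1+K)² ≤ 1`.
    refine ⟨1 / (8 * (1 + K.toReal)), by positivity, fun P hP h𝒩 u₀ θ₀ hu hθ _ hsmall => ?_⟩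
    have hd0 : √P.g / P.𝒩 ≠ 0 := by
      have := P.g_pos
      positivity
    obtain ⟨V₀, hV₀m, hV₀⟩ := exists_measurable_hasFourier hr0 (hdata u₀ θ₀ hu hθ)
    -- With the energy weight the rescaled norm of the data is bounded by the norm in the
    -- hypothesis, and the semigroup bound has `M = 1` on `[0, ∞)`.
    set d : ℝˣ := Units.mk0 _ hd0 with hd
    have hfin := hnorm d _ V₀ hV₀m (hdata u₀ θ₀ hu hθ) hV₀
    have hB := semigroupBound_energy P hP h𝒩 d rfl
    refine uniquelySolvable_of_small hB zero_le_one measurableSet_Ici le_rfl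
      (fun t _ => Icc_subset_Ici_self) hα₀ hα₁ hr₁ hr₂ hV₀m hV₀ hfin
      (hz hB zero_le_one measurableSet_Ici le_rfl V₀ hV₀m hfin) ?_
    have hN : freqNorm L (-1) r (size d V₀) ≤ ENNReal.ofReal (1 / (8 * (1 + K.toReal)) * P.ν) := by
      refine (freqNorm_size_le hr₁ hV₀m hV₀).trans (le_trans (le_of_eq ?_) hsmall)
      rw [Fin.sum_univ_four, Fin.sum_univ_three]
      simp [scaleWeight, hd]
    have hnu : ENNReal.ofReal (1 / P.ν) * freqNorm L (-1) r (size d V₀) ≤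
        ENNReal.ofReal (1 / (8 * (1 + K.toReal))) := by
      refine (mul_le_mul_right hN _).trans (le_of_eq ?_)
      have := P.ν_pos
      rw [← ENNReal.ofReal_mul (by positivity)]
      congr 1
      field_simp
    rw [← pow_le_one_iff two_ne_zero, mul_pow]
    calc _ ≤ 8 ^ 2 * (K * ENNReal.ofReal (1 / (8 * (1 + K.toReal))) ^ 2) := by
          gcongr
          refine (hKb P d _ hB measurableSet_Ici le_rfl V₀ hV₀m).trans ?_
          gcongr
      _ = ENNReal.ofReal (8 ^ 2 * (K.toReal * (1 / (8 * (1 + K.toReal))) ^ 2)) := by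
          rw [ENNReal.ofReal_mul (by norm_num), ENNReal.ofReal_mul ENNReal.toReal_nonneg,
            ENNReal.ofReal_toReal hK, ENNReal.ofReal_pow (p := 1 / (8 * (1 + K.toReal))) (by positivity)]
          norm_num
      _ ≤ 1 := by
          rw [ENNReal.ofReal_le_one]
          have hK0 : 0 ≤ K.toReal := ENNReal.toReal_nonneg
          have : 8 ^ 2 * (K.toReal * (1 / (8 * (1 + K.toReal))) ^ 2) =
              K.toReal / (1 + K.toReal) ^ 2 := by field_simp
          rw [this, div_le_one (by positivity)]
          nlinarith
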